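/- Let $M$ be a smooth $n$-dimensional manifold with a twisted Poisson structure $(\pi,H)$: $\pi$ is a bivector field and $H$ a closed $3$-form such that, for $\{f,g\}=\pi(df,dg)$ and $\pi^\#\varepsilon=\pi(\varepsilon,\cdot)$, $$\{f,\{g,h\}\}+\{g,\{h,f\}\}+\{h,\{f,g\}\}=H(\pi^\#df,\pi^\#dg,\pi^\#dh).$$ On the graded manifold $T^*[1]M$ with local coordinates $x^i$ (degree $0$) and $p_i$ (degree $1$) consider the degree $1$ vector field $$Q=\pi^{ji}p_j\frac{\partial}{\partial x^i}-\tfrac12 C_i^{jk}p_jp_k\frac{\partial}{\partial p_i},\qquad C_i^{jk}=\partial_i\pi^{jk}-H_{iab}\pi^{ja}\pi^{kb},$$ and on $T[1]T^*[1]M$, with local coordinates $x^i,p_i,\theta^i=dx^i,\psi_i=dp_i$ of total degrees $0,1,1,2$ and signs governed by the total degree, the vector field $\tilde Q=d+\mathcal L_Q$, where $d=\theta^i\partial_{x^i}+\psi_i\partial_{p_i}$ and $\mathcal L_Q=[\iota_Q,d]$. Let $\tilde{\mathcal G}$ be the space of (global) vector fields of degree $-1$ on $T[1]T^*[1]M$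 which in local coordinates have the form $$\tilde\varepsilon=\varepsilon_i\frac{\partial}{\partial p_i}+\alpha_{ij}\theta^j\frac{\partial}{\partial\psi_i},$$ with $\varepsilon_i,\alpha_{ij}$ smooth functions of $x$, and let $[\tilde\varepsilon,\tilde\varepsilon']_{\tilde Q}=[\tilde\varepsilon,[\tilde Q,\tilde\varepsilon']]$ (graded commutators). Let $\mathcal G=\Gamma(T^*M)$ with the bracket $$[\varepsilon^1,\varepsilon^2]=\mathcal L_{\pi^\#\varepsilon^1}\varepsilon^2-\mathcal L_{\pi^\#\varepsilon^2}\varepsilon^1-d(\pi(\varepsilon^1,\varepsilon^2))+\iota_{\pi^\#\varepsilon^1}\iota_{\pi^\#\varepsilon^2}H,$$ and let $\mathcal A=\Gamma(T^*M\otimes T^*M)$ be the space of covariant $2$-tensor fields with the bracket $$[\bar\alpha,\bar\beta]=\langle\pi^{23},\bar\alpha\otimes\bar\beta-\bar\beta\otimes\bar\alpha\rangle,\qquad \langle\pi^{23},\bar\alpha\otimes\bar\beta\rangle_{il}=\pi^{jk}\bar\alpha_{ij}\bar\beta_{kl}.$$ Then $\tilde{\mathcal G}$ is closed under $[\cdot,\cdot]_{\tilde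 Q}$; $\tilde{\mathcal G}$, $\mathcal G$ and $\mathcal A$ are real Lie algebras with these brackets; the formula $$\rho(\varepsilon)\bar\alpha=\mathcal L_{\pi^\#\varepsilon}\bar\alpha-\langle\pi^{23},\mathcal D_H\varepsilon\otimes\bar\alpha\rangle,\qquad \mathcal D_H\varepsilon=d\varepsilon+\iota_{\pi^\#\varepsilon}H,$$ defines an action of the Lie algebra $\mathcal G$ on $\mathcal A$ by derivations; and the Lie algebra $(\tilde{\mathcal G},[\cdot,\cdot]_{\tilde Q})$ is isomorphic to the semidirect product $\mathcal G\ltimes\mathcal A$ defined by $\rho$. -/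

import Mathlib

open scoped Manifold ContDiff TensorProduct

noncomputable section

namespace TwistedPSM

/-! ## Superfunctions on a coordinate patch of `T[1]T^*[1]M`

`A` plays the role of the algebra of smooth functions on a coordinate patch, with coordinate
derivations `pd i = ∂/∂x^i`.  The generators are `x` (total degree 0), `p_i` and `θ^i = d x^i`
(total degree 1) and `ψ_i = d p_i` (total degree 2); signs are governed by the total degree, so
`p` and `θ` anticommute among each other and `ψ` is central. -/

section Local

/-- The polynomial algebra `ℝ[ψ]` on the even generators `ψ_i`. -/
abbrev Poly (n : ℕ) : Type := MvPolynomial (Fin n) ℝ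

/-- The exterior algebra on the odd generators `θ^i` (index `inl i`) and `p_i` (index `inr i`). -/
abbrev Ext (n : ℕ) : Type := ExteriorAlgebra ℝ (Fin n ⊕ Fin n → ℝ)

/-- The free graded commutative real algebra on the `θ^i`, `p_i`, `ψ_i`. -/
def Fibre (n : ℕ) : Type := Poly n ⊗[ℝ] Ext n

instance (n : ℕ) : Ring (Fibre n) := inferInstanceAs (Ring (Poly n ⊗[ℝ] Ext n))

instance (n : ℕ) : Algebra ℝ (Fibre n) := inferInstanceAs (Algebra ℝ (Poly n ⊗[ℝ] Ext n))

/-- Superfunctions `A[θ, p | ψ]` on a coordinate patch with function algebra `A`. -/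
def SFun (n : ℕ) (A : Type*) [CommRing A] [Algebra ℝ A] : Type _ := A ⊗[ℝ] Fibre n

variable {n : ℕ} {A : Type*} [CommRing A] [Algebra ℝ A]

instance : Ring (SFun n A) := inferInstanceAs (Ring (A ⊗[ℝ] Fibre n))

instance : Algebra ℝ (SFun n A) := inferInstanceAs (Algebra ℝ (A ⊗[ℝ] Fibre n))

/-- The superfunction `a * q(ψ) * e(θ, p)`. -/
def SFun.mk (a : A) (q : Poly n) (e : Ext n) : SFun n A :=
  (a ⊗ₜ[ℝ] ((q ⊗ₜ[ℝ] e : Poly n ⊗[ℝ] Ext n) : Fibre n) : A ⊗[ℝ] Fibre n)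

/-- The linear map `a * q(ψ) * e(θ, p) ↦ f(a) * g(q) * h(e)`. -/
def SFun.map (f : A →ₗ[ℝ] A) (g : Poly n →ₗ[ℝ] Poly n) (h : Ext n →ₗ[ℝ] Ext n) :
    SFun n A →ₗ[ℝ] SFun n A :=
  (TensorProduct.map f ((TensorProduct.map g h : Poly n ⊗[ℝ] Ext n →ₗ[ℝ] Poly n ⊗[ℝ] Ext n) :
    Fibre n →ₗ[ℝ] Fibre n) : A ⊗[ℝ] Fibre n →ₗ[ℝ] A ⊗[ℝ] Fibre n)

theorem SFun.map_mk (f : A →ₗ[ℝ] A) (g : Poly n →ₗ[ℝ] Poly n) (h : Ext n →ₗ[ℝ] Ext n)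
    (a : A) (q : Poly n) (e : Ext n) : SFun.map f g h (SFun.mk a q e) = SFun.mk (f a) (g q) (h e) :=
  rfl

theorem SFun.mk_mul_mk (a b : A) (q r : Poly n) (d e : Ext n) :
    SFun.mk a q d * SFun.mk b r e = SFun.mk (a * b) (q * r) (d * e) := by
  have h : ((q ⊗ₜ[ℝ] d : Poly n ⊗[ℝ] Ext n) : Fibre n) * ((r ⊗ₜ[ℝ] e : Poly n ⊗[ℝ] Ext n) : Fibre n)
      = (((q * r) ⊗ₜ[ℝ] (d * e) : Poly n ⊗[ℝ] Ext n) : Fibre n) :=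
    Algebra.TensorProduct.tmul_mul_tmul q r d e
  exact (Algebra.TensorProduct.tmul_mul_tmul (A := A) (B := Fibre n) a b _ _).trans
    (congrArg (fun z : Fibre n => ((a * b) ⊗ₜ[ℝ] z : A ⊗[ℝ] Fibre n)) h)

theorem SFun.one_eq : (1 : SFun n A) = SFun.mk 1 1 1 := rfl

theorem SFun.induct {P : SFun n A → Prop} (zero : P 0) (mk : ∀ a q e, P (SFun.mk a q e))
    (add : ∀ x y, P x → P y → P (x + y)) (x : SFun n A) : P x := by
  refine TensorProduct.induction_on (motive := P) x zero (fun a y => ?_) add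
  refine TensorProduct.induction_on (R := ℝ) (M := Poly n) (N := Ext n)
    (motive := fun y => P (a ⊗ₜ[ℝ] (y : Fibre n) : A ⊗[ℝ] Fibre n)) y ?_ (fun q e => mk a q e)
    fun y z hy hz => ?_
  · have h : (a ⊗ₜ[ℝ] (0 : Fibre n) : A ⊗[ℝ] Fibre n) = 0 := TensorProduct.tmul_zero _ _
    exact h.symm ▸ zero
  · have h : (a ⊗ₜ[ℝ] ((y : Fibre n) + (z : Fibre n)) : A ⊗[ℝ] Fibre n)
        = a ⊗ₜ[ℝ] (y : Fibre n) + a ⊗ₜ[ℝ] (z : Fibre n) := TensorProduct.tmul_add _ _ _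
    exact h.symm ▸ add _ _ hy hz

/-- Inclusion of the base functions as an algebra homomorphism. -/
def fnHom : A →ₐ[ℝ] SFun n A :=
  (Algebra.TensorProduct.includeLeft : A →ₐ[ℝ] A ⊗[ℝ] Fibre n)

/-- Inclusion of the algebra of odd generators. -/
def extHom : Ext n →ₐ[ℝ] SFun n A :=
  (Algebra.TensorProduct.includeRight : Fibre n →ₐ[ℝ] A ⊗[ℝ] Fibre n).comp
    (Algebra.TensorProduct.includeRight : Ext n →ₐ[ℝ] Poly n ⊗[ℝ] Ext n)

/-- A function on the base, viewed as a superfunction. -/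
def fn (f : A) : SFun n A := fnHom f

/-- The even generator `ψ_i = d p_i`. -/
def psi (i : Fin n) : SFun n A := SFun.mk 1 (MvPolynomial.X i) 1

/-- The odd generators: `odd (inl i) = θ^i`, `odd (inr i) = p_i`. -/
def odd (s : Fin n ⊕ Fin n) : SFun n A :=
  extHom (ExteriorAlgebra.ι ℝ (Pi.single s (1 : ℝ) : Fin n ⊕ Fin n → ℝ))

/-- The odd generator `θ^i = d x^i`. -/
def theta (i : Fin n) : SFun n A := odd (Sum.inl i)

/-- The odd generator `p_i`. -/
def mom (i : Fin n) : SFun n A := odd (Sum.inr i)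

theorem fn_eq (f : A) : (fn f : SFun n A) = SFun.mk f 1 1 := rfl

theorem extHom_eq (e : Ext n) : (extHom e : SFun n A) = SFun.mk 1 1 e := rfl

theorem odd_eq (s : Fin n ⊕ Fin n) :
    (odd s : SFun n A) = SFun.mk 1 1 (ExteriorAlgebra.ι ℝ (Pi.single s (1 : ℝ))) := rfl

/-- A derivation of the base functions (e.g. `∂/∂x^i`), extended to superfunctions by zero on the
generators `θ, p, ψ`. -/
def dBase (D : Derivation ℝ A A) : SFun n A →ₗ[ℝ] SFun n A :=
  SFun.map (D : A →ₗ[ℝ] A) LinearMap.id LinearMap.id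

/-- The even derivation `∂/∂ψ_i`. -/
def dPsi (i : Fin n) : SFun n A →ₗ[ℝ] SFun n A :=
  SFun.map LinearMap.id
    (MvPolynomial.pderiv i : Derivation ℝ (Poly n) (Poly n)).toLinearMap LinearMap.id

/-- The odd (left) derivations `∂/∂θ^i` (for `inl i`) and `∂/∂p_i` (for `inr i`): contraction of
the exterior algebra with a dual basis vector. -/
def dOdd (s : Fin n ⊕ Fin n) : SFun n A →ₗ[ℝ] SFun n A :=
  SFun.map LinearMap.id LinearMap.id
    (CliffordAlgebra.contractLeft (Q := (0 : QuadraticForm ℝ (Fin n ⊕ Fin n → ℝ)))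
      (LinearMap.proj s : (Fin n ⊕ Fin n → ℝ) →ₗ[ℝ] ℝ))

/-- The odd derivation `∂/∂θ^i`. -/
def dTheta (i : Fin n) : SFun n A →ₗ[ℝ] SFun n A := dOdd (Sum.inl i)

/-- The odd derivation `∂/∂p_i`. -/
def dMom (i : Fin n) : SFun n A →ₗ[ℝ] SFun n A := dOdd (Sum.inr i)

/-- Left multiplication by a superfunction. -/
def lmul (a : SFun n A) : SFun n A →ₗ[ℝ] SFun n A := LinearMap.mulLeft ℝ a

/-- The vector field `ε_i ∂/∂p_i + α_{ij} θ^j ∂/∂ψ_i` of degree `-1`. -/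
def epsField (ε : Fin n → A) (α : Fin n → Fin n → A) : SFun n A →ₗ[ℝ] SFun n A :=
  ∑ i, lmul (fn (ε i)) ∘ₗ dMom i + ∑ i, ∑ j, lmul (fn (α i j) * theta j) ∘ₗ dPsi i

variable (pd : Fin n → Derivation ℝ A A)

/-- The de Rham differential `d = θ^i ∂/∂x^i + ψ_i ∂/∂p_i` of `T^*[1]M`. -/
def deRham : SFun n A →ₗ[ℝ] SFun n A :=
  ∑ i, (lmul (theta i) ∘ₗ dBase (pd i) + lmul (psi i) ∘ₗ dMom i)

/-- `C_i^{jk} = ∂_i π^{jk} - H_{iab} π^{ja} π^{kb}`: the structure functions of the twisted Poisson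
Lie algebroid, `[d x^j, d x^k] = C_i^{jk} d x^i`. -/
def structC (π : Fin n → Fin n → A) (H : Fin n → Fin n → Fin n → A) (i j k : Fin n) : A :=
  pd i (π j k) - ∑ a, ∑ b, H i a b * π j a * π k b

/-- The component `Q x^i = π^{ji} p_j` of the vector field `Q` on `T^*[1]M`. -/
def Qx (π : Fin n → Fin n → A) (i : Fin n) : SFun n A := ∑ j, fn (π j i) * mom j

/-- The component `Q p_i = -1/2 C_i^{jk} p_j p_k` of the vector field `Q` on `T^*[1]M`. -/
def Qp (π : Fin n → Fin n → A) (H : Fin n → Fin n → Fin n → A) (i : Fin n) : SFun n A :=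
  -((1 / 2 : ℝ) • ∑ j, ∑ k, fn (structC pd π H i j k) * mom j * mom k)

/-- The contraction `ι_Q = (Q x^i) ∂/∂θ^i + (Q p_i) ∂/∂ψ_i`, of total degree 0. -/
def contractQ (π : Fin n → Fin n → A) (H : Fin n → Fin n → Fin n → A) :
    SFun n A →ₗ[ℝ] SFun n A :=
  ∑ i, (lmul (Qx π i) ∘ₗ dTheta i + lmul (Qp pd π H i) ∘ₗ dPsi i)

/-- `Q̃ = d + L_Q`, with `L_Q = [ι_Q, d]` (graded commutator, `ι_Q` even). -/
def Qtilde (π : Fin n → Fin n → A) (H : Fin n → Fin n → Fin n → A) :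
    SFun n A →ₗ[ℝ] SFun n A :=
  deRham pd + (contractQ pd π H ∘ₗ deRham pd - deRham pd ∘ₗ contractQ pd π H)

/-- The derived bracket `[D, [Q, D']]` of two odd vector fields `D, D'` with an odd `Q`
(graded commutators: `[Q, D'] = Q D' + D' Q` is even). -/
def derivedBracket (Q D D' : SFun n A →ₗ[ℝ] SFun n A) : SFun n A →ₗ[ℝ] SFun n A :=
  D ∘ₗ (Q ∘ₗ D' + D' ∘ₗ Q) - (Q ∘ₗ D' + D' ∘ₗ Q) ∘ₗ D

/-! ### Tensor calculus in a coordinate patch -/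

/-- `π^# ε = π(ε, ·)`, i.e. `(π^# ε)^k = π^{jk} ε_j`. -/
def sharp (π : Fin n → Fin n → A) (ε : Fin n → A) (k : Fin n) : A := ∑ j, π j k * ε j

/-- Lie derivative of a 1-form. -/
def lie1 (X : Fin n → A) (w : Fin n → A) (i : Fin n) : A :=
  ∑ k, (X k * pd k (w i) + w k * pd i (X k))

/-- Lie derivative of a covariant 2-tensor. -/
def lie2 (X : Fin n → A) (β : Fin n → Fin n → A) (i j : Fin n) : A :=
  ∑ k, (X k * pd k (β i j) + β k j * pd i (X k) + β i k * pd j (X k))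

/-- Exterior derivative of a 1-form: `(d ε)_{ij} = ∂_i ε_j - ∂_j ε_i`. -/
def ext1 (ε : Fin n → A) (i j : Fin n) : A := pd i (ε j) - pd j (ε i)

/-- Contraction of a vector field with the first slot of a 3-form. -/
def contr3 (X : Fin n → A) (H : Fin n → Fin n → Fin n → A) (j k : Fin n) : A :=
  ∑ i, X i * H i j k

/-- Contraction of a vector field with the first slot of a 2-form. -/
def contr2 (X : Fin n → A) (w : Fin n → Fin n → A) (k : Fin n) : A := ∑ j, X j * w j k

/-- `π(ε, ε')`. -/
def pair (π : Fin n → Fin n → A) (ε ε' : Fin n → A) : A := ∑ i, ∑ j, π i j * ε i * ε' j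

/-- The twisted Poisson Lie algebroid bracket
`L_{π^# ε} ε' - L_{π^# ε'} ε - d(π(ε, ε')) + ι_{π^# ε} ι_{π^# ε'} H` on 1-forms. -/
def bracketForm (π : Fin n → Fin n → A) (H : Fin n → Fin n → Fin n → A) (ε ε' : Fin n → A)
    (i : Fin n) : A :=
  lie1 pd (sharp π ε) ε' i - lie1 pd (sharp π ε') ε i - pd i (pair π ε ε')
    + contr2 (sharp π ε) (contr3 (sharp π ε') H) i

/-- `⟨π^{23}, α ⊗ β⟩_{il} = π^{jk} α_{ij} β_{kl}`: contraction of `π` with the 2nd and 3rd entry. -/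
def contr23 (π : Fin n → Fin n → A) (α β : Fin n → Fin n → A) (i l : Fin n) : A :=
  ∑ j, ∑ k, π j k * α i j * β k l

/-- The bracket `⟨π^{23}, α ⊗ β - β ⊗ α⟩` of covariant 2-tensors. -/
def bracketTensor (π : Fin n → Fin n → A) (α β : Fin n → Fin n → A) (i l : Fin n) : A :=
  contr23 π α β i l - contr23 π β α i l

/-- `D_H ε = d ε + ι_{π^# ε} H`. -/
def DH (π : Fin n → Fin n → A) (H : Fin n → Fin n → Fin n → A) (ε : Fin n → A)
    (i j : Fin n) : A :=
  ext1 pd ε i j + contr3 (sharp π ε) H i j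

/-- `ρ(ε) β = L_{π^# ε} β - ⟨π^{23}, D_H ε ⊗ β⟩`. -/
def action (π : Fin n → Fin n → A) (H : Fin n → Fin n → Fin n → A) (ε : Fin n → A)
    (β : Fin n → Fin n → A) (i l : Fin n) : A :=
  lie2 pd (sharp π ε) β i l - contr23 π (DH pd π H ε) β i l

end Local

/-! ## Change of coordinates on superfunctions -/

section Change

variable {n : ℕ} {A B : Type*} [CommRing A] [Algebra ℝ A] [CommRing B] [Algebra ℝ B]

theorem fn_commute (b : B) (x : SFun n B) : Commute (fn b) x := by
  induction x using SFun.induct with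
  | zero => exact Commute.zero_right _
  | mk a q e => simp [Commute, SemiconjBy, fn_eq, SFun.mk_mul_mk, mul_comm]
  | add x y hx hy => exact hx.add_right hy

theorem psi_commute (i : Fin n) (x : SFun n B) : Commute (psi i) x := by
  induction x using SFun.induct with
  | zero => exact Commute.zero_right _
  | mk a q e => simp [Commute, SemiconjBy, psi, SFun.mk_mul_mk, mul_comm]
  | add x y hx hy => exact hx.add_right hy

theorem odd_anticomm (s t : Fin n ⊕ Fin n) :
    (odd s * odd t : SFun n B) = -(odd t * odd s) := by
  have h := ExteriorAlgebra.ι_add_mul_swap (R := ℝ)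
    (Pi.single s (1 : ℝ) : Fin n ⊕ Fin n → ℝ) (Pi.single t (1 : ℝ))
  rw [odd, odd, ← map_mul, eq_neg_of_add_eq_zero_left h, map_neg, map_mul]

theorem ext_mul_commute {V : Type*} [AddCommGroup V] [Module ℝ V] (u v : V)
    (x : ExteriorAlgebra ℝ V) :
    Commute (ExteriorAlgebra.ι ℝ u * ExteriorAlgebra.ι ℝ v) x := by
  induction x using ExteriorAlgebra.induction with
  | algebraMap r => exact (Algebra.commutes r _).symm
  | ι w =>
    have h1 := eq_neg_of_add_eq_zero_left (ExteriorAlgebra.ι_add_mul_swap (R := ℝ) v w)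
    have h2 := eq_neg_of_add_eq_zero_left (ExteriorAlgebra.ι_add_mul_swap (R := ℝ) u w)
    change _ * _ = _ * _
    rw [mul_assoc, h1, mul_neg, ← mul_assoc, h2, neg_mul, neg_neg, mul_assoc]
  | mul a b ha hb => exact ha.mul_right hb
  | add a b ha hb => exact ha.add_right hb

theorem odd_mul_commute (s t : Fin n ⊕ Fin n) (x : SFun n B) : Commute (odd s * odd t) x := by
  induction x using SFun.induct with
  | zero => exact Commute.zero_right _
  | mk a q e =>
    have h := (ext_mul_commute (Pi.single s (1 : ℝ) : Fin n ⊕ Fin n → ℝ) (Pi.single t 1) e).eq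
    simp only [Commute, SemiconjBy, odd_eq, SFun.mk_mul_mk, one_mul, mul_one, h]
  | add x y hx hy => exact hx.add_right hy

theorem sum_odd_sq (f : Fin n ⊕ Fin n → B) :
    (∑ s, fn (f s) * odd s : SFun n B) * ∑ s, fn (f s) * odd s = 0 := by
  have e : ∀ s t, (fn (f s) * odd s : SFun n B) * (fn (f t) * odd t)
      = fn (f s * f t) * (odd s * odd t) := by
    intro s t
    rw [mul_assoc, ← mul_assoc (odd s), ← (fn_commute (f t) (odd s)).eq, fn, fn, fn, map_mul]
    simp only [mul_assoc]
  have h : (∑ s, fn (f s) * odd s : SFun n B) * ∑ s, fn (f s) * odd s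
      = -((∑ s, fn (f s) * odd s : SFun n B) * ∑ s, fn (f s) * odd s) := by
    rw [Finset.sum_mul_sum]
    conv_rhs => rw [Finset.sum_comm]
    rw [← Finset.sum_neg_distrib]
    refine Finset.sum_congr rfl fun s _ => ?_
    rw [← Finset.sum_neg_distrib]
    refine Finset.sum_congr rfl fun t _ => ?_
    rw [e, e, odd_anticomm, mul_neg, mul_comm (f s)]
  have h2 : (2 : ℝ) • ((∑ s, fn (f s) * odd s : SFun n B) * ∑ s, fn (f s) * odd s) = 0 := by
    rw [two_smul]
    exact eq_neg_iff_add_eq_zero.mp h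
  exact (smul_eq_zero_iff_right (by norm_num)).mp h2

variable (res : A →ₐ[ℝ] B) (J : Matrix (Fin n) (Fin n) B) (pd : Fin n → Derivation ℝ B B)

/-- Images of the odd generators under a change of coordinates with Jacobian matrix
`J i a = ∂x^i/∂y^a`: `θ^i ↦ J^i_a θ^a` and `p_i ↦ (J⁻¹)^a_i p_a`. -/
def oddImage (s : Fin n ⊕ Fin n) : SFun n B :=
  ∑ t, fn (Matrix.fromBlocks J 0 0 (J⁻¹).transpose s t) * odd t

/-- Image of `ψ_i = d p_i`: `d ((J⁻¹)^a_i p_a) = (J⁻¹)^a_i ψ_a + ∂_b (J⁻¹)^a_i θ^b p_a`. -/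
def psiImage (i : Fin n) : SFun n B :=
  ∑ a, (fn (J⁻¹ a i) * psi a + ∑ b, fn (pd b (J⁻¹ a i)) * (theta b * mom a))

theorem oddImage_sq (v : Fin n ⊕ Fin n → ℝ) :
    Fintype.linearCombination ℝ (oddImage J) v * Fintype.linearCombination ℝ (oddImage J) v = 0 := by
  have h : Fintype.linearCombination ℝ (oddImage J) v
      = ∑ t, fn (∑ s, v s • Matrix.fromBlocks J 0 0 (J⁻¹).transpose s t) * odd t := by
    simp only [Fintype.linearCombination_apply, oddImage, Finset.smul_sum, fn, map_sum, map_smul,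
      Finset.sum_mul, smul_mul_assoc]
    exact Finset.sum_comm
  rw [h, sum_odd_sq]

theorem psiImage_mem_center (i : Fin n) : psiImage J pd i ∈ Subalgebra.center ℝ (SFun n B) := by
  refine Subalgebra.sum_mem _ fun a _ => Subalgebra.add_mem _ (Subalgebra.mul_mem _ ?_ ?_)
    (Subalgebra.sum_mem _ fun b _ => Subalgebra.mul_mem _ ?_ ?_) <;>
  rw [Subalgebra.mem_center_iff] <;> intro x
  · exact (fn_commute _ x).eq.symm
  · exact (psi_commute _ x).eq.symm
  · exact (fn_commute _ x).eq.symm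
  · exact (odd_mul_commute _ _ x).eq.symm

/-- The algebra homomorphism given by `oddImage`, `psiImage` on the generators `θ, p, ψ`. -/
def fibrePull : Fibre n →ₐ[ℝ] SFun n B :=
  (Algebra.TensorProduct.lift
    ((Subalgebra.center ℝ (SFun n B)).val.comp
      (MvPolynomial.aeval fun i =>
        (⟨psiImage J pd i, psiImage_mem_center J pd i⟩ : Subalgebra.center ℝ (SFun n B))))
    (ExteriorAlgebra.lift ℝ ⟨Fintype.linearCombination ℝ (oddImage J), oddImage_sq J⟩)
    (fun _ _ => show Commute _ _ from (Subalgebra.mem_center_iff.mp (Subtype.property _) _).symm) :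
      Poly n ⊗[ℝ] Ext n →ₐ[ℝ] SFun n B)

/-- The pullback of superfunctions: the algebra homomorphism determined by
`f ↦ res f` on functions of `x` and by `oddImage`, `psiImage` on the generators. -/
def pullback : SFun n A →ₐ[ℝ] SFun n B :=
  (Algebra.TensorProduct.lift (fnHom.comp res) (fibrePull J pd)
    (fun a _ => fn_commute (res a) _) : A ⊗[ℝ] Fibre n →ₐ[ℝ] SFun n B)

theorem pullback_mk (a : A) (q : Poly n) (e : Ext n) :
    pullback res J pd (SFun.mk a q e) = fn (res a) *
      (((MvPolynomial.aeval fun i =>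
        (⟨psiImage J pd i, psiImage_mem_center J pd i⟩ : Subalgebra.center ℝ (SFun n B))) q :
        Subalgebra.center ℝ (SFun n B)) : SFun n B) *
      ExteriorAlgebra.lift ℝ ⟨Fintype.linearCombination ℝ (oddImage J), oddImage_sq J⟩ e := by
  rw [mul_assoc]
  refine (Algebra.TensorProduct.lift_tmul (A := A) (B := Fibre n) _ _ _ a _).trans ?_
  exact congrArg (fun z => fn (res a) * z)
    (Algebra.TensorProduct.lift_tmul (A := Poly n) (B := Ext n) _ _ _ q e)

theorem fn_one : (fn 1 : SFun n B) = 1 := map_one fnHom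

theorem pullback_fn (a : A) : pullback res J pd (fn a) = fn (res a) := by
  rw [fn_eq, pullback_mk]
  simp

theorem pullback_odd (s : Fin n ⊕ Fin n) : pullback res J pd (odd s) = oddImage J s := by
  rw [odd_eq, pullback_mk, ExteriorAlgebra.lift_ι_apply]
  simp [fn_one, Fintype.linearCombination_apply, Pi.single_apply]

theorem pullback_psi (i : Fin n) : pullback res J pd (psi i) = psiImage J pd i := by
  rw [psi, pullback_mk]
  simp [fn_one]

end Change

/-! ## Charts and smooth functions -/

section Manifold

variable {n : ℕ} {M : Type*} [TopologicalSpace M] [ChartedSpace (EuclideanSpace ℝ (Fin n)) M]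

variable (n M) in
/-- The charts of the maximal smooth atlas. -/
def Chart : Type _ :=
  {e : OpenPartialHomeomorph M (EuclideanSpace ℝ (Fin n)) //
    e ∈ IsManifold.maximalAtlas (𝓡 n) ∞ M}

/-- The domain of a chart. -/
def Chart.dom (c : Chart n M) : TopologicalSpace.Opens M := ⟨c.1.source, c.1.open_source⟩

/-- Smooth functions on the domain of a chart. -/
abbrev Chart.Fun (c : Chart n M) : Type _ := C^∞⟮𝓡 n, c.dom; 𝓘(ℝ, ℝ), ℝ⟯

/-- The coordinate function `x^i`. -/
def Chart.coord (c : Chart n M) (i : Fin n) : c.Fun :=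
  ⟨fun q => c.1 q.1 i, by
    intro q
    have h := contMDiffAt_of_mem_maximalAtlas c.2 q.2
    have h1 : ContMDiffAt (𝓡 n) 𝓘(ℝ, ℝ) ∞ (fun y : M => c.1 y i) q.1 :=
      ((EuclideanSpace.proj (𝕜 := ℝ) i).contMDiff.contMDiffAt).comp q.1 h
    exact contMDiffAt_subtype_iff.mpr h1⟩

/-- The coordinate expression `f ∘ x⁻¹` of a function on a chart domain (zero outside the
image of the chart). -/
def Chart.expr (c : Chart n M) (f : c.Fun) (y : EuclideanSpace ℝ (Fin n)) : ℝ :=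
  Function.extend Subtype.val f 0 (c.1.symm y)

theorem Chart.expr_apply (c : Chart n M) (f : c.Fun) {y : EuclideanSpace ℝ (Fin n)}
    (hy : y ∈ c.1.target) : c.expr f y = f ⟨c.1.symm y, c.1.map_target hy⟩ :=
  Subtype.val_injective.extend_apply f 0 ⟨c.1.symm y, c.1.map_target hy⟩

theorem Chart.contDiffOn_expr (c : Chart n M) (f : c.Fun) :
    ContDiffOn ℝ ∞ (c.expr f) c.1.target := by
  rw [← contMDiffOn_iff_contDiffOn]
  have h1 : ContMDiffOn (𝓡 n) 𝓘(ℝ, ℝ) ∞ (Function.extend Subtype.val f 0) c.1.source := by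
    intro q hq
    refine ContMDiffAt.contMDiffWithinAt ?_
    refine (contMDiffAt_subtype_iff (U := c.dom) (x := ⟨q, hq⟩)).mp ?_
    have : (fun x : c.dom => Function.extend Subtype.val f 0 x.1) = f := by
      funext x
      exact Subtype.val_injective.extend_apply f 0 x
    rw [this]
    exact f.contMDiff _
  exact h1.comp (contMDiffOn_symm_of_mem_maximalAtlas c.2) fun y hy => c.1.map_target hy

theorem Chart.differentiableAt_expr (c : Chart n M) (f : c.Fun) (q : c.dom) :
    DifferentiableAt ℝ (c.expr f) (c.1 q.1) :=
  ((c.contDiffOn_expr f).contDiffAt (c.1.open_target.mem_nhds (c.1.map_source q.2))).differentiableAt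
    (by simp)

/-- The coordinate derivation `∂/∂x^i`: the `i`-th partial derivative of the coordinate
expression. -/
def Chart.pd (c : Chart n M) (i : Fin n) : Derivation ℝ c.Fun c.Fun :=
  Derivation.mk'
    { toFun := fun f =>
        ⟨fun q => fderiv ℝ (c.expr f) (c.1 q.1) (EuclideanSpace.single i 1), by
          intro q
          have hq := c.1.map_source q.2
          have h : ContDiffAt ℝ ∞
              (fun y => fderiv ℝ (c.expr f) y (EuclideanSpace.single i 1)) (c.1 q.1) :=
            (((c.contDiffOn_expr f).contDiffAt (c.1.open_target.mem_nhds hq)).fderiv_right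
              (m := ∞) (by simp)).clm_apply contDiffAt_const
          have h1 : ContMDiffAt (𝓡 n) 𝓘(ℝ, ℝ) ∞
              (fun z : M => fderiv ℝ (c.expr f) (c.1 z) (EuclideanSpace.single i 1)) q.1 :=
            h.contMDiffAt.comp q.1 (contMDiffAt_of_mem_maximalAtlas c.2 q.2)
          exact contMDiffAt_subtype_iff.mpr h1⟩
      map_add' := fun f g => by
        ext q
        have h : c.expr (f + g) =ᶠ[nhds (c.1 q.1)] c.expr f + c.expr g := by
          filter_upwards [c.1.open_target.mem_nhds (c.1.map_source q.2)] with y hy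
          simp only [Pi.add_apply, c.expr_apply _ hy]
          rfl
        change fderiv ℝ (c.expr (f + g)) (c.1 q.1) _ =
          fderiv ℝ (c.expr f) (c.1 q.1) _ + fderiv ℝ (c.expr g) (c.1 q.1) _
        rw [h.fderiv_eq, fderiv_add (c.differentiableAt_expr f q) (c.differentiableAt_expr g q)]
        rfl
      map_smul' := fun r f => by
        ext q
        have h : c.expr (r • f) =ᶠ[nhds (c.1 q.1)] r • c.expr f := by
          filter_upwards [c.1.open_target.mem_nhds (c.1.map_source q.2)] with y hy
          simp only [Pi.smul_apply, c.expr_apply _ hy]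
          rfl
        change fderiv ℝ (c.expr (r • f)) (c.1 q.1) _ = r • fderiv ℝ (c.expr f) (c.1 q.1) _
        rw [h.fderiv_eq, fderiv_const_smul (c.differentiableAt_expr f q)]
        rfl }
    fun f g => by
      ext q
      have h : c.expr (f * g) =ᶠ[nhds (c.1 q.1)] c.expr f * c.expr g := by
        filter_upwards [c.1.open_target.mem_nhds (c.1.map_source q.2)] with y hy
        simp only [Pi.mul_apply, c.expr_apply _ hy]
        rfl
      have hv : ∀ f : c.Fun, c.expr f (c.1 q.1) = f q := fun f => by
        rw [c.expr_apply f (c.1.map_source q.2)]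
        exact congrArg f (Subtype.ext (c.1.left_inv q.2))
      change fderiv ℝ (c.expr (f * g)) (c.1 q.1) _ =
        f q * fderiv ℝ (c.expr g) (c.1 q.1) _ + g q * fderiv ℝ (c.expr f) (c.1 q.1) _
      rw [h.fderiv_eq, fderiv_mul (c.differentiableAt_expr f q) (c.differentiableAt_expr g q)]
      simp [hv]

/-- Restriction of smooth functions to a smaller chart domain. -/
def Chart.res {c c' : Chart n M} (h : c'.dom ≤ c.dom) : c.Fun →ₐ[ℝ] c'.Fun :=
  { ContMDiffMap.restrictRingHom (n := ∞) (𝓡 n) 𝓘(ℝ, ℝ) ℝ h with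
    commutes' := fun _ => rfl }

/-- The Jacobian matrix `J i a = ∂x^i/∂y^a` of the coordinates `x` of `c` with respect to the
coordinates `y` of a chart `c'` with smaller domain. -/
def Chart.jac {c c' : Chart n M} (h : c'.dom ≤ c.dom) : Matrix (Fin n) (Fin n) c'.Fun :=
  fun i a => c'.pd a (Chart.res h (c.coord i))

/-- Restriction of superfunctions on `T[1]T^*[1]M` to a smaller chart domain, together with the
change of coordinates from `(x, p, dx, dp)` to `(y, p', dy, dp')`. -/
def Chart.pull {c c' : Chart n M} (h : c'.dom ≤ c.dom) : SFun n c.Fun →ₐ[ℝ] SFun n c'.Fun :=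
  pullback (Chart.res h) (Chart.jac h) c'.pd

/-! ## Tensor fields, twisted Poisson structures and vector fields -/

variable (n M) in
/-- Families of components, one for each chart, of a tensor field with one covariant index. -/
abbrev Comp1 : Type _ := (c : Chart n M) → Fin n → c.Fun

variable (n M) in
/-- Families of components, one for each chart, of a tensor field with two indices. -/
abbrev Comp2 : Type _ := (c : Chart n M) → Fin n → Fin n → c.Fun

variable (n M) in
/-- Families of components, one for each chart, of a tensor field with three indices. -/
abbrev Comp3 : Type _ := (c : Chart n M) → Fin n → Fin n → Fin n → c.Fun

variable (n M) in
/-- 1-forms, i.e. sections of `T^*M`, given by their components in all charts. -/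
def OneForms : Set (Comp1 n M) :=
  {ε | ∀ (c c' : Chart n M) (h : c'.dom ≤ c.dom) (a : Fin n),
    ε c' a = ∑ i, Chart.jac h i a * Chart.res h (ε c i)}

variable (n M) in
/-- Covariant 2-tensor fields, given by their components in all charts. -/
def CovTensors : Set (Comp2 n M) :=
  {α | ∀ (c c' : Chart n M) (h : c'.dom ≤ c.dom) (a b : Fin n),
    α c' a b = ∑ i, ∑ j, Chart.jac h i a * Chart.jac h j b * Chart.res h (α c i j)}

variable (n M) in
/-- Bivector fields: skew-symmetric contravariant 2-tensor fields. -/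
def Bivectors : Set (Comp2 n M) :=
  {π | (∀ c i j, π c j i = -π c i j) ∧
    ∀ (c c' : Chart n M) (h : c'.dom ≤ c.dom) (i j : Fin n),
      Chart.res h (π c i j) = ∑ a, ∑ b, Chart.jac h i a * Chart.jac h j b * π c' a b}

variable (n M) in
/-- 3-forms: skew-symmetric covariant 3-tensor fields. -/
def ThreeForms : Set (Comp3 n M) :=
  {H | (∀ c i j k, H c j i k = -H c i j k ∧ H c i k j = -H c i j k) ∧
    ∀ (c c' : Chart n M) (h : c'.dom ≤ c.dom) (a b d : Fin n),
      H c' a b d = ∑ i, ∑ j, ∑ k,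
        Chart.jac h i a * Chart.jac h j b * Chart.jac h k d * Chart.res h (H c i j k)}

variable (n M) in
/-- A twisted Poisson structure `(π, H)`: a bivector field `π` and a closed 3-form `H` with
`{f, {g, h}} + {g, {h, f}} + {h, {f, g}} = H(π^# df, π^# dg, π^# dh)`, where `{f, g} = π(df, dg)`
(written out for coordinate functions). -/
structure TwistedPoisson where
  /-- the bivector field -/
  π : Comp2 n M
  /-- the 3-form -/
  H : Comp3 n M
  bivector : π ∈ Bivectors n M
  threeForm : H ∈ ThreeForms n M
  closed : ∀ (c : Chart n M) (i j k l : Fin n),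
    c.pd i (H c j k l) - c.pd j (H c i k l) + c.pd k (H c i j l) - c.pd l (H c i j k) = 0
  jacobi : ∀ (c : Chart n M) (i j k : Fin n),
    ∑ l, (π c i l * c.pd l (π c j k) + π c j l * c.pd l (π c k i) + π c k l * c.pd l (π c i j))
      = ∑ a, ∑ b, ∑ d, H c a b d * π c i a * π c j b * π c k d

variable (n M) in
/-- Families of operators on the superfunctions over all charts. -/
abbrev Ops : Type _ := (c : Chart n M) → SFun n c.Fun →ₗ[ℝ] SFun n c.Fun

variable (n M) in
/-- Vector fields on `T[1]T^*[1]M` of the form `ε_i ∂/∂p_i + α_{ij} θ^j ∂/∂ψ_i` in every chart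
(these have degree `-1`).  A vector field on the graded manifold is a family of derivations of the
superfunctions over all charts that commutes with restrictions and coordinate changes. -/
def EpsFields : Set (Ops n M) :=
  {D | (∀ c, ∃ (ε : Fin n → c.Fun) (α : Fin n → Fin n → c.Fun), D c = epsField ε α) ∧
    ∀ (c c' : Chart n M) (h : c'.dom ≤ c.dom) (F : SFun n c.Fun),
      D c' (Chart.pull h F) = Chart.pull h (D c F)}

namespace TwistedPoisson

variable (P : TwistedPoisson n M)

/-- `Q̃ = d + L_{Q_{π,H}}` on `T[1]T^*[1]M`. -/
def Q : Ops n M := fun c => Qtilde c.pd (P.π c) (P.H c)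

/-- The `Q̃`-derived bracket `[D, [Q̃, D']]`. -/
def opBracket (D D' : Ops n M) : Ops n M := fun c => derivedBracket (P.Q c) (D c) (D' c)

/-- The twisted Poisson Lie algebroid bracket of 1-forms. -/
def formBracket (ε ε' : Comp1 n M) : Comp1 n M :=
  fun c => bracketForm c.pd (P.π c) (P.H c) (ε c) (ε' c)

/-- The bracket `⟨π^{23}, α ⊗ β - β ⊗ α⟩` of covariant 2-tensors. -/
def tensorBracket (α β : Comp2 n M) : Comp2 n M := fun c => bracketTensor (P.π c) (α c) (β c)

/-- `ρ(ε) α = L_{π^# ε} α - ⟨π^{23}, D_H ε ⊗ α⟩`. -/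
def rho (ε : Comp1 n M) (α : Comp2 n M) : Comp2 n M :=
  fun c => action c.pd (P.π c) (P.H c) (ε c) (α c)

end TwistedPoisson

end Manifold

/-- The Lie algebra structure on `S ⊆ V` consists of the vector space operations of `V` and of the
given bracket. -/
structure IsInducedLie {V : Type*} [AddCommGroup V] [Module ℝ V] (S : Set V) [LieRing S]
    [LieAlgebra ℝ S] (br : V → V → V) : Prop where
  coe_add : ∀ x y : S, ((x + y : S) : V) = x + y
  coe_smul : ∀ (r : ℝ) (x : S), ((r • x : S) : V) = r • (x : V)
  coe_lie : ∀ x y : S, ((⁅x, y⁆ : S) : V) = br x y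

end TwistedPSM

end

namespace TwistedPSM

noncomputable section

/-! ## Parity and graded derivations of superfunctions -/

section Super

variable {n : ℕ} {A : Type*} [CommRing A] [Algebra ℝ A]

/-! Two facts make the derived bracket `[D, [Q̃, D']]` a Lie bracket: the fields `ε_i ∂/∂p_i +
α_{ij} θ^j ∂/∂ψ_i` anticommute with each other, which gives skew-symmetry (`epsField_anticomm`,
`derivedBracket_skew`), and `Q̃² = 0`, which gives the Jacobi identity (`derivedBracket_leibniz`).
Closure is a computation on generators in one chart (`derivedBracket_epsField`) together with the
invariance of `Q̃` under coordinate changes (`IsCoordChange.Qtilde_pullback`).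

`Q̃² = 0` (`Qtilde_sq`) splits into `d² = 0`, `[d, L_Q] = 0` and `L_Q² = 0`. The last needs `L_Q(Q
x^i) = 0`, which is the twisted Jacobi identity contracted with momenta (`lieQ_Qx`), and `L_Q(Q p_i)
= 0`, which is the `x^i`-derivative of that contracted identity combined with `dH = 0` (`lieQ_Qp`).
The formula that keeps this short is `2 Q p_i = -∂_i(π^{jk} p_j p_k) + H_{iab} (Q x^a)(Q x^b)`
(`two_smul_Qp'`); it also controls the change of coordinates of `Q`.

The coefficient `α` is not a tensor, because `ψ_i = d p_i` transforms with an extra term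
`∂_b(J⁻¹)^a_i θ^b p_a`. Writing `α_{ij} = -β_{ij} - ∂_j ε_i` absorbs this term: the field is global
exactly when `ε` is a 1-form and `β` a covariant 2-tensor (`IsCoordChange.epsField_pullback_iff`).
The minus sign in front of `β` gives the bracket of two fields with `ε = 0` the sign of the bracket
on `𝒜`. In the variables `(ε, β)` the derived bracket is the semidirect one (`derivedMom_eq`,
`derivedPsi_eq`).

Nothing about `𝒢`, `𝒜` and `ρ` is then checked directly. Since the parametrisation is injective and
detects tensoriality, closure, the Jacobi identities, the action property and the derivation
property are all read off from `𝒢̃` on the pairs `(ε, 0)` and `(0, β)` (`SemidirectData`). -/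

/-- Superfunctions form an algebra over the functions on the base. -/
instance SFun.baseAlgebra : Algebra A (SFun n A) :=
  RingHom.toAlgebra' (fnHom : A →ₐ[ℝ] SFun n A).toRingHom fun a x => (fn_commute a x).eq

theorem fn_mul (a : A) (x : SFun n A) : fn a * x = a • x := (Algebra.smul_def a x).symm

theorem fn_eq_smul (a : A) : (fn a : SFun n A) = a • 1 := by rw [← fn_mul, mul_one]

theorem base_smul_smul (r : ℝ) (a : A) (x : SFun n A) : (r • a) • x = r • a • x := by
  rw [← fn_mul, ← fn_mul, fn, map_smul, smul_mul_assoc]; rfl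

theorem smul_base_comm (r : ℝ) (a : A) (x : SFun n A) : a • r • x = r • a • x := by
  rw [← fn_mul, ← fn_mul, mul_smul_comm]

theorem SFun.mk_factor (a : A) (q : Poly n) (e : Ext n) :
    SFun.mk a q e = fn a * (SFun.mk 1 q 1 * extHom e) := by
  simp only [fn_eq, extHom_eq, SFun.mk_mul_mk, one_mul, mul_one]

theorem extHom_ι (v : Fin n ⊕ Fin n → ℝ) :
    (extHom (ExteriorAlgebra.ι ℝ v) : SFun n A) = ∑ s, (fn (algebraMap ℝ A (v s)) * odd s) := by
  have h : v = ∑ s, v s • (Pi.single s (1 : ℝ) : Fin n ⊕ Fin n → ℝ) := by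
    funext t; simp [Finset.sum_apply, Pi.single_apply]
  conv_lhs => rw [h]
  simp only [map_sum, map_smul]
  refine Finset.sum_congr rfl fun s _ => ?_
  have h1 : (fn (algebraMap ℝ A (v s)) : SFun n A) = v s • 1 := by
    rw [fn, AlgHom.commutes, Algebra.algebraMap_eq_smul_one]
  rw [h1, smul_mul_assoc, one_mul]; rfl

/-- Induction on superfunctions along products and sums of the generators. -/
theorem SFun.gen_induct {P : SFun n A → Prop} (hfn : ∀ a, P (fn a)) (hodd : ∀ s, P (odd s))
    (hpsi : ∀ i, P (psi i)) (hmul : ∀ x y, P x → P y → P (x * y))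
    (hadd : ∀ x y, P x → P y → P (x + y)) (x : SFun n A) : P x := by
  have h0 : P 0 := by simpa [fn] using hfn 0
  have hsum : ∀ {ι : Type} (s : Finset ι) (f : ι → SFun n A), (∀ i, P (f i)) → P (∑ i ∈ s, f i) :=
    fun s f h => Finset.sum_induction f P hadd h0 fun i _ => h i
  induction x using SFun.induct with
  | zero => exact h0
  | add x y hx hy => exact hadd x y hx hy
  | mk a q e =>
    rw [SFun.mk_factor]
    refine hmul _ _ (hfn a) (hmul _ _ ?_ ?_)
    · have hC : ∀ r : ℝ, SFun.mk 1 (MvPolynomial.C r) 1 = (fn (algebraMap ℝ A r) : SFun n A) := by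
        intro r
        rw [fn, AlgHom.commutes, Algebra.algebraMap_eq_smul_one, SFun.one_eq]
        have : (MvPolynomial.C r : Poly n) = r • 1 := by
          rw [MvPolynomial.smul_eq_C_mul, mul_one]
        rw [this]
        exact ((TensorProduct.mk ℝ A (Fibre n) 1).comp
          ((TensorProduct.mk ℝ (Poly n) (Ext n)).flip 1 : Poly n →ₗ[ℝ] Fibre n)).map_smul r 1
      have hA : ∀ p q : Poly n, (SFun.mk 1 (p + q) 1 : SFun n A) = SFun.mk 1 p 1 + SFun.mk 1 q 1 :=
        fun p q => ((TensorProduct.mk ℝ A (Fibre n) 1).comp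
          ((TensorProduct.mk ℝ (Poly n) (Ext n)).flip 1 : Poly n →ₗ[ℝ] Fibre n)).map_add p q
      induction q using MvPolynomial.induction_on with
      | C r => rw [hC]; exact hfn _
      | add p q hp hq => rw [hA]; exact hadd _ _ hp hq
      | mul_X p i hp =>
        have : (SFun.mk 1 (p * MvPolynomial.X i) 1 : SFun n A) = SFun.mk 1 p 1 * psi i := by
          simp only [psi, SFun.mk_mul_mk, one_mul]
        rw [this]; exact hmul _ _ hp (hpsi i)
    · induction e using ExteriorAlgebra.induction with
      | algebraMap r =>
        have : (extHom (algebraMap ℝ (Ext n) r) : SFun n A) = fn (algebraMap ℝ A r) := by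
          rw [fn, AlgHom.commutes, AlgHom.commutes]
        rw [this]; exact hfn _
      | ι v =>
        rw [extHom_ι]
        exact Finset.sum_induction _ P hadd h0 fun s _ => hmul _ _ (hfn _) (hodd s)
      | mul a b ha hb => rw [map_mul]; exact hmul _ _ ha hb
      | add a b ha hb => rw [map_add]; exact hadd _ _ ha hb

/-- The parity automorphism of superfunctions. -/
def parity : SFun n A →ₗ[ℝ] SFun n A :=
  SFun.map LinearMap.id LinearMap.id
    (CliffordAlgebra.involute (Q := (0 : QuadraticForm ℝ (Fin n ⊕ Fin n → ℝ)))).toLinearMap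

theorem SFun.map_mul {f : A →ₗ[ℝ] A} {g : Poly n →ₗ[ℝ] Poly n} {h : Ext n →ₗ[ℝ] Ext n}
    (hf : ∀ a b, f (a * b) = f a * f b) (hg : ∀ a b, g (a * b) = g a * g b)
    (hh : ∀ a b, h (a * b) = h a * h b) (x y : SFun n A) :
    SFun.map f g h (x * y) = SFun.map f g h x * SFun.map f g h y := by
  induction x using SFun.induct with
  | zero => simp
  | add x y hx hy => rw [add_mul, map_add, hx, hy, map_add, add_mul]
  | mk a q e =>
    induction y using SFun.induct with
    | zero => simp
    | add x y hx hy => rw [mul_add, map_add, hx, hy, map_add, mul_add]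
    | mk b r d => simp only [SFun.mk_mul_mk, SFun.map_mk, hf, hg, hh]

theorem parity_mul (x y : SFun n A) : parity (x * y) = parity x * parity y :=
  SFun.map_mul (fun _ _ => rfl) (fun _ _ => rfl)
    (fun a b => _root_.map_mul (CliffordAlgebra.involute) a b) x y

@[simp] theorem parity_fn (a : A) : parity (fn a : SFun n A) = fn a := by
  rw [fn_eq, parity, SFun.map_mk]
  exact congrArg (SFun.mk a 1) (map_one CliffordAlgebra.involute)

@[simp] theorem parity_psi (i : Fin n) : parity (psi i : SFun n A) = psi i := by
  rw [psi, parity, SFun.map_mk]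
  exact congrArg (SFun.mk 1 _) (map_one CliffordAlgebra.involute)

theorem SFun.mk_neg (a : A) (q : Poly n) (e : Ext n) : SFun.mk a q (-e) = -SFun.mk a q e := by
  rw [SFun.mk_factor a q (-e), SFun.mk_factor a q e, map_neg, mul_neg, mul_neg]

@[simp] theorem parity_odd (s : Fin n ⊕ Fin n) : parity (odd s : SFun n A) = -odd s := by
  rw [odd_eq, parity, SFun.map_mk, ← SFun.mk_neg]
  exact congrArg (SFun.mk 1 1) (CliffordAlgebra.involute_ι _)

@[simp] theorem parity_mom (i : Fin n) : parity (mom i : SFun n A) = -mom i := parity_odd _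

@[simp] theorem parity_theta (i : Fin n) : parity (theta i : SFun n A) = -theta i := parity_odd _

@[simp] theorem parity_smul (a : A) (x : SFun n A) : parity (a • x) = a • parity x := by
  rw [← fn_mul, parity_mul, parity_fn, fn_mul]

@[simp] theorem parity_parity (x : SFun n A) : parity (parity x) = x := by
  induction x using SFun.gen_induct with
  | hfn a => simp
  | hodd s => simp
  | hpsi i => simp
  | hmul x y hx hy => rw [parity_mul, parity_mul, hx, hy]
  | hadd x y hx hy => rw [map_add, map_add, hx, hy]

/-! ### Homogeneous elements and their commutation signs -/

/-- Even elements. -/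
def IsEven (a : SFun n A) : Prop := parity a = a ∧ ∀ x, a * x = x * a

/-- Odd elements. -/
def IsOdd (a : SFun n A) : Prop := parity a = -a ∧ ∀ x, a * x = parity x * a

theorem isEven_fn (a : A) : IsEven (fn a : SFun n A) := ⟨parity_fn a, fun x => (fn_commute a x).eq⟩

theorem isEven_psi (i : Fin n) : IsEven (psi i : SFun n A) :=
  ⟨parity_psi i, fun x => (psi_commute i x).eq⟩

/-- The sign rule is multiplicative and additive in the second factor, so it need only be tested on
generators. -/
theorem isOdd_odd (s : Fin n ⊕ Fin n) : IsOdd (odd s : SFun n A) := by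
  refine ⟨parity_odd s, fun x => ?_⟩
  induction x using SFun.gen_induct with
  | hfn a => simp [(fn_commute a (odd s)).eq]
  | hodd t => rw [parity_odd, odd_anticomm, neg_mul]
  | hpsi i => simp [(psi_commute i (odd s)).eq]
  | hmul x y hx hy => rw [parity_mul, ← mul_assoc, hx, mul_assoc, hy, mul_assoc]
  | hadd x y hx hy => rw [map_add, mul_add, hx, hy, add_mul]

theorem IsEven.zero : IsEven (0 : SFun n A) := ⟨by simp, by simp⟩

theorem IsOdd.zero : IsOdd (0 : SFun n A) := ⟨by simp, by simp⟩

theorem IsEven.add {a b : SFun n A} (ha : IsEven a) (hb : IsEven b) : IsEven (a + b) :=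
  ⟨by rw [map_add, ha.1, hb.1], fun x => by rw [add_mul, ha.2, hb.2, mul_add]⟩

theorem IsOdd.add {a b : SFun n A} (ha : IsOdd a) (hb : IsOdd b) : IsOdd (a + b) :=
  ⟨by rw [map_add, ha.1, hb.1]; abel, fun x => by rw [add_mul, ha.2, hb.2, mul_add]⟩

theorem IsEven.smul (c : A) {a : SFun n A} (ha : IsEven a) : IsEven (c • a) :=
  ⟨by rw [parity_smul, ha.1], fun x => by rw [smul_mul_assoc, ha.2, mul_smul_comm]⟩

theorem IsOdd.smul (c : A) {a : SFun n A} (ha : IsOdd a) : IsOdd (c • a) :=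
  ⟨by rw [parity_smul, ha.1, smul_neg], fun x => by rw [smul_mul_assoc, ha.2, mul_smul_comm]⟩

theorem IsEven.rsmul (c : ℝ) {a : SFun n A} (ha : IsEven a) : IsEven (c • a) :=
  ⟨by rw [map_smul, ha.1], fun x => by rw [smul_mul_assoc, ha.2, mul_smul_comm]⟩

theorem IsEven.neg {a : SFun n A} (ha : IsEven a) : IsEven (-a) :=
  ⟨by rw [map_neg, ha.1], fun x => by rw [neg_mul, ha.2, mul_neg]⟩

theorem IsEven.sum {ι : Type*} (s : Finset ι) {a : ι → SFun n A} (h : ∀ i, IsEven (a i)) :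
    IsEven (∑ i ∈ s, a i) :=
  Finset.sum_induction a IsEven (fun _ _ => IsEven.add) IsEven.zero fun i _ => h i

theorem IsOdd.sum {ι : Type*} (s : Finset ι) {a : ι → SFun n A} (h : ∀ i, IsOdd (a i)) :
    IsOdd (∑ i ∈ s, a i) :=
  Finset.sum_induction a IsOdd (fun _ _ => IsOdd.add) IsOdd.zero fun i _ => h i

theorem IsOdd.mul {a b : SFun n A} (ha : IsOdd a) (hb : IsOdd b) : IsEven (a * b) :=
  ⟨by rw [parity_mul, ha.1, hb.1, neg_mul_neg], fun x => by
    rw [mul_assoc, hb.2, ← mul_assoc, ha.2, parity_parity, mul_assoc]⟩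

theorem IsOdd.anticomm {a b : SFun n A} (ha : IsOdd a) (hb : IsOdd b) : a * b = -(b * a) := by
  rw [ha.2, hb.1, neg_mul]

/-! ### Graded derivations and their commutators -/

/-- Even derivations. -/
structure IsEvenDer (D : SFun n A →ₗ[ℝ] SFun n A) : Prop where
  leibniz : ∀ x y, D (x * y) = D x * y + x * D y
  parity_comm : ∀ x, D (parity x) = parity (D x)

/-- Odd (left) derivations. -/
structure IsOddDer (D : SFun n A →ₗ[ℝ] SFun n A) : Prop where
  leibniz : ∀ x y, D (x * y) = D x * y + parity x * D y
  parity_comm : ∀ x, D (parity x) = -parity (D x)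

variable {D D' : SFun n A →ₗ[ℝ] SFun n A}

theorem IsEvenDer.zero : IsEvenDer (0 : SFun n A →ₗ[ℝ] SFun n A) := ⟨by simp, by simp⟩

theorem IsOddDer.zero : IsOddDer (0 : SFun n A →ₗ[ℝ] SFun n A) := ⟨by simp, by simp⟩

theorem IsEvenDer.add (h : IsEvenDer D) (h' : IsEvenDer D') : IsEvenDer (D + D') :=
  ⟨fun x y => by
    simp only [LinearMap.add_apply, h.leibniz, h'.leibniz, add_mul, mul_add]; abel,
   fun x => by simp only [LinearMap.add_apply, h.parity_comm, h'.parity_comm, map_add]⟩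

theorem IsOddDer.add (h : IsOddDer D) (h' : IsOddDer D') : IsOddDer (D + D') :=
  ⟨fun x y => by
    simp only [LinearMap.add_apply, h.leibniz, h'.leibniz, add_mul, mul_add]; abel,
   fun x => by simp only [LinearMap.add_apply, h.parity_comm, h'.parity_comm, map_add]; abel⟩

theorem IsEvenDer.sum {ι : Type*} (s : Finset ι) {D : ι → SFun n A →ₗ[ℝ] SFun n A}
    (h : ∀ i, IsEvenDer (D i)) : IsEvenDer (∑ i ∈ s, D i) :=
  Finset.sum_induction D IsEvenDer (fun _ _ => IsEvenDer.add) IsEvenDer.zero fun i _ => h i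

theorem IsOddDer.sum {ι : Type*} (s : Finset ι) {D : ι → SFun n A →ₗ[ℝ] SFun n A}
    (h : ∀ i, IsOddDer (D i)) : IsOddDer (∑ i ∈ s, D i) :=
  Finset.sum_induction D IsOddDer (fun _ _ => IsOddDer.add) IsOddDer.zero fun i _ => h i

theorem IsEvenDer.lmul_even (h : IsEvenDer D) {a : SFun n A} (ha : IsEven a) :
    IsEvenDer (lmul a ∘ₗ D) :=
  ⟨fun x y => by
    simp only [lmul, LinearMap.comp_apply, LinearMap.mulLeft_apply, h.leibniz, mul_add]
    rw [← mul_assoc a x, ha.2 x, mul_assoc, mul_assoc],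
   fun x => by
    simp only [lmul, LinearMap.comp_apply, LinearMap.mulLeft_apply, h.parity_comm, parity_mul, ha.1]⟩

theorem IsEvenDer.lmul_odd (h : IsEvenDer D) {a : SFun n A} (ha : IsOdd a) :
    IsOddDer (lmul a ∘ₗ D) :=
  ⟨fun x y => by
    simp only [lmul, LinearMap.comp_apply, LinearMap.mulLeft_apply, h.leibniz, mul_add]
    rw [← mul_assoc a x, ha.2 x, mul_assoc, mul_assoc],
   fun x => by
    simp only [lmul, LinearMap.comp_apply, LinearMap.mulLeft_apply, h.parity_comm, parity_mul, ha.1,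
      neg_mul, neg_neg]⟩

theorem IsOddDer.lmul_even (h : IsOddDer D) {a : SFun n A} (ha : IsEven a) :
    IsOddDer (lmul a ∘ₗ D) :=
  ⟨fun x y => by
    simp only [lmul, LinearMap.comp_apply, LinearMap.mulLeft_apply, h.leibniz, mul_add]
    rw [← mul_assoc a (parity x), ha.2 (parity x), mul_assoc, mul_assoc],
   fun x => by
    simp only [lmul, LinearMap.comp_apply, LinearMap.mulLeft_apply, h.parity_comm, parity_mul, ha.1,
      mul_neg]⟩

theorem IsOddDer.lmul_odd (h : IsOddDer D) {a : SFun n A} (ha : IsOdd a) :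
    IsEvenDer (lmul a ∘ₗ D) :=
  ⟨fun x y => by
    simp only [lmul, LinearMap.comp_apply, LinearMap.mulLeft_apply, h.leibniz, mul_add]
    rw [← mul_assoc a (parity x), ha.2 (parity x), parity_parity, mul_assoc, mul_assoc],
   fun x => by
    simp only [lmul, LinearMap.comp_apply, LinearMap.mulLeft_apply, h.parity_comm, parity_mul, ha.1,
      mul_neg, neg_mul]⟩

/-- The graded commutator of an even and an odd derivation. -/
theorem IsEvenDer.comm_odd (h : IsEvenDer D) (h' : IsOddDer D') :
    IsOddDer (D ∘ₗ D' - D' ∘ₗ D) :=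
  ⟨fun x y => by
    simp only [LinearMap.sub_apply, LinearMap.comp_apply, h.leibniz, h'.leibniz, map_add, h.parity_comm,
      sub_mul, mul_sub]
    abel,
   fun x => by
    simp only [LinearMap.sub_apply, LinearMap.comp_apply, h.parity_comm, h'.parity_comm, map_sub, map_neg]
    abel⟩

/-- The graded commutator of two odd derivations. -/
theorem IsOddDer.comm_odd (h : IsOddDer D) (h' : IsOddDer D') :
    IsEvenDer (D ∘ₗ D' + D' ∘ₗ D) :=
  ⟨fun x y => by
    simp only [LinearMap.add_apply, LinearMap.comp_apply, h.leibniz, h'.leibniz, map_add, h.parity_comm,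
      h'.parity_comm, parity_parity, add_mul, mul_add, neg_mul]
    abel,
   fun x => by
    simp only [LinearMap.add_apply, LinearMap.comp_apply, h.parity_comm, h'.parity_comm, map_add, map_neg]
    abel⟩

theorem IsOddDer.sq (h : IsOddDer D) : IsEvenDer (D ∘ₗ D) :=
  ⟨fun x y => by
    simp only [LinearMap.comp_apply, h.leibniz, map_add, h.parity_comm, parity_parity, neg_mul]
    abel,
   fun x => by simp only [LinearMap.comp_apply, h.parity_comm, map_neg, neg_neg]⟩

theorem IsOddDer.comm_even (h : IsOddDer D) (h' : IsEvenDer D') :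
    IsOddDer (D ∘ₗ D' - D' ∘ₗ D) :=
  ⟨fun x y => by
    simp only [LinearMap.sub_apply, LinearMap.comp_apply, h.leibniz, h'.leibniz, map_add, h'.parity_comm,
      sub_mul, mul_sub]
    abel,
   fun x => by
    simp only [LinearMap.sub_apply, LinearMap.comp_apply, h.parity_comm, h'.parity_comm, map_sub, map_neg]
    abel⟩

/-- The generators determine a derivation, so operator identities below reduce to four evaluations.
All base functions are tested, not only coordinates, because `A` is an arbitrary algebra. -/
theorem IsEvenDer.ext (h : IsEvenDer D) (h' : IsEvenDer D') (hfn : ∀ a, D (fn a) = D' (fn a))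
    (htheta : ∀ i, D (theta i) = D' (theta i)) (hmom : ∀ i, D (mom i) = D' (mom i))
    (hpsi : ∀ i, D (psi i) = D' (psi i)) : D = D' := by
  ext x
  induction x using SFun.gen_induct with
  | hfn a => exact hfn a
  | hodd s => exact Sum.rec htheta hmom s
  | hpsi i => exact hpsi i
  | hmul x y hx hy => rw [h.leibniz, h'.leibniz, hx, hy]
  | hadd x y hx hy => rw [map_add, map_add, hx, hy]

theorem IsOddDer.ext (h : IsOddDer D) (h' : IsOddDer D') (hfn : ∀ a, D (fn a) = D' (fn a))
    (htheta : ∀ i, D (theta i) = D' (theta i)) (hmom : ∀ i, D (mom i) = D' (mom i))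
    (hpsi : ∀ i, D (psi i) = D' (psi i)) : D = D' := by
  ext x
  induction x using SFun.gen_induct with
  | hfn a => exact hfn a
  | hodd s => exact Sum.rec htheta hmom s
  | hpsi i => exact hpsi i
  | hmul x y hx hy => rw [h.leibniz, h'.leibniz, hx, hy]
  | hadd x y hx hy => rw [map_add, map_add, hx, hy]

/-! ### The coordinate derivations are graded derivations -/

theorem isEvenDer_dBase (X : Derivation ℝ A A) : IsEvenDer (dBase X : SFun n A →ₗ[ℝ] SFun n A) := by
  have key : ∀ a b : A, ∀ q : Poly n, ∀ e : Ext n,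
      SFun.mk (X (a * b)) q e = SFun.mk (X a * b) q e + SFun.mk (a * X b) q e := by
    intro a b q e
    rw [SFun.mk_factor, SFun.mk_factor (X a * b), SFun.mk_factor (a * X b), ← add_mul, fn, fn, fn,
      ← map_add, X.leibniz, smul_eq_mul, smul_eq_mul, add_comm, mul_comm b]
  refine ⟨fun x y => ?_, fun x => ?_⟩
  · induction x using SFun.induct with
    | zero => simp
    | add x y hx hy => simp only [add_mul, map_add, hx, hy]; abel
    | mk a q e =>
      induction y using SFun.induct with
      | zero => simp
      | add x y hx hy => simp only [mul_add, map_add, hx, hy]; abel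
      | mk b r d =>
        simp only [SFun.mk_mul_mk, dBase, SFun.map_mk, LinearMap.id_apply, Derivation.coeFn_coe, key]
  · induction x using SFun.induct with
    | zero => simp
    | add x y hx hy => simp only [map_add, hx, hy]
    | mk a q e => simp [dBase, parity, SFun.map_mk]

theorem isEvenDer_dPsi (i : Fin n) : IsEvenDer (dPsi i : SFun n A →ₗ[ℝ] SFun n A) := by
  have key : ∀ a : A, ∀ q r : Poly n, ∀ e : Ext n,
      SFun.mk a (MvPolynomial.pderiv i (q * r)) e = SFun.mk a (MvPolynomial.pderiv i q * r) e
        + SFun.mk a (q * MvPolynomial.pderiv i r) e := by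
    intro a q r e
    rw [Derivation.leibniz, smul_eq_mul, smul_eq_mul, add_comm, mul_comm r]
    exact ((TensorProduct.mk ℝ A (Fibre n) a).comp
          ((TensorProduct.mk ℝ (Poly n) (Ext n)).flip e : Poly n →ₗ[ℝ] Fibre n)).map_add _ _
  refine ⟨fun x y => ?_, fun x => ?_⟩
  · induction x using SFun.induct with
    | zero => simp
    | add x y hx hy => simp only [add_mul, map_add, hx, hy]; abel
    | mk a q e =>
      induction y using SFun.induct with
      | zero => simp
      | add x y hx hy => simp only [mul_add, map_add, hx, hy]; abel
      | mk b r d =>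
        simp only [SFun.mk_mul_mk, dPsi, SFun.map_mk, LinearMap.id_apply, Derivation.coeFn_coe, key]
  · induction x using SFun.induct with
    | zero => simp
    | add x y hx hy => simp only [map_add, hx, hy]
    | mk a q e => simp [dPsi, parity, SFun.map_mk]

theorem SFun.mk_add (a : A) (q : Poly n) (d e : Ext n) :
    SFun.mk a q (d + e) = SFun.mk a q d + SFun.mk a q e := by
  rw [SFun.mk_factor a q (d + e), SFun.mk_factor a q d, SFun.mk_factor a q e, map_add, mul_add, mul_add]

theorem contractLeft_involute {V : Type*} [AddCommGroup V] [Module ℝ V] (f : Module.Dual ℝ V)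
    (x : ExteriorAlgebra ℝ V) :
    CliffordAlgebra.contractLeft (Q := (0 : QuadraticForm ℝ V)) f (CliffordAlgebra.involute x)
      = -CliffordAlgebra.involute (CliffordAlgebra.contractLeft (Q := (0 : QuadraticForm ℝ V)) f x) := by
  induction x using CliffordAlgebra.left_induction with
  | algebraMap r => simp
  | add x y hx hy => simp only [map_add, hx, hy, neg_add]
  | ι_mul x v hx =>
    simp only [map_mul, CliffordAlgebra.involute_ι, neg_mul, map_neg,
      CliffordAlgebra.contractLeft_ι_mul, hx, map_sub, map_smul]
    simp

/-- Induction on the left factor, one vector at a time: moving the contraction past a vector costs a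
sign, and `involute` accumulates these signs. -/
theorem contractLeft_mul {V : Type*} [AddCommGroup V] [Module ℝ V] (f : Module.Dual ℝ V)
    (x y : ExteriorAlgebra ℝ V) :
    CliffordAlgebra.contractLeft (Q := (0 : QuadraticForm ℝ V)) f (x * y)
      = CliffordAlgebra.contractLeft (Q := (0 : QuadraticForm ℝ V)) f x * y
        + CliffordAlgebra.involute x * CliffordAlgebra.contractLeft (Q := (0 : QuadraticForm ℝ V)) f y := by
  induction x using CliffordAlgebra.left_induction generalizing y with
  | algebraMap r => simp [CliffordAlgebra.contractLeft_algebraMap_mul]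
  | add x y hx hy => simp only [map_add, add_mul, hx, hy]; abel
  | ι_mul x v hx =>
    simp only [mul_assoc, map_mul, CliffordAlgebra.involute_ι, neg_mul,
      CliffordAlgebra.contractLeft_ι_mul, hx, mul_add, sub_mul, smul_mul_assoc]
    abel

theorem isOddDer_dOdd (s : Fin n ⊕ Fin n) : IsOddDer (dOdd s : SFun n A →ₗ[ℝ] SFun n A) := by
  refine ⟨fun x y => ?_, fun x => ?_⟩
  · induction x using SFun.induct with
    | zero => simp
    | add x y hx hy => simp only [add_mul, map_add, hx, hy]; abel
    | mk a q e =>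
      induction y using SFun.induct with
      | zero => simp
      | add x y hx hy => simp only [mul_add, map_add, hx, hy]; abel
      | mk b r d =>
        simp only [SFun.mk_mul_mk, dOdd, parity, SFun.map_mk, LinearMap.id_apply,
          ← SFun.mk_add, AlgHom.toLinearMap_apply]
        exact congrArg (SFun.mk _ _) (contractLeft_mul _ _ _)
  · induction x using SFun.induct with
    | zero => simp
    | add x y hx hy => simp only [map_add, hx, hy, neg_add]
    | mk a q e =>
      simp only [dOdd, parity, SFun.map_mk, LinearMap.id_apply, ← SFun.mk_neg,
        AlgHom.toLinearMap_apply]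
      exact congrArg (SFun.mk _ _) (contractLeft_involute _ _)

end Super

/-! ## Values of the vector fields on the generators -/

section Values

variable {n : ℕ} {A : Type*} [CommRing A] [Algebra ℝ A]

theorem SFun.mk_zero_left (q : Poly n) (e : Ext n) : (SFun.mk 0 q e : SFun n A) = 0 := by
  rw [SFun.mk_factor, fn, map_zero, zero_mul]

theorem SFun.mk_zero_right (a : A) (q : Poly n) : (SFun.mk a q 0 : SFun n A) = 0 := by
  rw [SFun.mk_factor, map_zero, mul_zero, mul_zero]

theorem SFun.mk_zero_mid (a : A) (e : Ext n) : (SFun.mk a 0 e : SFun n A) = 0 :=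
  ((TensorProduct.mk ℝ A (Fibre n) a).comp
    ((TensorProduct.mk ℝ (Poly n) (Ext n)).flip e : Poly n →ₗ[ℝ] Fibre n)).map_zero

@[simp] theorem dBase_fn (X : Derivation ℝ A A) (f : A) : dBase X (fn f : SFun n A) = fn (X f) := rfl

@[simp] theorem dBase_odd (X : Derivation ℝ A A) (s) : dBase X (odd s : SFun n A) = 0 := by
  rw [odd_eq, dBase, SFun.map_mk, Derivation.coeFn_coe, Derivation.map_one_eq_zero,
    SFun.mk_zero_left]

@[simp] theorem dBase_psi (X : Derivation ℝ A A) (i) : dBase X (psi i : SFun n A) = 0 := by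
  rw [psi, dBase, SFun.map_mk, Derivation.coeFn_coe, Derivation.map_one_eq_zero,
    SFun.mk_zero_left]

@[simp] theorem dPsi_fn (i : Fin n) (f : A) : dPsi i (fn f : SFun n A) = 0 := by
  rw [fn_eq, dPsi, SFun.map_mk]
  exact (congrArg (fun q => SFun.mk f q 1) (Derivation.map_one_eq_zero _)).trans (SFun.mk_zero_mid _ _)

@[simp] theorem dPsi_odd (i : Fin n) (s) : dPsi i (odd s : SFun n A) = 0 := by
  rw [odd_eq, dPsi, SFun.map_mk]
  exact (congrArg (fun q => SFun.mk 1 q _) (Derivation.map_one_eq_zero _)).trans (SFun.mk_zero_mid _ _)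

@[simp] theorem dPsi_psi (i j : Fin n) : dPsi i (psi j : SFun n A) = if i = j then 1 else 0 := by
  rw [psi, dPsi, SFun.map_mk]
  have h := MvPolynomial.pderiv_X (R := ℝ) i j
  refine (congrArg (fun q => SFun.mk 1 q _) h).trans ?_
  split_ifs with hij
  · subst hij; simp [SFun.one_eq]
  · simp [hij, SFun.mk_zero_mid]

@[simp] theorem dOdd_fn (s : Fin n ⊕ Fin n) (f : A) : dOdd s (fn f : SFun n A) = 0 := by
  rw [fn_eq, dOdd, SFun.map_mk]
  exact (congrArg (SFun.mk f 1) (CliffordAlgebra.contractLeft_one _ _)).trans (SFun.mk_zero_right _ _)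

@[simp] theorem dOdd_psi (s : Fin n ⊕ Fin n) (i) : dOdd s (psi i : SFun n A) = 0 := by
  rw [psi, dOdd, SFun.map_mk]
  exact (congrArg (SFun.mk 1 _) (CliffordAlgebra.contractLeft_one _ _)).trans (SFun.mk_zero_right _ _)

@[simp] theorem dOdd_odd (s t : Fin n ⊕ Fin n) :
    dOdd s (odd t : SFun n A) = if s = t then 1 else 0 := by
  rw [odd_eq, dOdd, SFun.map_mk]
  refine (congrArg (SFun.mk 1 _) (CliffordAlgebra.contractLeft_ι _ _ _)).trans ?_
  split_ifs with h
  · subst h; simp [SFun.one_eq]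
  · simp [h, SFun.mk_zero_right]

theorem isOdd_mom (i : Fin n) : IsOdd (mom i : SFun n A) := isOdd_odd _

theorem isOdd_theta (i : Fin n) : IsOdd (theta i : SFun n A) := isOdd_odd _

/-! ### The fields of degree -1 on generators -/

variable (ε ε' : Fin n → A) (α α' : Fin n → Fin n → A)

theorem isOddDer_epsField : IsOddDer (epsField ε α) := by
  refine .add (.sum _ fun i => (isOddDer_dOdd _).lmul_even (isEven_fn _)) (.sum _ fun i => .sum _ fun j =>
    (isEvenDer_dPsi _).lmul_odd ?_)
  rw [fn_mul]; exact (isOdd_theta j).smul _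

@[simp] theorem epsField_fn (f : A) : epsField ε α (fn f) = 0 := by
  simp [epsField, lmul, dMom]

@[simp] theorem epsField_theta (i : Fin n) : epsField ε α (theta i) = 0 := by
  simp [epsField, lmul, dMom, theta]

@[simp] theorem epsField_mom (i : Fin n) : epsField ε α (mom i) = ε i • 1 := by
  simp [epsField, lmul, dMom, mom, fn_eq_smul]

@[simp] theorem epsField_psi (i : Fin n) : epsField ε α (psi i) = ∑ j, α i j • theta j := by
  simp only [epsField, lmul, dMom, LinearMap.add_apply, LinearMap.sum_apply, LinearMap.comp_apply,
    LinearMap.mulLeft_apply, dOdd_psi, dPsi_psi, mul_ite, mul_one, mul_zero, fn_mul,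
    Finset.sum_const_zero, zero_add]
  rw [Finset.sum_comm]
  simp

@[simp] theorem epsField_smul (a : A) (x : SFun n A) :
    epsField ε α (a • x) = a • epsField ε α x := by
  rw [← fn_mul, (isOddDer_epsField ε α).leibniz, epsField_fn, zero_mul, zero_add, parity_fn, fn_mul]

/-! ### The operators `d`, `ι_Q` and `Q̃` on generators -/

variable (pd : Fin n → Derivation ℝ A A)

theorem isOddDer_deRham : IsOddDer (deRham pd) :=
  .sum _ fun i => .add ((isEvenDer_dBase _).lmul_odd (isOdd_theta i))
    ((isOddDer_dOdd _).lmul_even (isEven_psi i))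

@[simp] theorem deRham_fn (f : A) : deRham pd (fn f) = ∑ i, pd i f • theta i := by
  simp [deRham, lmul, dMom, ← fn_mul, (fn_commute _ _).eq]

@[simp] theorem deRham_theta (i : Fin n) : deRham pd (theta i) = 0 := by
  simp [deRham, lmul, dMom, theta]

@[simp] theorem deRham_mom (i : Fin n) : deRham pd (mom i) = psi i := by
  simp [deRham, lmul, dMom, mom]

@[simp] theorem deRham_psi (i : Fin n) : deRham pd (psi i) = 0 := by
  simp [deRham, lmul, dMom]

theorem deRham_smul (a : A) (x : SFun n A) :
    deRham pd (a • x) = ∑ i, pd i a • (theta i * x) + a • deRham pd x := by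
  rw [← fn_mul, (isOddDer_deRham pd).leibniz, deRham_fn, parity_fn, fn_mul, Finset.sum_mul]
  simp only [smul_mul_assoc]

variable (π : Fin n → Fin n → A) (H : Fin n → Fin n → Fin n → A)

theorem Qx_eq (i : Fin n) : Qx π i = ∑ j, π j i • mom j := by
  simp only [Qx, fn_mul]

theorem Qp_eq (i : Fin n) :
    Qp pd π H i = -((1 / 2 : ℝ) • ∑ j, ∑ k, structC pd π H i j k • (mom j * mom k)) := by
  simp only [Qp, fn_mul, smul_mul_assoc]

theorem isOdd_Qx (i : Fin n) : IsOdd (Qx π i) := by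
  rw [Qx_eq]; exact .sum _ fun j => (isOdd_mom j).smul _

theorem isEven_Qp (i : Fin n) : IsEven (Qp pd π H i) := by
  rw [Qp_eq]
  exact .neg (.rsmul _ (.sum _ fun j => .sum _ fun k => ((isOdd_mom j).mul (isOdd_mom k)).smul _))

theorem isEvenDer_contractQ : IsEvenDer (contractQ pd π H) :=
  .sum _ fun i => .add ((isOddDer_dOdd _).lmul_odd (isOdd_Qx _ i))
    ((isEvenDer_dPsi _).lmul_even (isEven_Qp _ _ _ i))

@[simp] theorem contractQ_fn (f : A) : contractQ pd π H (fn f) = 0 := by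
  simp [contractQ, lmul, dTheta]

@[simp] theorem contractQ_theta (i : Fin n) : contractQ pd π H (theta i) = Qx π i := by
  simp [contractQ, lmul, dTheta, theta]

@[simp] theorem contractQ_mom (i : Fin n) : contractQ pd π H (mom i) = 0 := by
  simp [contractQ, lmul, dTheta, mom]

@[simp] theorem contractQ_psi (i : Fin n) : contractQ pd π H (psi i) = Qp pd π H i := by
  simp [contractQ, lmul, dTheta]

@[simp] theorem contractQ_smul (a : A) (x : SFun n A) :
    contractQ pd π H (a • x) = a • contractQ pd π H x := by
  rw [← fn_mul, (isEvenDer_contractQ pd π H).leibniz, contractQ_fn, zero_mul, zero_add, fn_mul]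

theorem isOddDer_Qtilde : IsOddDer (Qtilde pd π H) :=
  .add (isOddDer_deRham pd) ((isEvenDer_contractQ pd π H).comm_odd (isOddDer_deRham pd))

theorem Qtilde_fn (f : A) : Qtilde pd π H (fn f) = ∑ i, pd i f • (theta i + Qx π i) := by
  simp [Qtilde, smul_add, Finset.sum_add_distrib]

theorem Qtilde_theta (i : Fin n) : Qtilde pd π H (theta i) = -deRham pd (Qx π i) := by
  simp [Qtilde]

theorem Qtilde_mom (i : Fin n) : Qtilde pd π H (mom i) = psi i + Qp pd π H i := by
  simp [Qtilde]

theorem Qtilde_psi (i : Fin n) : Qtilde pd π H (psi i) = -deRham pd (Qp pd π H i) := by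
  simp [Qtilde]

theorem Qtilde_smul (a : A) (x : SFun n A) : Qtilde pd π H (a • x)
    = ∑ i, pd i a • ((theta i + Qx π i) * x) + a • Qtilde pd π H x := by
  rw [← fn_mul, (isOddDer_Qtilde pd π H).leibniz, Qtilde_fn, parity_fn, fn_mul, Finset.sum_mul]
  simp only [smul_mul_assoc]

theorem epsField_Qx (i : Fin n) : epsField ε α (Qx π i) = sharp π ε i • 1 := by
  simp [Qx_eq, sharp, Finset.sum_smul, smul_smul]

/-- Since the field kills base functions, this is the value of the whole graded commutator with
`Q̃`, which therefore covers the vector field `π^# ε` on the base. -/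
theorem epsField_Qtilde_fn (f : A) :
    epsField ε α (Qtilde pd π H (fn f)) = fn (∑ k, sharp π ε k * pd k f) := by
  rw [fn_eq_smul (∑ k, sharp π ε k * pd k f)]
  simp only [Qtilde_fn, map_sum, epsField_smul, map_add, epsField_theta, epsField_Qx, zero_add,
    Finset.sum_smul, smul_smul, mul_comm]

/-- The matrix of `[D, Q̃]` on the generators `θ`, for `D = epsField ε α`. -/
def thetaMatrix (j l : Fin n) : A := ∑ m, (pd l (π m j) * ε m - π m j * α m l)

theorem epsField_Qtilde_theta (j : Fin n) :
    epsField ε α (Qtilde pd π H (theta j)) = ∑ l, thetaMatrix ε α pd π j l • theta l := by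
  have hD := isOddDer_epsField ε α
  simp only [Qtilde_theta, map_neg, Qx_eq, map_sum, deRham_smul, map_add, deRham_mom, epsField_smul,
    hD.leibniz, epsField_theta, zero_mul, zero_add, parity_theta, epsField_mom, epsField_psi,
    mul_smul_comm, mul_one, thetaMatrix, Finset.sum_smul, sub_smul, ← smul_smul,
    Finset.smul_sum, smul_neg, Finset.sum_neg_distrib, Finset.sum_sub_distrib,
    Finset.sum_add_distrib]
  rw [Finset.sum_comm, Finset.sum_comm (f := fun x y => π x j • α x y • (theta y : SFun n A))]
  abel

theorem epsField_Qtilde_smul_theta (a : A) (j : Fin n) :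
    epsField ε α (Qtilde pd π H (a • theta j))
      = (∑ k, sharp π ε k * pd k a) • theta j + a • ∑ l, thetaMatrix ε α pd π j l • theta l := by
  have hD := isOddDer_epsField ε α
  simp only [Qtilde_smul, map_add, map_sum, epsField_smul, hD.leibniz, epsField_Qtilde_theta,
    epsField_theta, epsField_Qx, zero_add, mul_zero, add_zero, smul_mul_assoc, one_mul,
    Finset.sum_smul, smul_smul, mul_comm]

theorem structC_skew (hπ : ∀ i j, π j i = -π i j) (hH : ∀ i j k, H i k j = -H i j k) (i j k : Fin n) :
    structC pd π H i k j = -structC pd π H i j k := by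
  simp only [structC]
  rw [hπ j k, map_neg, Finset.sum_comm, neg_sub', sub_right_inj, ← Finset.sum_neg_distrib]
  refine Finset.sum_congr rfl fun a _ => ?_
  rw [← Finset.sum_neg_distrib]
  exact Finset.sum_congr rfl fun b _ => by rw [hH i a b]; ring

/-- Removes the factor `1/2` from `Q p_i`: contracting with two fields antisymmetrises, and a skew
coefficient counts both halves equally. -/
theorem half_smul_sum_skew (C t : Fin n → Fin n → A) (hC : ∀ j k, C k j = -C j k) :
    (1 / 2 : ℝ) • ∑ j, ∑ k, C j k * (t j k - t k j) = ∑ j, ∑ k, C j k * t j k := by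
  have h : ∑ j, ∑ k, C j k * t k j = -∑ j, ∑ k, C j k * t j k := by
    rw [Finset.sum_comm]
    simp only [← Finset.sum_neg_distrib]
    exact Finset.sum_congr rfl fun j _ => Finset.sum_congr rfl fun k _ => by rw [hC]; ring
  simp only [mul_sub, Finset.sum_sub_distrib, h, sub_neg_eq_add]
  rw [← two_smul ℝ, smul_smul]
  norm_num

theorem epsField_Qp (hC : ∀ i j k, structC pd π H i k j = -structC pd π H i j k) (i : Fin n) :
    epsField ε α (epsField ε' α' (Qp pd π H i))
      = -((∑ j, ∑ k, structC pd π H i j k * (ε' j * ε k)) • 1) := by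
  have hD := isOddDer_epsField ε' α'
  have e : ∀ j k, epsField ε α (epsField ε' α' (mom j * mom k))
      = (ε' j * ε k - ε' k * ε j) • 1 := by
    intro j k
    simp only [hD.leibniz, epsField_mom, parity_mom, smul_mul_assoc, one_mul, mul_smul_comm,
      mul_one, map_add, map_neg, epsField_smul, smul_neg, smul_smul, sub_smul]
    abel
  simp only [Qp_eq, map_neg, map_smul, map_sum, epsField_smul, e]
  rw [← half_smul_sum_skew _ (fun j k => ε' j * ε k) (hC i)]
  simp only [base_smul_smul, Finset.sum_smul, smul_smul]

/-- `d` turns `C p p` into terms `∂C θ p p` and `C ψ p`. The two contractions remove both momenta in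
the first, and in the second remove `p` and replace `ψ` by `α θ`, so a linear form in `θ` remains.
-/
theorem epsField_deRham_Qp (hC : ∀ i j k, structC pd π H i k j = -structC pd π H i j k)
    (i : Fin n) :
    epsField ε α (epsField ε' α' (deRham pd (Qp pd π H i)))
      = -∑ l, (∑ j, ∑ k, (pd l (structC pd π H i j k) * (ε' j * ε k)
        + structC pd π H i j k * (α j l * ε' k - α' j l * ε k))) • theta l := by
  have hD := isOddDer_epsField ε α
  have hD' := isOddDer_epsField ε' α'
  have hd := isOddDer_deRham pd
  have e1 : ∀ l j k, epsField ε α (epsField ε' α' (theta l * (mom j * mom k)))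
      = (ε' j * ε k - ε' k * ε j) • theta l := by
    intro l j k
    simp only [hD'.leibniz, hD.leibniz, epsField_mom, epsField_theta, parity_theta, zero_mul, zero_add,
      parity_mom, smul_mul_assoc, one_mul, neg_mul, mul_neg, mul_add, mul_smul_comm,
      mul_one, map_add, map_neg, epsField_smul, smul_smul, sub_smul, smul_neg]
    abel
  have e2 : ∀ j k, epsField ε α (epsField ε' α' (psi j * mom k))
      = ∑ l, (α j l * ε' k - α' j l * ε k) • theta l := by
    intro j k
    simp only [hD'.leibniz, hD.leibniz, epsField_mom, epsField_psi, epsField_theta, parity_theta,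
      zero_mul, zero_add, parity_psi, Finset.sum_mul, map_sum, smul_mul_assoc,
      mul_smul_comm, mul_one, map_add, epsField_smul, smul_smul, sub_smul, smul_neg,
      Finset.smul_sum, ← Finset.sum_add_distrib]
    refine Finset.sum_congr rfl fun l _ => ?_
    rw [mul_comm (ε' k)]; abel
  have e3 : ∀ j k, (mom j * psi k : SFun n A) = psi k * mom j :=
    fun j k => ((isEven_psi k).2 _).symm
  have e4 : ∀ j k, epsField ε α (epsField ε' α' (deRham pd (structC pd π H i j k • (mom j * mom k))))
      = ∑ l, (pd l (structC pd π H i j k) * (ε' j * ε k - ε' k * ε j)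
        + structC pd π H i j k * ((α j l * ε' k - α' j l * ε k) - (α k l * ε' j - α' k l * ε j)))
          • theta l := by
    intro j k
    simp only [deRham_smul, hd.leibniz, deRham_mom, parity_mom, neg_mul, e3, map_add, map_neg, map_sum,
      epsField_smul, e1, e2, smul_smul, add_smul, mul_sub, sub_smul, Finset.sum_add_distrib,
      Finset.sum_sub_distrib, smul_add, smul_neg, smul_sub, Finset.smul_sum]
    abel
  simp only [Qp_eq, map_neg, map_smul, map_sum, e4]
  rw [neg_inj]
  have e5 : ∀ l, ∑ j, ∑ k, (pd l (structC pd π H i j k) * (ε' j * ε k)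
        + structC pd π H i j k * (α j l * ε' k - α' j l * ε k))
      = (1 / 2 : ℝ) • ∑ j, ∑ k, (pd l (structC pd π H i j k) * (ε' j * ε k - ε' k * ε j)
        + structC pd π H i j k * ((α j l * ε' k - α' j l * ε k) - (α k l * ε' j - α' k l * ε j))) := by
    intro l
    have h1 := half_smul_sum_skew (fun j k => pd l (structC pd π H i j k)) (fun j k => ε' j * ε k)
      (fun j k => by rw [hC, map_neg])
    have h2 := half_smul_sum_skew (structC pd π H i) (fun j k => α j l * ε' k - α' j l * ε k) (hC i)
    simp only [Finset.sum_add_distrib, smul_add, h1, h2]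
  simp only [e5, base_smul_smul, ← Finset.smul_sum, Finset.sum_smul]
  congr 1
  rw [Finset.sum_comm]
  conv_rhs => rw [Finset.sum_comm]
  rw [Finset.sum_comm]
  refine Finset.sum_congr rfl fun j _ => ?_
  rw [Finset.sum_comm]

/-- The component of the derived bracket along `∂/∂p`. -/
def derivedMom (i : Fin n) : A :=
  ∑ k, sharp π ε k * pd k (ε' i) - ∑ k, sharp π ε' k * pd k (ε i)
    - ∑ j, ∑ k, structC pd π H i j k * (ε' j * ε k)

/-- The component of the derived bracket along `∂/∂ψ`. -/
def derivedPsi (i l : Fin n) : A :=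
  (∑ k, sharp π ε k * pd k (α' i l) + ∑ j, α' i j * thetaMatrix ε α pd π j l)
    - (∑ k, sharp π ε' k * pd k (α i l) + ∑ j, α i j * thetaMatrix ε' α' pd π j l)
    + ∑ j, ∑ k, (pd l (structC pd π H i j k) * (ε' j * ε k)
        + structC pd π H i j k * (α j l * ε' k - α' j l * ε k))

/-- Both sides are odd derivations. On base functions and on `θ` the bracket vanishes, because `[Q̃,
D']` maps these to base functions and to combinations of `θ`, all killed by `D`. The values on `p`
and `ψ` give the two families of components. -/
theorem derivedBracket_epsField (hC : ∀ i j k, structC pd π H i k j = -structC pd π H i j k) :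
    derivedBracket (Qtilde pd π H) (epsField ε α) (epsField ε' α')
      = epsField (derivedMom ε ε' pd π H) (derivedPsi ε ε' α α' pd π H) := by
  have hD := isOddDer_epsField ε α
  have hD' := isOddDer_epsField ε' α'
  have hQ := isOddDer_Qtilde pd π H
  refine IsOddDer.ext (hD.comm_even (hQ.comm_odd hD')) (isOddDer_epsField _ _) (fun f => ?_)
    (fun i => ?_) (fun i => ?_) fun i => ?_
  · simp only [derivedBracket, LinearMap.sub_apply, LinearMap.add_apply, LinearMap.comp_apply,
      epsField_fn, map_zero, zero_add, epsField_Qtilde_fn, sub_zero]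
  · simp only [derivedBracket, LinearMap.sub_apply, LinearMap.add_apply, LinearMap.comp_apply,
      epsField_theta, map_zero, zero_add, epsField_Qtilde_theta, sub_zero, map_sum,
      epsField_smul, smul_zero, Finset.sum_const_zero]
  · simp only [derivedBracket, LinearMap.sub_apply, LinearMap.add_apply, LinearMap.comp_apply,
      epsField_mom, Qtilde_mom, map_add, epsField_psi, map_sum, epsField_smul, epsField_theta,
      epsField_Qp _ _ _ _ _ _ _ hC, ← fn_eq_smul, epsField_Qtilde_fn, epsField_fn, map_zero,
      smul_zero, Finset.sum_const_zero, zero_add, derivedMom]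
    rw [fn, fn, fn, fn, map_sub, map_sub]
    abel
  · simp only [derivedBracket, LinearMap.sub_apply, LinearMap.add_apply, LinearMap.comp_apply,
      epsField_psi, Qtilde_psi, map_add, map_neg, map_sum, epsField_theta, epsField_smul, smul_zero,
      epsField_deRham_Qp _ _ _ _ _ _ _ hC, epsField_Qtilde_smul_theta, Finset.sum_const_zero,
      map_zero, neg_neg, derivedPsi, add_smul, sub_smul, Finset.sum_add_distrib,
      Finset.sum_sub_distrib]
    have e : ∀ (α : Fin n → Fin n → A) (T : Fin n → Fin n → A),
        ∑ j, α i j • ∑ l, T j l • (theta l : SFun n A) = ∑ l, (∑ j, α i j * T j l) • theta l := by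
      intro α T
      simp only [Finset.smul_sum, Finset.sum_smul, smul_smul]
      exact Finset.sum_comm
    rw [e, e]
    abel

end Values

/-! ## The derived bracket in terms of tensor calculus -/

section Tensor

variable {n : ℕ} {A : Type*} [CommRing A] [Algebra ℝ A]
variable (ε ε' : Fin n → A) (β β' : Fin n → Fin n → A)
variable (pd : Fin n → Derivation ℝ A A)
variable (π : Fin n → Fin n → A) (H : Fin n → Fin n → Fin n → A)

/-- The contraction `C_i^{jk} ε_k`. -/
theorem sum_structC_mul (hπ : ∀ i j, π j i = -π i j)
    (hH : ∀ i j k, H j i k = -H i j k ∧ H i k j = -H i j k) (i j : Fin n) :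
    ∑ k, structC pd π H i j k * ε k
      = -pd i (sharp π ε j) + ∑ k, π k j * (pd i (ε k) + contr3 (sharp π ε) H i k) := by
  have e1 : ∑ k, pd i (π j k) * ε k = -pd i (sharp π ε j) + ∑ k, π k j * pd i (ε k) := by
    simp only [sharp, map_sum, Derivation.leibniz, smul_eq_mul, Finset.sum_add_distrib]
    rw [neg_add_rev, neg_add_cancel_right, ← Finset.sum_neg_distrib]
    exact Finset.sum_congr rfl fun k _ => by rw [hπ k j, map_neg]; ring
  have e2 : ∑ k, (∑ a, ∑ b, H i a b * π j a * π k b) * ε k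
      = -∑ k, π k j * contr3 (sharp π ε) H i k := by
    simp only [contr3, sharp, Finset.sum_mul, Finset.mul_sum]
    rw [Finset.sum_comm, ← Finset.sum_neg_distrib]
    refine Finset.sum_congr rfl fun a _ => ?_
    rw [Finset.sum_comm, ← Finset.sum_neg_distrib]
    refine Finset.sum_congr rfl fun b _ => ?_
    rw [← Finset.sum_neg_distrib]
    refine Finset.sum_congr rfl fun k _ => ?_
    rw [hπ a j, (hH i b a).1, (hH i a b).2]; ring
  simp only [structC, sub_mul, Finset.sum_sub_distrib, e1, e2, mul_add, Finset.sum_add_distrib]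
  ring

/-- The term `C_i^{jk} ε'_j ε_k` is expanded by `sum_structC_mul`. Using `π(ε, ε') = -ε_k (π^#
ε')^k`, the summand `d(π(ε, ε'))` cancels the terms with `∂_i (π^# ε')^k` in the Lie derivatives. -/
theorem derivedMom_eq (hπ : ∀ i j, π j i = -π i j)
    (hH : ∀ i j k, H j i k = -H i j k ∧ H i k j = -H i j k) :
    derivedMom ε ε' pd π H = bracketForm pd π H ε ε' := by
  funext i
  have e1 : ∑ j, ∑ k, structC pd π H i j k * (ε' j * ε k)
      = ∑ j, ε' j * (-pd i (sharp π ε j) + ∑ k, π k j * (pd i (ε k) + contr3 (sharp π ε) H i k)) := by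
    refine Finset.sum_congr rfl fun j _ => ?_
    rw [← sum_structC_mul ε pd π H hπ hH, Finset.mul_sum]
    exact Finset.sum_congr rfl fun k _ => by ring
  have e2 : ∀ u : Fin n → A, ∑ j, ε' j * ∑ k, π k j * u k = -∑ k, u k * sharp π ε' k := by
    intro u
    simp only [sharp, Finset.mul_sum]
    rw [Finset.sum_comm, ← Finset.sum_neg_distrib]
    refine Finset.sum_congr rfl fun k _ => ?_
    rw [← Finset.sum_neg_distrib]
    exact Finset.sum_congr rfl fun j _ => by rw [hπ j k]; ring
  have e3 : pair π ε ε' = ∑ k, ε' k * sharp π ε k := by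
    simp only [pair, sharp, Finset.mul_sum]
    rw [Finset.sum_comm]
    exact Finset.sum_congr rfl fun k _ => Finset.sum_congr rfl fun j _ => by ring
  have e4 : pair π ε ε' = -∑ k, ε k * sharp π ε' k := by
    simp only [pair, sharp, Finset.mul_sum]
    rw [← Finset.sum_neg_distrib]
    refine Finset.sum_congr rfl fun k _ => ?_
    rw [← Finset.sum_neg_distrib]
    exact Finset.sum_congr rfl fun j _ => by rw [hπ j k]; ring
  have e5 : contr2 (sharp π ε) (contr3 (sharp π ε') H) i
      = ∑ k, contr3 (sharp π ε) H i k * sharp π ε' k := by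
    simp only [contr2, contr3, Finset.mul_sum, Finset.sum_mul]
    rw [Finset.sum_comm]
    refine Finset.sum_congr rfl fun k _ => Finset.sum_congr rfl fun j _ => ?_
    rw [(hH j k i).1, (hH j i k).2]; ring
  have e4' : pd i (pair π ε ε') = -∑ k, (ε k * pd i (sharp π ε' k) + sharp π ε' k * pd i (ε k)) := by
    rw [e4]; simp only [map_neg, map_sum, Derivation.leibniz, smul_eq_mul]
  simp only [derivedMom, e1, bracketForm, lie1, e4', e5, mul_add, Finset.sum_add_distrib, e2,
    Finset.sum_neg_distrib, mul_neg]
  simp only [mul_comm (pd i (ε _))]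
  ring

/-- By `sum_structC_mul`, the derivative `∂_i (π^# ε)^k` from the Lie derivative, the half `∂_i ε_k`
of `dε` and the `H`-term combine into the structure functions. Only the other half `∂_j ε_i` of `dε`
stays explicit. -/
theorem action_eq (hπ : ∀ i j, π j i = -π i j)
    (hH : ∀ i j k, H j i k = -H i j k ∧ H i k j = -H i j k) (i l : Fin n) :
    action pd π H ε β i l = ∑ k, sharp π ε k * pd k (β i l) + ∑ k, β i k * pd l (sharp π ε k)
      - ∑ j, ∑ k, structC pd π H i j k * (β j l * ε k) + ∑ j, ∑ k, π j k * pd j (ε i) * β k l := by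
  have e1 : ∑ j, ∑ k, structC pd π H i j k * (β j l * ε k)
      = ∑ j, β j l * (-pd i (sharp π ε j) + ∑ k, π k j * (pd i (ε k) + contr3 (sharp π ε) H i k)) := by
    refine Finset.sum_congr rfl fun j _ => ?_
    rw [← sum_structC_mul ε pd π H hπ hH, Finset.mul_sum]
    exact Finset.sum_congr rfl fun k _ => by ring
  have e2 : ∀ u : Fin n → A, ∑ j, ∑ k, π j k * u j * β k l = ∑ j, β j l * ∑ k, π k j * u k := by
    intro u
    simp only [Finset.mul_sum]
    rw [Finset.sum_comm]
    exact Finset.sum_congr rfl fun k _ => Finset.sum_congr rfl fun j _ => by ring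
  have e3 : contr23 π (DH pd π H ε) β i l = ∑ j, β j l * ∑ k, π k j * DH pd π H ε i k := e2 _
  simp only [action, lie2, e3, DH, ext1, e1, e2 (fun j => pd j (ε i)), mul_add, mul_sub, Finset.sum_add_distrib,
    Finset.sum_neg_distrib, Finset.sum_sub_distrib, mul_neg]
  ring

/-- Here the shift by `-∂_l ε_i` pays off: it completes `(∂_l π) ε` to the derivative of `π^# ε`. -/
theorem thetaMatrix_eq (j l : Fin n) :
    thetaMatrix ε (fun i l => -β i l - pd l (ε i)) pd π j l
      = pd l (sharp π ε j) + ∑ m, π m j * β m l := by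
  simp only [thetaMatrix, sharp, map_sum, Derivation.leibniz, smul_eq_mul, ← Finset.sum_add_distrib]
  exact Finset.sum_congr rfl fun m _ => by ring

/-- The new `α`-component again has the shifted form, with the 1-form bracket in place of `ε`, and
its tensor part is the semidirect bracket. Commuting partial derivatives match the second
derivatives of `ε` and `ε'`. -/
theorem derivedPsi_eq (hcomm : ∀ i j f, pd i (pd j f) = pd j (pd i f))
    (hπ : ∀ i j, π j i = -π i j)
    (hH : ∀ i j k, H j i k = -H i j k ∧ H i k j = -H i j k) :
    derivedPsi ε ε' (fun i l => -β i l - pd l (ε i)) (fun i l => -β' i l - pd l (ε' i)) pd π H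
      = fun i l => -(bracketTensor π β β' i l + action pd π H ε β' i l - action pd π H ε' β i l)
        - pd l (bracketForm pd π H ε ε' i) := by
  funext i l
  -- The form with structure functions is the convenient one to differentiate, since `derivedPsi`
  -- already contains `∂_l C`.
  rw [← derivedMom_eq ε ε' pd π H hπ hH]
  have hC := structC_skew pd π H hπ fun i j k => (hH i j k).2
  have hCsum : ∀ u v : Fin n → A, ∑ j, ∑ k, structC pd π H i j k * (u j * v k)
      = -∑ j, ∑ k, structC pd π H i j k * (v j * u k) := by
    intro u v
    rw [Finset.sum_comm]
    simp only [← Finset.sum_neg_distrib]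
    exact Finset.sum_congr rfl fun j _ => Finset.sum_congr rfl fun k _ => by rw [hC]; ring
  have eP : ∀ u v : Fin n → Fin n → A, ∑ j, u i j * ∑ m, π m j * v m l
      = -∑ j, ∑ k, π j k * u i j * v k l := by
    intro u v
    simp only [Finset.mul_sum, ← Finset.sum_neg_distrib]
    exact Finset.sum_congr rfl fun j _ => Finset.sum_congr rfl fun k _ => by rw [hπ j k]; ring
  have eP' : ∀ (u : Fin n → A) (v : Fin n → Fin n → A), ∑ j, pd j (u i) * ∑ m, π m j * v m l
      = -∑ j, ∑ k, π j k * pd j (u i) * v k l := fun u v => eP (fun i j => pd j (u i)) v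
  simp only [derivedPsi, thetaMatrix_eq ε β pd π, thetaMatrix_eq ε' β' pd π,
    action_eq ε β' pd π H hπ hH, action_eq ε' β pd π H hπ hH, derivedMom, bracketTensor, contr23,
    map_sub, map_sum, Derivation.leibniz, smul_eq_mul, map_neg, mul_add, mul_sub, sub_mul,
    mul_neg, neg_mul, Finset.sum_add_distrib, Finset.sum_sub_distrib, Finset.sum_neg_distrib, eP, eP']
  -- Beyond ring identities, the remaining discrepancy is the skew-symmetry of `C_i^{jk}` in the
  -- terms pairing `ε'` with `∂_l ε`.
  have c1 := hCsum ε' (fun k => pd l (ε k))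
  simp only [hcomm _ l, mul_comm (pd l (structC pd π H _ _ _)), mul_comm (ε _) (pd _ _), mul_comm (ε' _) (pd _ _)] at c1 ⊢
  linear_combination -c1

end Tensor

/-! ## `Q̃` squares to zero -/

section Square

variable {n : ℕ} {A : Type*} [CommRing A] [Algebra ℝ A]

section Sums

variable {ι V : Type*} [Fintype ι] [AddCommMonoid V]

theorem sum_rotate₃ (G : ι → ι → ι → V) :
    ∑ a, ∑ b, ∑ c, G a b c = ∑ b, ∑ c, ∑ a, G a b c :=
  Finset.sum_comm.trans (Finset.sum_congr rfl fun _ _ => Finset.sum_comm)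

theorem sum_rotate₄ (G : ι → ι → ι → ι → V) :
    ∑ a, ∑ b, ∑ c, ∑ d, G a b c d = ∑ b, ∑ c, ∑ d, ∑ a, G a b c d :=
  Finset.sum_comm.trans (Finset.sum_congr rfl fun _ _ => sum_rotate₃ _)

theorem sum_reverse₃ (G : ι → ι → ι → V) :
    ∑ a, ∑ b, ∑ c, G a b c = ∑ c, ∑ b, ∑ a, G a b c :=
  Finset.sum_comm.trans ((Finset.sum_congr rfl fun _ _ => Finset.sum_comm).trans Finset.sum_comm)

end Sums

section OddFamily

variable {P : Fin n → SFun n A} (hP : ∀ i, IsOdd (P i))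
include hP

theorem sum_smul_odd_swap (T : Fin n → Fin n → A) :
    ∑ j, ∑ k, T k j • (P j * P k) = -∑ j, ∑ k, T j k • (P j * P k) := by
  rw [Finset.sum_comm]
  simp only [← Finset.sum_neg_distrib]
  exact Finset.sum_congr rfl fun j _ => Finset.sum_congr rfl fun k _ => by
    rw [(hP k).anticomm (hP j), smul_neg]

theorem sum_smul_odd_of_symm {T : Fin n → Fin n → A} (hT : ∀ j k, T j k = T k j) :
    ∑ j, ∑ k, T j k • (P j * P k) = 0 := by
  have h := sum_smul_odd_swap hP T
  simp only [← hT] at h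
  have h2 : (2 : ℝ) • ∑ j, ∑ k, T j k • (P j * P k) = 0 := by
    rw [two_smul]; exact eq_neg_iff_add_eq_zero.mp h
  exact (smul_eq_zero_iff_right (by norm_num)).mp h2

/-- A product of two odd elements is central, so cubic monomials in odd elements are invariant under
cyclic rotation. -/
theorem sum_smul_odd_cycle (T : Fin n → Fin n → Fin n → A) :
    ∑ i, ∑ j, ∑ k, T j k i • (P i * P j * P k) = ∑ i, ∑ j, ∑ k, T i j k • (P i * P j * P k) := by
  rw [Finset.sum_comm]
  refine Finset.sum_congr rfl fun j _ => ?_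
  rw [Finset.sum_comm]
  refine Finset.sum_congr rfl fun k _ => Finset.sum_congr rfl fun i _ => ?_
  rw [mul_assoc, ((hP j).mul (hP k)).2]

end OddFamily

variable (pd : Fin n → Derivation ℝ A A)
variable (π : Fin n → Fin n → A) (H : Fin n → Fin n → Fin n → A)

theorem eq_zero_of_add_self {x : SFun n A} (h : x + x = 0) : x = 0 := by
  rw [← two_smul ℝ] at h
  exact (smul_eq_zero_iff_right (by norm_num)).mp h

theorem deRham_sq (hcomm : ∀ i j f, pd i (pd j f) = pd j (pd i f)) :
    deRham pd ∘ₗ deRham pd = (0 : SFun n A →ₗ[ℝ] SFun n A) := by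
  refine IsEvenDer.ext (isOddDer_deRham pd).sq .zero (fun f => ?_) (fun i => ?_) (fun i => ?_)
    fun i => ?_
  · simp only [LinearMap.comp_apply, deRham_fn, map_sum, deRham_smul, deRham_theta, smul_zero, add_zero,
      LinearMap.zero_apply]
    rw [Finset.sum_comm]
    exact sum_smul_odd_of_symm isOdd_theta fun j k => hcomm j k f
  all_goals simp

/-! ### The Lie derivative along `Q` and the twisted Jacobi identity -/

/-- The Lie derivative `[ι_Q, d]`. -/
def lieQ : SFun n A →ₗ[ℝ] SFun n A :=
  contractQ pd π H ∘ₗ deRham pd - deRham pd ∘ₗ contractQ pd π H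

theorem isOddDer_lieQ : IsOddDer (lieQ pd π H) :=
  (isEvenDer_contractQ pd π H).comm_odd (isOddDer_deRham pd)

theorem lieQ_fn (f : A) : lieQ pd π H (fn f) = ∑ i, pd i f • Qx π i := by simp [lieQ]

theorem lieQ_mom (i : Fin n) : lieQ pd π H (mom i) = Qp pd π H i := by simp [lieQ]

theorem lieQ_theta (i : Fin n) : lieQ pd π H (theta i) = -deRham pd (Qx π i) := by simp [lieQ]

theorem lieQ_smul (a : A) (x : SFun n A) :
    lieQ pd π H (a • x) = ∑ i, pd i a • (Qx π i * x) + a • lieQ pd π H x := by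
  rw [← fn_mul, (isOddDer_lieQ pd π H).leibniz, lieQ_fn, parity_fn, fn_mul, Finset.sum_mul]
  simp only [smul_mul_assoc]

/-- A consequence of `d² = 0`. It transfers statements from `x` and `p` to `θ = dx` and `ψ = dp`. -/
theorem lieQ_deRham (hcomm : ∀ i j f, pd i (pd j f) = pd j (pd i f)) (x : SFun n A) :
    lieQ pd π H (deRham pd x) = -deRham pd (lieQ pd π H x) := by
  have h : ∀ y, deRham pd (deRham pd y) = (0 : SFun n A) := fun y =>
    LinearMap.congr_fun (deRham_sq pd hcomm) y
  simp [lieQ, h]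

theorem two_smul_Qp (i : Fin n) :
    Qp pd π H i + Qp pd π H i = -∑ j, ∑ k, structC pd π H i j k • (mom j * mom k) := by
  rw [Qp_eq, ← two_smul ℝ, smul_neg, smul_smul]
  norm_num

variable (hπ : ∀ i j, π j i = -π i j) (hH : ∀ i j k, H j i k = -H i j k ∧ H i k j = -H i j k)
  (hJ : ∀ i j k, ∑ l, (π i l * pd l (π j k) + π j l * pd l (π k i) + π k l * pd l (π i j))
      = ∑ a, ∑ b, ∑ d, H a b d * π i a * π j b * π k d)

include hπ hH hJ in
-- The result is quadratic in the momenta, so only the skew part of its coefficient matters; that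
-- part vanishes by the twisted Jacobi identity for the indices `k, j, i`.
theorem lieQ_Qx (i : Fin n) : lieQ pd π H (Qx π i) = 0 := by
  have e1 : lieQ pd π H (Qx π i)
      = ∑ k, ∑ j, (∑ l, π k l * pd l (π j i)) • (mom k * mom j) + ∑ l, π l i • Qp pd π H l := by
    conv_lhs => rw [Qx_eq]
    simp only [map_sum, lieQ_smul, lieQ_mom, Finset.sum_add_distrib, add_left_inj]
    rw [Finset.sum_comm]
    conv_rhs => rw [Finset.sum_comm]
    rw [Finset.sum_comm]
    refine Finset.sum_congr rfl fun j _ => ?_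
    simp only [Qx_eq, Finset.sum_mul, Finset.smul_sum, Finset.sum_smul, smul_mul_assoc, smul_smul]
    rw [Finset.sum_comm]
    simp only [mul_comm]
  have e2 : ∑ l, π l i • Qp pd π H l + ∑ l, π l i • Qp pd π H l
      = -∑ k, ∑ j, (∑ l, π l i * structC pd π H l k j) • (mom k * mom j) := by
    simp only [← Finset.sum_add_distrib, ← smul_add, two_smul_Qp, smul_neg, Finset.sum_neg_distrib,
      Finset.smul_sum, Finset.sum_smul, smul_smul]
    rw [Finset.sum_comm, neg_inj]
    exact Finset.sum_congr rfl fun k _ => Finset.sum_comm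
  have e3 := sum_smul_odd_swap (A := A) isOdd_mom fun k j => ∑ l, π k l * pd l (π j i)
  -- Doubling clears the `1/2` in `Q p_l` and leaves two copies of the first sum, one of which is
  -- antisymmetrised by swapping the momenta.
  refine eq_zero_of_add_self ?_
  rw [e1, add_add_add_comm, e2]
  nth_rewrite 2 [← neg_neg (∑ k, ∑ j, (∑ l, π k l * pd l (π j i)) • (mom k * mom j : SFun n A))]
  rw [← e3]
  simp only [← sub_eq_add_neg, ← Finset.sum_sub_distrib]
  refine Finset.sum_eq_zero fun k _ => Finset.sum_eq_zero fun j _ => ?_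
  rw [← sub_smul, ← sub_smul, sub_eq_zero.mpr, zero_smul]
  have h := hJ k j i
  have e4 : ∑ l, π l i * structC pd π H l k j
      = -∑ l, π i l * pd l (π k j) + ∑ a, ∑ b, ∑ d, H a b d * π k a * π j b * π i d := by
    simp only [structC, mul_sub, Finset.sum_sub_distrib]
    rw [sub_eq_add_neg]
    congr 1
    · rw [← Finset.sum_neg_distrib]
      exact Finset.sum_congr rfl fun l _ => by rw [hπ i l]; ring
    · simp only [Finset.mul_sum, ← Finset.sum_neg_distrib]
      rw [Finset.sum_comm]
      refine Finset.sum_congr rfl fun a _ => ?_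
      rw [Finset.sum_comm]
      refine Finset.sum_congr rfl fun b _ => Finset.sum_congr rfl fun l _ => ?_
      rw [hπ i l, (hH a l b).1, (hH a b l).2]; ring
  have e5 : ∀ l, pd l (π i k) = -pd l (π k i) := fun l => by rw [hπ k i, map_neg]
  rw [e4, ← h]
  simp only [e5, Finset.sum_add_distrib, mul_neg, Finset.sum_neg_distrib]
  ring

/-! ### The quadratic function of the bivector and the identity `L_Q(Q p_i) = 0` -/

/-- Twice the bivector field as a quadratic function of the momenta. -/
def bivectorFn : SFun n A := ∑ j, ∑ k, π j k • (mom j * mom k)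

theorem dBase_smul (X : Derivation ℝ A A) (a : A) (x : SFun n A) :
    dBase X (a • x) = X a • x + a • dBase X x := by
  rw [← fn_mul, (isEvenDer_dBase X).leibniz, dBase_fn, fn_mul, fn_mul]

@[simp] theorem dBase_mom (X : Derivation ℝ A A) (i) : dBase X (mom i : SFun n A) = 0 :=
  dBase_odd X _

theorem dBase_bivectorFn (X : Derivation ℝ A A) :
    dBase X (bivectorFn π) = ∑ j, ∑ k, X (π j k) • (mom j * mom k) := by
  simp [bivectorFn, dBase_smul, (isEvenDer_dBase X).leibniz]

/-- The two terms of the structure functions separate: the momenta contracted with `∂_i π` give a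
derivative of one quadratic function, and those contracted with `H π π` regroup into components of
`Q`. -/
theorem two_smul_Qp' (i : Fin n) : Qp pd π H i + Qp pd π H i
    = -dBase (pd i) (bivectorFn π) + ∑ a, ∑ b, H i a b • (Qx π a * Qx π b) := by
  have e : ∑ a, ∑ b, H i a b • (Qx π a * Qx π b)
      = ∑ j, ∑ k, (∑ a, ∑ b, H i a b * π j a * π k b) • (mom j * mom k) := by
    simp only [Qx_eq, Finset.sum_mul, Finset.mul_sum, Finset.smul_sum, Finset.sum_smul,
      smul_mul_assoc, mul_smul_comm, smul_smul]
    have : ∀ (F : Fin n → Fin n → Fin n → Fin n → SFun n A),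
        ∑ a, ∑ b, ∑ j, ∑ k, F a b j k = ∑ j, ∑ k, ∑ a, ∑ b, F a b j k := by
      intro F
      exact (Finset.sum_congr rfl fun a _ => sum_rotate₃ _).trans (sum_rotate₃ _)
    rw [this, Finset.sum_comm]
    refine Finset.sum_congr rfl fun j _ => Finset.sum_congr rfl fun k _ =>
      Finset.sum_congr rfl fun a _ => Finset.sum_congr rfl fun b _ => ?_
    congr 1; ring
  rw [two_smul_Qp, dBase_bivectorFn, e]
  simp only [structC, sub_smul, Finset.sum_sub_distrib]
  abel

include hJ in
-- The twisted Jacobi identity contracted with `p_i p_j p_k`. Its three cyclic terms become equal,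
-- whence the factor 3.
theorem sum_Qx_mul_dBase_bivectorFn :
    (3 : ℝ) • ∑ l, Qx π l * dBase (pd l) (bivectorFn π)
      = ∑ a, ∑ b, ∑ d, H a b d • (Qx π a * Qx π b * Qx π d) := by
  have e1 : ∑ l, Qx π l * dBase (pd l) (bivectorFn π)
      = ∑ i, ∑ j, ∑ k, (∑ l, π i l * pd l (π j k)) • (mom i * mom j * mom k : SFun n A) := by
    simp only [dBase_bivectorFn, Qx_eq, Finset.sum_mul, Finset.mul_sum, Finset.sum_smul,
      Finset.smul_sum, smul_mul_assoc, mul_smul_comm, smul_smul, mul_assoc]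
    refine (sum_rotate₄ _).trans ?_
    refine (sum_rotate₃ _).symm.trans ?_
    refine Finset.sum_congr rfl fun i _ => Finset.sum_congr rfl fun j _ =>
      Finset.sum_congr rfl fun k _ => Finset.sum_congr rfl fun l _ => ?_
    rw [mul_comm]
  have e2 := sum_smul_odd_cycle (A := A) isOdd_mom fun i j k => ∑ l, π i l * pd l (π j k)
  have e3 := sum_smul_odd_cycle (A := A) isOdd_mom fun i j k => ∑ l, π j l * pd l (π k i)
  have e4 : (3 : ℝ) • ∑ l, Qx π l * dBase (pd l) (bivectorFn π)
      = ∑ i, ∑ j, ∑ k, (∑ l, (π i l * pd l (π j k) + π j l * pd l (π k i) + π k l * pd l (π i j)))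
        • (mom i * mom j * mom k : SFun n A) := by
    simp only [Finset.sum_add_distrib, add_smul]
    rw [e3, e2, e1]
    module
  rw [e4]
  simp only [hJ, Qx_eq, Finset.sum_mul, Finset.mul_sum, Finset.smul_sum, Finset.sum_smul,
      smul_mul_assoc, mul_smul_comm, smul_smul]
  conv_rhs =>
    enter [2, a, 2, b, 2, c]
    rw [sum_reverse₃]
  refine (Finset.sum_congr rfl fun i _ => Finset.sum_congr rfl fun j _ => sum_rotate₄ _).trans ?_
  refine (Finset.sum_congr rfl fun i _ => sum_rotate₄ _).trans ?_
  refine (sum_rotate₄ _).trans ?_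
  refine Finset.sum_congr rfl fun a _ => Finset.sum_congr rfl fun b _ => Finset.sum_congr rfl fun c _ =>
    Finset.sum_congr rfl fun i _ => Finset.sum_congr rfl fun j _ => Finset.sum_congr rfl fun k _ => ?_
  congr 1; ring

include hπ in
-- `L_Q` acts on coefficients as `Q x^l ∂_l` and replaces each momentum by its `Q p_j`. The
-- contributions of the two momenta agree because `π` is skew, so `Q p_j` appears doubled.
theorem lieQ_dBase_bivectorFn (hcomm : ∀ i j f, pd i (pd j f) = pd j (pd i f)) (i : Fin n) :
    lieQ pd π H (dBase (pd i) (bivectorFn π))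
      = ∑ l, Qx π l * dBase (pd i) (dBase (pd l) (bivectorFn π))
        - ∑ j, (Qp pd π H j + Qp pd π H j) * dBase (pd i) (Qx π j) := by
  have hL := isOddDer_lieQ pd π H
  have e1 : ∀ j k, lieQ pd π H (pd i (π j k) • (mom j * mom k))
      = ∑ l, Qx π l * (pd i (pd l (π j k)) • (mom j * mom k))
        + (pd i (π j k) • (Qp pd π H j * mom k) - pd i (π j k) • (Qp pd π H k * mom j)) := by
    intro j k
    rw [lieQ_smul, hL.leibniz, lieQ_mom, lieQ_mom, parity_mom, neg_mul, ← (isEven_Qp pd π H k).2,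
      smul_add, smul_neg, ← sub_eq_add_neg]
    simp only [mul_smul_comm, hcomm i]
  have e2 : ∀ l, dBase (pd i) (dBase (pd l) (bivectorFn π))
      = ∑ j, ∑ k, pd i (pd l (π j k)) • (mom j * mom k : SFun n A) := by
    intro l
    simp [dBase_bivectorFn, dBase_smul, (isEvenDer_dBase (pd i)).leibniz]
  have e3 : ∑ j, ∑ k, pd i (π j k) • (Qp pd π H j * mom k)
      = -∑ j, Qp pd π H j * dBase (pd i) (Qx π j) := by
    simp only [Qx_eq, map_sum, dBase_smul, dBase_mom, smul_zero, add_zero, Finset.mul_sum,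
      mul_smul_comm, ← Finset.sum_neg_distrib]
    refine Finset.sum_congr rfl fun j _ => Finset.sum_congr rfl fun k _ => ?_
    rw [hπ k j, map_neg, neg_smul]
  have e4 : ∑ j, ∑ k, pd i (π j k) • (Qp pd π H k * mom j)
      = ∑ j, Qp pd π H j * dBase (pd i) (Qx π j) := by
    simp only [Qx_eq, map_sum, dBase_smul, dBase_mom, smul_zero, add_zero, Finset.mul_sum,
      mul_smul_comm]
    exact Finset.sum_comm
  have e5 : ∑ j, ∑ k, ∑ l, Qx π l * (pd i (pd l (π j k)) • (mom j * mom k))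
      = ∑ l, Qx π l * dBase (pd i) (dBase (pd l) (bivectorFn π)) := by
    simp only [e2, Finset.mul_sum]
    exact (sum_rotate₃ _).symm
  rw [dBase_bivectorFn]
  simp only [map_sum, e1, Finset.sum_add_distrib, Finset.sum_sub_distrib, e3, e4, e5, add_mul]
  abel

/-- Skew-symmetry of `H` against the anticommuting factors makes the three Leibniz terms equal. -/
theorem dBase_sum_cubic (hH : ∀ i j k, H j i k = -H i j k ∧ H i k j = -H i j k)
    {P : Fin n → SFun n A} (hP : ∀ i, IsOdd (P i)) (X : Derivation ℝ A A)
    (hP' : ∀ i, IsOdd (dBase X (P i))) :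
    dBase X (∑ a, ∑ b, ∑ d, H a b d • (P a * P b * P d))
      = ∑ a, ∑ b, ∑ d, X (H a b d) • (P a * P b * P d)
        + (3 : ℝ) • ∑ a, ∑ b, ∑ d, H a b d • (P b * P d * dBase X (P a)) := by
  have hX := isEvenDer_dBase (n := n) X
  have e1 : ∑ a, ∑ b, ∑ d, H a b d • (dBase X (P a) * P b * P d)
      = ∑ a, ∑ b, ∑ d, H a b d • (P b * P d * dBase X (P a)) :=
    Finset.sum_congr rfl fun a _ => Finset.sum_congr rfl fun b _ => Finset.sum_congr rfl fun d _ => by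
      rw [mul_assoc, ((hP b).mul (hP d)).2]
  have e2 : ∑ a, ∑ b, ∑ d, H a b d • (P a * dBase X (P b) * P d)
      = ∑ a, ∑ b, ∑ d, H a b d • (P b * P d * dBase X (P a)) := by
    rw [Finset.sum_comm]
    refine Finset.sum_congr rfl fun a _ => Finset.sum_congr rfl fun b _ =>
      Finset.sum_congr rfl fun d _ => ?_
    rw [(hH a b d).1, mul_assoc, (hP' a).anticomm (hP d), mul_neg, smul_neg, neg_smul, neg_neg, mul_assoc]
  have e3 : ∑ a, ∑ b, ∑ d, H a b d • (P a * P b * dBase X (P d))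
      = ∑ a, ∑ b, ∑ d, H a b d • (P b * P d * dBase X (P a)) := by
    rw [← sum_rotate₃]
    refine Finset.sum_congr rfl fun a _ => Finset.sum_congr rfl fun b _ =>
      Finset.sum_congr rfl fun d _ => ?_
    rw [(hH b a d).2, (hH a b d).1, neg_neg]
  simp only [map_sum, dBase_smul, hX.leibniz, add_mul, smul_add, Finset.sum_add_distrib, e1, e2, e3]
  module

/-- Closedness expresses `∂_i H_{abd}` as a cyclic sum of derivatives of `H_{i··}`, and the three
summands agree after contraction with odd elements. -/
theorem sum_closed_cubic (hH : ∀ i j k, H j i k = -H i j k ∧ H i k j = -H i j k)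
    (hcl : ∀ i j k l, pd i (H j k l) - pd j (H i k l) + pd k (H i j l) - pd l (H i j k) = 0)
    {P : Fin n → SFun n A} (hP : ∀ i, IsOdd (P i)) (i : Fin n) :
    ∑ a, ∑ b, ∑ d, pd i (H a b d) • (P a * P b * P d)
      = (3 : ℝ) • ∑ a, ∑ b, ∑ d, pd a (H i b d) • (P a * P b * P d) := by
  have e1 := sum_smul_odd_cycle hP fun a b d => pd a (H i b d)
  have e2 := sum_smul_odd_cycle hP fun a b d => pd b (H i d a)
  have e : ∀ a b d, pd i (H a b d) = pd a (H i b d) + pd b (H i d a) + pd d (H i a b) := by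
    intro a b d
    rw [(hH i a d).2, map_neg]
    linear_combination hcl i a b d
  have e3 : (3 : ℝ) • ∑ a, ∑ b, ∑ d, pd a (H i b d) • (P a * P b * P d)
      = ∑ a, ∑ b, ∑ d, pd a (H i b d) • (P a * P b * P d)
        + ∑ a, ∑ b, ∑ d, pd b (H i d a) • (P a * P b * P d)
        + ∑ a, ∑ b, ∑ d, pd d (H i a b) • (P a * P b * P d) := by
    rw [e2, e1]; module
  rw [e3]
  simp only [e, add_smul, Finset.sum_add_distrib]

include hπ hH hJ in
theorem lieQ_Qp (hcomm : ∀ i j f, pd i (pd j f) = pd j (pd i f))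
    (hcl : ∀ i j k l, pd i (H j k l) - pd j (H i k l) + pd k (H i j l) - pd l (H i j k) = 0)
    (i : Fin n) : lieQ pd π H (Qp pd π H i) = 0 := by
  have hL := isOddDer_lieQ pd π H
  have hX := isEvenDer_dBase (n := n) (pd i)
  have hP' : ∀ j, IsOdd (dBase (pd i) (Qx π j)) := fun j => by
    simp only [Qx_eq, map_sum, dBase_smul, dBase_mom, smul_zero, add_zero]
    exact .sum _ fun k => (isOdd_mom k).smul _
  have e1 : lieQ pd π H (∑ a, ∑ b, H i a b • (Qx π a * Qx π b))
      = ∑ a, ∑ b, ∑ d, pd a (H i b d) • (Qx π a * Qx π b * Qx π d) := by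
    simp only [map_sum, lieQ_smul, hL.leibniz, lieQ_Qx pd π H hπ hH hJ, zero_mul, mul_zero, add_zero,
      smul_zero, mul_assoc]
    exact (sum_rotate₃ _).symm
  have e2 : ∑ j, (Qp pd π H j + Qp pd π H j) * dBase (pd i) (Qx π j)
      = -∑ j, dBase (pd i) (Qx π j) * dBase (pd j) (bivectorFn π)
        + ∑ a, ∑ b, ∑ d, H a b d • (Qx π b * Qx π d * dBase (pd i) (Qx π a)) := by
    simp only [two_smul_Qp', add_mul, neg_mul, Finset.sum_add_distrib, Finset.sum_neg_distrib,
      Finset.sum_mul, smul_mul_assoc]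
    congr 2
    refine Finset.sum_congr rfl fun j _ => ?_
    have hE : IsEven (dBase (pd j) (bivectorFn π)) := by
      rw [dBase_bivectorFn]
      exact .sum _ fun j => .sum _ fun k => ((isOdd_mom j).mul (isOdd_mom k)).smul _
    exact hE.2 _
  -- The contracted Jacobi identity is differentiated along `x^i`; closedness then gives every term
  -- a factor 3, which is cancelled. What remains is, up to sign, the expansion of `2 L_Q(Q p_i)`.
  have e3 := congrArg (dBase (pd i)) (sum_Qx_mul_dBase_bivectorFn pd π H hJ)
  rw [dBase_sum_cubic H hH (isOdd_Qx π) _ hP', sum_closed_cubic pd H hH hcl (isOdd_Qx π)] at e3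
  simp only [map_smul, map_sum, hX.leibniz, Finset.sum_add_distrib, ← smul_add] at e3
  have e4 := (smul_right_injective (SFun n A) (three_ne_zero (α := ℝ))) e3
  refine eq_zero_of_add_self ?_
  rw [← map_add, two_smul_Qp', map_add, map_neg, lieQ_dBase_bivectorFn pd π H hπ hcomm, e1, e2]
  rw [← sub_eq_zero] at e4
  rw [← neg_eq_zero, ← e4]
  abel

include hπ hH hJ in
-- With `Q̃ = d + L_Q`, the mixed terms cancel by `lieQ_deRham`. For `L_Q²`, the function case is
-- symmetry of second derivatives against the anticommuting `Q x^i`; the other generators reduce to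
-- `lieQ_Qx` and `lieQ_Qp`.
theorem Qtilde_sq (hcomm : ∀ i j f, pd i (pd j f) = pd j (pd i f))
    (hcl : ∀ i j k l, pd i (H j k l) - pd j (H i k l) + pd k (H i j l) - pd l (H i j k) = 0) :
    Qtilde pd π H ∘ₗ Qtilde pd π H = 0 := by
  have hd := deRham_sq (A := A) pd hcomm
  have hL : lieQ pd π H ∘ₗ lieQ pd π H = 0 := by
    refine IsEvenDer.ext (isOddDer_lieQ pd π H).sq .zero (fun f => ?_) (fun i => ?_) (fun i => ?_)
      fun i => ?_
    · simp only [LinearMap.comp_apply, lieQ_fn, map_sum, lieQ_smul, lieQ_Qx pd π H hπ hH hJ, smul_zero,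
        add_zero, LinearMap.zero_apply]
      rw [Finset.sum_comm]
      exact sum_smul_odd_of_symm (isOdd_Qx π) fun j k => hcomm j k f
    · simp [lieQ_theta, lieQ_deRham pd π H hcomm, lieQ_Qx pd π H hπ hH hJ]
    · simp [lieQ_mom, lieQ_Qp pd π H hπ hH hJ hcomm hcl]
    · rw [LinearMap.comp_apply, ← deRham_mom pd]
      simp [-deRham_mom, lieQ_deRham pd π H hcomm, lieQ_mom, lieQ_Qp pd π H hπ hH hJ hcomm hcl]
  ext x
  have h1 := lieQ_deRham pd π H hcomm x
  have h2 : deRham pd (deRham pd x) = 0 := LinearMap.congr_fun hd x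
  have h3 : lieQ pd π H (lieQ pd π H x) = 0 := LinearMap.congr_fun hL x
  have h4 : ∀ y, Qtilde pd π H y = deRham pd y + lieQ pd π H y := fun y => rfl
  simp [h4, h1, h2, h3]

/-! ## Lie algebra identities for the derived bracket -/

/-- One such field sends `p` to base functions and `ψ` to combinations of `θ`, and every such field
kills both; so any two of them compose to zero on generators. -/
theorem epsField_anticomm (ε ε' : Fin n → A) (α α' : Fin n → Fin n → A) :
    epsField ε α ∘ₗ epsField ε' α' + epsField ε' α' ∘ₗ epsField ε α = 0 := by
  refine IsEvenDer.ext ((isOddDer_epsField ε α).comm_odd (isOddDer_epsField ε' α')) .zero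
    (fun f => ?_) (fun i => ?_) (fun i => ?_) fun i => ?_ <;> simp [← fn_eq_smul]

/-- The symmetrised bracket is the commutator of `[D, D']` with `Q`, hence zero when `D` and `D'`
anticommute. -/
theorem derivedBracket_skew {Q D D' : SFun n A →ₗ[ℝ] SFun n A} (h : D ∘ₗ D' + D' ∘ₗ D = 0) :
    derivedBracket Q D D' = -derivedBracket Q D' D := by
  have e : derivedBracket Q D D' + derivedBracket Q D' D
      = (D ∘ₗ D' + D' ∘ₗ D) ∘ₗ Q - Q ∘ₗ (D ∘ₗ D' + D' ∘ₗ D) := by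
    simp only [derivedBracket, LinearMap.comp_add, LinearMap.add_comp, LinearMap.comp_assoc]
    abel
  rw [h, LinearMap.zero_comp, LinearMap.comp_zero, sub_zero] at e
  exact eq_neg_of_add_eq_zero_left e

theorem derivedBracket_leibniz {Q x y z : SFun n A →ₗ[ℝ] SFun n A} (hQ : Q ∘ₗ Q = 0)
    (h : derivedBracket Q x z ∘ₗ y + y ∘ₗ derivedBracket Q x z = 0) :
    derivedBracket Q x (derivedBracket Q y z)
      = derivedBracket Q (derivedBracket Q x y) z + derivedBracket Q y (derivedBracket Q x z) := by
  -- Skew-symmetry rewrites the last bracket so that the identity becomes purely associative, using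
  -- nothing beyond `Q² = 0`.
  have hs := derivedBracket_skew (Q := Q) ((add_comm _ _).trans h)
  rw [hs]
  have hQ' : ∀ w : SFun n A →ₗ[ℝ] SFun n A, Q ∘ₗ Q ∘ₗ w = 0 := fun w => by
    rw [← LinearMap.comp_assoc, hQ, LinearMap.zero_comp]
  simp only [derivedBracket, LinearMap.comp_add, LinearMap.add_comp, LinearMap.comp_sub,
    LinearMap.sub_comp, LinearMap.comp_assoc, hQ, hQ', LinearMap.comp_zero]
  abel

/-- The augmentation sending all generators to zero shows that the fibre algebra is nontrivial, so
the real scalars inject into it; tensoring with `A` over the field `ℝ` preserves injectivity. -/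
theorem fn_injective : Function.Injective (fn : A → SFun n A) := by
  have : Nontrivial (Fibre n) :=
    (Algebra.TensorProduct.lift (MvPolynomial.aeval fun _ => (0 : ℝ)) ExteriorAlgebra.algebraMapInv
      (fun _ _ => Commute.all _ _) : Poly n ⊗[ℝ] Ext n →ₐ[ℝ] ℝ).toRingHom.domain_nontrivial
  exact Algebra.TensorProduct.includeLeft_injective (S := ℝ) (algebraMap ℝ (Fibre n)).injective

theorem smul_one_injective {a b : A} (h : a • (1 : SFun n A) = b • 1) : a = b := by
  rw [← fn_eq_smul, ← fn_eq_smul] at h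
  exact fn_injective h

theorem sum_smul_theta_injective {v w : Fin n → A}
    (h : ∑ j, v j • (theta j : SFun n A) = ∑ j, w j • theta j) (j : Fin n) : v j = w j := by
  have e : ∀ k, ∀ a : A, dTheta j (a • theta k : SFun n A) = if j = k then fn a else 0 := by
    intro k a
    rw [← fn_mul, dTheta, (isOddDer_dOdd _).leibniz, theta, dOdd_fn, dOdd_odd]
    simp
  have := congrArg (dTheta j) h
  simp only [map_sum, e, Finset.sum_ite_eq, Finset.mem_univ, if_true] at this
  exact fn_injective this

theorem epsField_injective {ε ε' : Fin n → A} {α α' : Fin n → Fin n → A}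
    (h : epsField ε α = epsField ε' α') : ε = ε' ∧ α = α' := by
  refine ⟨funext fun i => ?_, funext fun i => funext (sum_smul_theta_injective ?_)⟩
  · have := LinearMap.congr_fun h (mom i)
    rw [epsField_mom, epsField_mom] at this
    exact smul_one_injective this
  · simpa only [epsField_psi] using LinearMap.congr_fun h (psi i)

end Square

/-! ## Naturality under changes of coordinates -/

section Naturality

variable {n : ℕ} {A B : Type*} [CommRing A] [Algebra ℝ A] [CommRing B] [Algebra ℝ B]
variable (res : A →ₐ[ℝ] B) (J : Matrix (Fin n) (Fin n) B)
variable (pdA : Fin n → Derivation ℝ A A) (pd : Fin n → Derivation ℝ B B)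

theorem pullback_smul (a : A) (x : SFun n A) :
    pullback res J pd (a • x) = res a • pullback res J pd x := by
  rw [← fn_mul, map_mul, pullback_fn, fn_mul]

theorem pullback_theta (i : Fin n) :
    pullback res J pd (theta i) = ∑ a, J i a • theta a := by
  rw [theta, pullback_odd, oddImage]
  simp [fn_mul, theta, Fintype.sum_sum_type]

theorem pullback_mom (i : Fin n) :
    pullback res J pd (mom i) = ∑ a, J⁻¹ a i • mom a := by
  rw [mom, pullback_odd, oddImage]
  simp [fn_mul, mom, Fintype.sum_sum_type]

theorem pullback_psi' (i : Fin n) : pullback res J pd (psi i)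
    = ∑ a, (J⁻¹ a i • psi a + ∑ b, pd b (J⁻¹ a i) • (theta b * mom a)) := by
  rw [pullback_psi, psiImage]
  simp only [fn_mul]

theorem pullback_parity (x : SFun n A) :
    pullback res J pd (parity x) = parity (pullback res J pd x) := by
  induction x using SFun.gen_induct with
  | hfn a => simp [pullback_fn]
  | hodd s =>
    rw [parity_odd, map_neg, pullback_odd, oddImage]
    simp [fn_mul, add_comm]
  | hpsi i =>
    rw [parity_psi, pullback_psi']
    simp [parity_mul]
  | hmul x y hx hy => simp only [parity_mul, map_mul, hx, hy]
  | hadd x y hx hy => simp only [map_add, hx, hy]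

variable {res J pd} in
theorem IsOddDer.natural {D : SFun n A →ₗ[ℝ] SFun n A} {D' : SFun n B →ₗ[ℝ] SFun n B}
    (h : IsOddDer D) (h' : IsOddDer D')
    (hfn : ∀ a, D' (fn (res a)) = pullback res J pd (D (fn a)))
    (htheta : ∀ i, D' (pullback res J pd (theta i)) = pullback res J pd (D (theta i)))
    (hmom : ∀ i, D' (pullback res J pd (mom i)) = pullback res J pd (D (mom i)))
    (hpsi : ∀ i, D' (pullback res J pd (psi i)) = pullback res J pd (D (psi i))) (x : SFun n A) :
    D' (pullback res J pd x) = pullback res J pd (D x) := by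
  induction x using SFun.gen_induct with
  | hfn a => rw [pullback_fn, hfn]
  | hodd s => exact Sum.rec htheta hmom s
  | hpsi i => exact hpsi i
  | hmul x y hx hy => rw [map_mul, h'.leibniz, h.leibniz, hx, hy, map_add, map_mul, map_mul,
      pullback_parity]
  | hadd x y hx hy => simp only [map_add, hx, hy]

variable {res J pd} in
theorem IsEvenDer.natural {D : SFun n A →ₗ[ℝ] SFun n A} {D' : SFun n B →ₗ[ℝ] SFun n B}
    (h : IsEvenDer D) (h' : IsEvenDer D')
    (hfn : ∀ a, D' (fn (res a)) = pullback res J pd (D (fn a)))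
    (htheta : ∀ i, D' (pullback res J pd (theta i)) = pullback res J pd (D (theta i)))
    (hmom : ∀ i, D' (pullback res J pd (mom i)) = pullback res J pd (D (mom i)))
    (hpsi : ∀ i, D' (pullback res J pd (psi i)) = pullback res J pd (D (psi i))) (x : SFun n A) :
    D' (pullback res J pd x) = pullback res J pd (D x) := by
  induction x using SFun.gen_induct with
  | hfn a => rw [pullback_fn, hfn]
  | hodd s => exact Sum.rec htheta hmom s
  | hpsi i => exact hpsi i
  | hmul x y hx hy => rw [map_mul, h'.leibniz, h.leibniz, hx, hy, map_add, map_mul, map_mul]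
  | hadd x y hx hy => simp only [map_add, hx, hy]

/-- The compatibility of `res` and `J` with coordinate derivations satisfied by a change of
coordinates. -/
structure IsCoordChange : Prop where
  chain : ∀ a f, pd a (res f) = ∑ i, J i a * res (pdA i f)
  symm : ∀ i a b, pd b (J i a) = pd a (J i b)
  isUnit : IsUnit J.det
  comm : ∀ i j f, pd i (pd j f) = pd j (pd i f)

variable {res J pdA pd} (h : IsCoordChange res J pdA pd)
include h

theorem IsCoordChange.sum_inv_mul (a b : Fin n) : ∑ i, J⁻¹ a i * J i b = if a = b then 1 else 0 := by
  have := congrFun (congrFun (Matrix.nonsing_inv_mul J h.isUnit) a) b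
  rwa [Matrix.mul_apply, Matrix.one_apply] at this

theorem IsCoordChange.sum_mul_inv (i j : Fin n) : ∑ a, J i a * J⁻¹ a j = if i = j then 1 else 0 := by
  have := congrFun (congrFun (Matrix.mul_nonsing_inv J h.isUnit) i) j
  rwa [Matrix.mul_apply, Matrix.one_apply] at this

/-- Lets a covariant transformation law be tested with the Jacobian moved to the other side, the
form in which pulled-back generators present it. -/
theorem IsCoordChange.eq_sum_iff (v w : Fin n → B) :
    (∀ a, v a = ∑ i, J i a * w i) ↔ ∀ i, ∑ a, J⁻¹ a i * v a = w i := by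
  constructor
  · intro H i
    simp only [H, Finset.mul_sum]
    rw [Finset.sum_comm]
    have : ∀ j, ∑ a, J⁻¹ a i * (J j a * w j) = (∑ a, J j a * J⁻¹ a i) * w j := fun j => by
      rw [Finset.sum_mul]; exact Finset.sum_congr rfl fun a _ => by ring
    simp [this, h.sum_mul_inv]
  · intro H a
    simp only [← H, Finset.mul_sum]
    rw [Finset.sum_comm]
    have : ∀ b, ∑ i, J i a * (J⁻¹ b i * v b) = (∑ i, J⁻¹ b i * J i a) * v b := fun j => by
      rw [Finset.sum_mul]; exact Finset.sum_congr rfl fun a _ => by ring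
    simp [this, h.sum_inv_mul]

theorem IsCoordChange.res_pd (i : Fin n) (f : A) :
    res (pdA i f) = ∑ e, J⁻¹ e i * pd e (res f) :=
  ((h.eq_sum_iff (fun e => pd e (res f)) fun i => res (pdA i f)).mp (fun a => h.chain a f) i).symm

/-- This expresses the symmetry of the second derivatives of `y^a` with respect to the `x`
coordinates. It comes from differentiating `J⁻¹ J = 1` and `J J⁻¹ = 1` and using the symmetry of the
derivatives of `J`. -/
theorem IsCoordChange.sum_inv_mul_pd_inv (i a d : Fin n) :
    ∑ e, J⁻¹ e i * ∑ k, J k d * pd e (J⁻¹ a k) = pd d (J⁻¹ a i) := by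
  have e1 : ∀ e, ∑ k, J k d * pd e (J⁻¹ a k) = -∑ k, J⁻¹ a k * pd d (J k e) := by
    intro e
    have := congrArg (pd e) (h.sum_inv_mul a d)
    rw [show pd e (if a = d then 1 else 0) = 0 by split_ifs <;> simp] at this
    simp only [map_sum, Derivation.leibniz, smul_eq_mul, Finset.sum_add_distrib, h.symm _ d e] at this
    rw [← add_eq_zero_iff_eq_neg, add_comm]
    exact this
  have e2 : ∀ k, ∑ e, J⁻¹ e i * pd d (J k e) = -∑ e, J k e * pd d (J⁻¹ e i) := by
    intro k
    have := congrArg (pd d) (h.sum_mul_inv k i)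
    rw [show pd d (if k = i then 1 else 0) = 0 by split_ifs <;> simp] at this
    simp only [map_sum, Derivation.leibniz, smul_eq_mul, Finset.sum_add_distrib] at this
    rw [← add_eq_zero_iff_eq_neg, add_comm]
    exact this
  have e3 : ∑ e, J⁻¹ e i * ∑ k, J⁻¹ a k * pd d (J k e)
      = ∑ k, J⁻¹ a k * ∑ e, J⁻¹ e i * pd d (J k e) := by
    simp only [Finset.mul_sum]
    rw [Finset.sum_comm]
    exact Finset.sum_congr rfl fun k _ => Finset.sum_congr rfl fun e _ => by ring
  have e4 : ∑ k, J⁻¹ a k * ∑ e, J k e * pd d (J⁻¹ e i)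
      = ∑ e, (∑ k, J⁻¹ a k * J k e) * pd d (J⁻¹ e i) := by
    simp only [Finset.mul_sum, Finset.sum_mul]
    rw [Finset.sum_comm]
    exact Finset.sum_congr rfl fun k _ => Finset.sum_congr rfl fun e _ => by ring
  simp only [e1, mul_neg, Finset.sum_neg_distrib, e3, e2, e4, neg_neg, h.sum_inv_mul]
  simp

/-- The image of `ψ_i` is `d` of the image of `p_i`, which settles `p`, and `ψ` by `d² = 0`. The `θ`
case is the symmetry of the derivatives of the Jacobian. -/
theorem IsCoordChange.deRham_pullback (x : SFun n A) :
    deRham pd (pullback res J pd x) = pullback res J pd (deRham pdA x) := by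
  have hmom : ∀ i, deRham pd (pullback res J pd (mom i)) = pullback res J pd (psi i) := by
    intro i
    rw [pullback_mom, pullback_psi']
    simp only [map_sum, deRham_smul, deRham_mom]
    exact Finset.sum_congr rfl fun a _ => add_comm _ _
  refine (isOddDer_deRham pdA).natural (isOddDer_deRham pd) (fun f => ?_) (fun i => ?_) (fun i => ?_)
    (fun i => ?_) x
  · simp only [deRham_fn, map_sum, pullback_smul, pullback_theta, h.chain, Finset.smul_sum,
      Finset.sum_smul, smul_smul]
    rw [Finset.sum_comm]
    simp only [mul_comm]
  · rw [pullback_theta, deRham_theta, map_zero]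
    simp only [map_sum, deRham_smul, deRham_theta, smul_zero, add_zero]
    rw [Finset.sum_comm]
    exact sum_smul_odd_of_symm isOdd_theta fun b a => h.symm i a b
  · rw [hmom, deRham_mom]
  · rw [deRham_psi, map_zero, ← hmom]
    exact LinearMap.congr_fun (deRham_sq pd h.comm) _

/-! ### Invariance of `Q` and `Q̃` under coordinate changes -/

variable {π : Fin n → Fin n → A} {π' : Fin n → Fin n → B}
  (hπ : ∀ i j, π j i = -π i j)
  (hπ' : ∀ i j, res (π i j) = ∑ a, ∑ b, J i a * J j b * π' a b)

include hπ' in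
theorem IsCoordChange.pullback_Qx (i : Fin n) :
    pullback res J pd (Qx π i) = ∑ a, J i a • Qx π' a := by
  have e : ∀ a b, ∑ j, J j a * J⁻¹ b j = if b = a then 1 else 0 := fun a b => by
    rw [← h.sum_inv_mul]; exact Finset.sum_congr rfl fun j _ => mul_comm _ _
  have e1 : ∀ b, ∑ j, res (π j i) * J⁻¹ b j = ∑ d, J i d * π' b d := by
    intro b
    have : ∀ j, res (π j i) * J⁻¹ b j = ∑ a, ∑ d, (J j a * J⁻¹ b j) * (J i d * π' a d) := by
      intro j
      simp only [hπ', Finset.sum_mul]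
      exact Finset.sum_congr rfl fun k _ => Finset.sum_congr rfl fun e _ => by ring
    simp only [this]
    rw [sum_rotate₃]
    simp only [← Finset.sum_mul, e]
    rw [Finset.sum_comm]
    simp
  simp only [Qx_eq, map_sum, pullback_smul, pullback_mom, Finset.smul_sum, smul_smul]
  rw [Finset.sum_comm]
  conv_rhs => rw [Finset.sum_comm]
  simp only [← Finset.sum_smul, e1]

include hπ hπ' in
-- The function `π^{jk} p_j p_k` is invariant, but `∂/∂x^i` is taken at fixed old momenta and
-- `∂/∂y^e` at fixed new ones. The correction term is the derivative of the old momenta `J⁻¹ p'`.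
theorem IsCoordChange.pullback_dBase_bivectorFn (i : Fin n) :
    pullback res J pd (dBase (pdA i) (bivectorFn π))
      = ∑ e, J⁻¹ e i • dBase (pd e) (bivectorFn π')
        - (2 : ℝ) • ∑ a, ∑ b, pd b (J⁻¹ a i) • (Qx π' b * mom a) := by
  set p : Fin n → SFun n B := fun j => pullback res J pd (mom j) with hp
  have hpe : ∀ j, p j = ∑ a, J⁻¹ a j • mom a := fun j => pullback_mom res J pd j
  have hodd' : ∀ e j, IsOdd (dBase (pd e) (p j)) := fun e j => by
    rw [hpe]
    simp only [map_sum, dBase_smul, dBase_mom, smul_zero, add_zero]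
    exact .sum _ fun k => (isOdd_mom k).smul _
  have hJp : ∀ a, ∑ k, J k a • p k = mom a := by
    intro a
    simp only [hpe, Finset.smul_sum, smul_smul]
    rw [Finset.sum_comm]
    have e : ∀ b, ∑ k, J k a * J⁻¹ b k = if b = a then 1 else 0 := fun b => by
      rw [← h.sum_inv_mul]; exact Finset.sum_congr rfl fun j _ => mul_comm _ _
    simp only [← Finset.sum_smul, e, ite_smul, one_smul, zero_smul]
    simp
  have e0 : bivectorFn π' = ∑ j, ∑ k, res (π j k) • (p j * p k) := by
    have e : ∀ k, ∑ j, res (π j k) • p j = ∑ a, J k a • Qx π' a := by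
      intro k
      rw [← h.pullback_Qx hπ', Qx_eq, map_sum]
      simp only [pullback_smul, p]
    rw [Finset.sum_comm]
    simp only [← smul_mul_assoc, ← Finset.sum_mul, e]
    simp only [Finset.sum_mul, smul_mul_assoc]
    rw [Finset.sum_comm]
    simp only [← mul_smul_comm, ← Finset.mul_sum, hJp]
    simp only [Qx_eq, Finset.sum_mul, smul_mul_assoc, bivectorFn]
    exact Finset.sum_comm
  have hQ1 : ∀ j, ∑ k, res (π j k) • p k = -∑ d, J j d • Qx π' d := by
    intro j
    rw [← h.pullback_Qx hπ', Qx_eq, map_sum, ← Finset.sum_neg_distrib]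
    exact Finset.sum_congr rfl fun k _ => by rw [pullback_smul, hπ j k, map_neg, neg_smul, neg_neg]
  have e1 : ∀ e, dBase (pd e) (bivectorFn π')
      = ∑ j, ∑ k, pd e (res (π j k)) • (p j * p k)
        + (2 : ℝ) • ∑ j, (∑ d, J j d • Qx π' d) * dBase (pd e) (p j) := by
    intro e
    have e2 : ∑ j, ∑ k, res (π j k) • (dBase (pd e) (p j) * p k)
        = ∑ j, (∑ d, J j d • Qx π' d) * dBase (pd e) (p j) := by
      simp only [← mul_smul_comm, ← Finset.mul_sum, hQ1]
      refine Finset.sum_congr rfl fun j _ => ?_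
      rw [(hodd' e j).anticomm, neg_mul, neg_neg]
      rw [← neg_one_smul B, Finset.smul_sum]
      exact .sum _ fun d => ((isOdd_Qx π' d).smul _).smul _
    have e3 : ∑ j, ∑ k, res (π j k) • (p j * dBase (pd e) (p k))
        = ∑ j, (∑ d, J j d • Qx π' d) * dBase (pd e) (p j) := by
      rw [Finset.sum_comm]
      simp only [← smul_mul_assoc, ← Finset.sum_mul]
      refine Finset.sum_congr rfl fun j _ => ?_
      rw [← h.pullback_Qx hπ', Qx_eq, map_sum]
      simp only [pullback_smul, p]
    rw [e0]
    simp only [map_sum, dBase_smul, (isEvenDer_dBase (pd e)).leibniz, smul_add,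
      Finset.sum_add_distrib, e2, e3]
    module
  -- `sum_inv_mul_pd_inv` eliminates the two Jacobian factors and exchanges the derivative index
  -- with `i`.
  have e4 : ∑ e, J⁻¹ e i • ∑ j, (∑ d, J j d • Qx π' d) * dBase (pd e) (p j)
      = ∑ a, ∑ b, pd b (J⁻¹ a i) • (Qx π' b * mom a) := by
    simp only [← h.sum_inv_mul_pd_inv i, hpe, map_sum, dBase_smul, dBase_mom, smul_zero, add_zero,
      Finset.sum_mul, Finset.mul_sum, Finset.smul_sum, Finset.sum_smul, smul_mul_assoc,
      mul_smul_comm, smul_smul]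
    refine (sum_rotate₄ _).trans ((sum_rotate₄ _).trans ?_)
    refine Finset.sum_congr rfl fun _ _ => Finset.sum_congr rfl fun _ _ => Finset.sum_congr rfl fun _ _ =>
      Finset.sum_congr rfl fun _ _ => ?_
    congr 1; ring
  have e5 : ∑ j, ∑ k, res (pdA i (π j k)) • (p j * p k)
      = ∑ e, J⁻¹ e i • ∑ j, ∑ k, pd e (res (π j k)) • (p j * p k) := by
    simp only [h.res_pd, Finset.sum_smul, Finset.smul_sum, smul_smul]
    exact (sum_rotate₃ _).symm
  rw [← e4]
  simp only [e1, dBase_bivectorFn π (pdA i), map_sum, pullback_smul, map_mul]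
  simp only [smul_add, Finset.sum_add_distrib, smul_base_comm, ← Finset.smul_sum (r := (2 : ℝ)),
    add_sub_cancel_right]
  exact e5

variable {H : Fin n → Fin n → Fin n → A} {H' : Fin n → Fin n → Fin n → B}
  (hH' : ∀ a b d, H' a b d = ∑ i, ∑ j, ∑ k, J i a * J j b * J k d * res (H i j k))

include hπ hπ' hH' in
-- Only `ψ` is delicate. The contraction of the extra term `∂_b(J⁻¹)^a_i θ^b p_a` matches the
-- correction in `pullback_dBase_bivectorFn`, while the `H`-part is tensorial.
theorem IsCoordChange.contractQ_pullback (x : SFun n A) :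
    contractQ pd π' H' (pullback res J pd x) = pullback res J pd (contractQ pdA π H x) := by
  refine (isEvenDer_contractQ pdA π H).natural (isEvenDer_contractQ pd π' H') (fun f => ?_)
    (fun i => ?_) (fun i => ?_) (fun i => ?_) x
  · simp
  · simp [pullback_theta, h.pullback_Qx hπ']
  · simp [pullback_mom]
  · have hH2 : ∀ i c d, ∑ e, J⁻¹ e i * H' e c d = ∑ a, ∑ b, J a c * J b d * res (H i a b) := by
      intro i c d
      refine (h.eq_sum_iff (fun e => H' e c d)
        fun i => ∑ a, ∑ b, J a c * J b d * res (H i a b)).mp (fun e => ?_) i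
      simp only [hH', Finset.mul_sum, mul_assoc]
    have e1 : pullback res J pd (∑ a, ∑ b, H i a b • (Qx π a * Qx π b))
        = ∑ e, J⁻¹ e i • ∑ c, ∑ d, H' e c d • (Qx π' c * Qx π' d) := by
      have e2 : ∑ e, J⁻¹ e i • ∑ c, ∑ d, H' e c d • (Qx π' c * Qx π' d)
          = ∑ c, ∑ d, (∑ e, J⁻¹ e i * H' e c d) • (Qx π' c * Qx π' d) := by
        simp only [Finset.smul_sum, Finset.sum_smul, smul_smul]
        exact sum_rotate₃ _
      rw [e2]
      simp only [hH2, map_sum, pullback_smul, map_mul, h.pullback_Qx hπ', Finset.sum_mul,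
        Finset.mul_sum, Finset.smul_sum, Finset.sum_smul, smul_mul_assoc, mul_smul_comm, smul_smul]
      refine (sum_rotate₄ _).trans ((sum_rotate₄ _).trans (Finset.sum_comm.trans ?_))
      refine Finset.sum_congr rfl fun _ _ => Finset.sum_congr rfl fun _ _ => Finset.sum_congr rfl fun _ _ =>
        Finset.sum_congr rfl fun _ _ => ?_
      congr 1; ring
    have e3 : contractQ pd π' H' (pullback res J pd (psi i))
        = ∑ a, J⁻¹ a i • Qp pd π' H' a + ∑ a, ∑ b, pd b (J⁻¹ a i) • (Qx π' b * mom a) := by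
      simp [pullback_psi', (isEvenDer_contractQ pd π' H').leibniz, Finset.sum_add_distrib]
    rw [contractQ_psi, e3, ← sub_eq_zero]
    refine eq_zero_of_add_self ?_
    have e4 : pullback res J pd (Qp pdA π H i) + pullback res J pd (Qp pdA π H i)
        = _ := (map_add _ _ _).symm.trans (congrArg _ (two_smul_Qp' pdA π H i))
    rw [map_add, map_neg, h.pullback_dBase_bivectorFn hπ hπ', e1] at e4
    have e5 : ∑ a, J⁻¹ a i • Qp pd π' H' a + ∑ a, J⁻¹ a i • Qp pd π' H' a = _ :=
      Finset.sum_add_distrib.symm.trans (Finset.sum_congr rfl fun a _ =>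
        (smul_add _ _ _).symm.trans (congrArg _ (two_smul_Qp' pd π' H' a)))
    rw [sub_add_sub_comm, add_add_add_comm, e4, e5]
    simp only [smul_add, smul_neg, Finset.sum_add_distrib, Finset.sum_neg_distrib]
    module

include hπ hπ' hH' in
theorem IsCoordChange.Qtilde_pullback (x : SFun n A) :
    Qtilde pd π' H' (pullback res J pd x) = pullback res J pd (Qtilde pdA π H x) := by
  simp only [Qtilde, LinearMap.add_apply, LinearMap.sub_apply, LinearMap.comp_apply, map_add, map_sub,
    h.deRham_pullback, h.contractQ_pullback hπ hπ' hH']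

/-- Evaluation on `p` gives the law for `ε`. On `ψ`, the inhomogeneous term contributes `∂_b(J⁻¹)
ε'`, which with `J⁻¹ ∂_b ε'` forms the derivative of `J⁻¹ ε' = res ε`; this cancels on both sides
and leaves the tensor law for `β`. -/
theorem IsCoordChange.epsField_pullback_iff (ε : Fin n → A) (β : Fin n → Fin n → A) (ε' : Fin n → B)
    (β' : Fin n → Fin n → B) :
    (∀ x : SFun n A, epsField ε' (fun i l => -β' i l - pd l (ε' i)) (pullback res J pd x)
        = pullback res J pd (epsField ε (fun i l => -β i l - pdA l (ε i)) x)) ↔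
      (∀ a, ε' a = ∑ i, J i a * res (ε i)) ∧
        ∀ a b, β' a b = ∑ i, ∑ j, J i a * J j b * res (β i j) := by
  have hc1 : ∀ i, epsField ε' (fun i l => -β' i l - pd l (ε' i)) (pullback res J pd (mom i))
      = (∑ a, J⁻¹ a i * ε' a) • 1 := by
    intro i
    simp [pullback_mom, Finset.sum_smul, smul_smul]
  have hc1' : ∀ i, pullback res J pd (epsField ε (fun i l => -β i l - pdA l (ε i)) (mom i))
      = res (ε i) • 1 := by
    intro i
    simp [pullback_smul]
  have hc2 : ∀ i, epsField ε' (fun i l => -β' i l - pd l (ε' i)) (pullback res J pd (psi i))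
      = ∑ b, (-∑ a, J⁻¹ a i * β' a b - pd b (∑ a, J⁻¹ a i * ε' a)) • theta b := by
    intro i
    have hD := isOddDer_epsField ε' (fun i l => -β' i l - pd l (ε' i))
    simp only [pullback_psi', map_sum, map_add, epsField_smul, epsField_psi, hD.leibniz, epsField_theta,
      epsField_mom, parity_theta, zero_mul, zero_add, mul_smul_comm, mul_one,
      Finset.sum_add_distrib, Derivation.leibniz, smul_eq_mul, sub_smul, add_smul, neg_smul, smul_neg,
      Finset.smul_sum, Finset.sum_smul, smul_smul, Finset.sum_neg_distrib, Finset.sum_sub_distrib,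
      smul_sub, mul_comm (ε' _)]
    rw [Finset.sum_comm, Finset.sum_comm (f := fun a b => (J⁻¹ a i * pd b (ε' a)) • (theta b : SFun n B)),
      Finset.sum_comm (f := fun a b => (pd b (J⁻¹ a i) * ε' a) • (theta b : SFun n B))]
    abel
  have hc2' : ∀ i, pullback res J pd (epsField ε (fun i l => -β i l - pdA l (ε i)) (psi i))
      = ∑ b, (-∑ j, res (β i j) * J j b - pd b (res (ε i))) • theta b := by
    intro i
    simp only [epsField_psi, map_sum, pullback_smul, pullback_theta, Finset.smul_sum, smul_smul, h.chain,
      map_sub, map_neg]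
    rw [Finset.sum_comm]
    simp only [← Finset.sum_smul, ← Finset.sum_neg_distrib, ← Finset.sum_sub_distrib]
    refine Finset.sum_congr rfl fun b _ => ?_
    congr 1
    exact Finset.sum_congr rfl fun j _ => by ring
  have hε := h.eq_sum_iff ε' fun i => res (ε i)
  have hβ : (∀ a b, β' a b = ∑ i, ∑ j, J i a * J j b * res (β i j)) ↔
      ∀ b i, ∑ a, J⁻¹ a i * β' a b = ∑ j, res (β i j) * J j b := by
    rw [forall_comm]
    refine forall_congr' fun b => ?_
    rw [← h.eq_sum_iff (fun a => β' a b) fun i => ∑ j, res (β i j) * J j b]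
    refine forall_congr' fun a => Eq.congr_right (Finset.sum_congr rfl fun i _ => ?_)
    rw [Finset.mul_sum]
    exact Finset.sum_congr rfl fun j _ => by ring
  rw [hε, hβ]
  constructor
  · intro H
    have H1 : ∀ i, ∑ a, J⁻¹ a i * ε' a = res (ε i) := fun i =>
      smul_one_injective ((hc1 i).symm.trans ((H _).trans (hc1' i)))
    refine ⟨H1, fun b i => ?_⟩
    have H2 := sum_smul_theta_injective ((hc2 i).symm.trans ((H _).trans (hc2' i))) b
    rw [H1] at H2
    exact neg_injective (sub_left_injective H2)
  · rintro ⟨H1, H2⟩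
    refine (isOddDer_epsField _ _).natural (isOddDer_epsField _ _) (fun f => ?_) (fun i => ?_)
      (fun i => ?_) fun i => ?_
    · simp
    · simp [pullback_theta]
    · rw [hc1, hc1', H1]
    · simp only [hc2, hc2', H1, H2]

end Naturality

/-! ## Coordinate derivations in overlapping charts -/

section ChartCalculus

variable {n : ℕ} {M : Type*} [TopologicalSpace M] [ChartedSpace (EuclideanSpace ℝ (Fin n)) M]

theorem Chart.pd_apply (c : Chart n M) (i : Fin n) (f : c.Fun) (q : c.dom) :
    c.pd i f q = fderiv ℝ (c.expr f) (c.1 q.1) (EuclideanSpace.single i 1) := rfl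

theorem Chart.pd_comm (c : Chart n M) (i j : Fin n) (f : c.Fun) :
    c.pd i (c.pd j f) = c.pd j (c.pd i f) := by
  ext q
  have hq := c.1.map_source q.2
  have hf : ContDiffAt ℝ ∞ (c.expr f) (c.1 q.1) :=
    (c.contDiffOn_expr f).contDiffAt (c.1.open_target.mem_nhds hq)
  have hd : DifferentiableAt ℝ (fderiv ℝ (c.expr f)) (c.1 q.1) :=
    (hf.fderiv_right (m := ∞) (by simp)).differentiableAt (by simp)
  have key : ∀ k l, c.pd k (c.pd l f) q = fderiv ℝ (fderiv ℝ (c.expr f)) (c.1 q.1)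
      (EuclideanSpace.single k 1) (EuclideanSpace.single l 1) := by
    intro k l
    have he : c.expr (c.pd l f) =ᶠ[nhds (c.1 q.1)]
        fun y => fderiv ℝ (c.expr f) y (EuclideanSpace.single l 1) := by
      filter_upwards [c.1.open_target.mem_nhds hq] with y hy
      rw [c.expr_apply _ hy, c.pd_apply, c.1.right_inv hy]
    rw [c.pd_apply, he.fderiv_eq, fderiv_clm_apply hd (differentiableAt_const _)]
    simp
  rw [key, key]
  exact (hf.isSymmSndFDerivAt (by simp [minSmoothness_of_isRCLikeNormedField]; exact WithTop.coe_le_coe.mpr le_top)) _ _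

theorem Chart.pd_coord (c : Chart n M) (i j : Fin n) :
    c.pd i (c.coord j) = if i = j then 1 else 0 := by
  ext q
  have he : c.expr (c.coord j) =ᶠ[nhds (c.1 q.1)] EuclideanSpace.proj (𝕜 := ℝ) j := by
    filter_upwards [c.1.open_target.mem_nhds (c.1.map_source q.2)] with y hy
    rw [c.expr_apply _ hy]
    exact congrArg (fun z : EuclideanSpace ℝ (Fin n) => z j) (c.1.right_inv hy)
  rw [c.pd_apply, he.fderiv_eq, ContinuousLinearMap.fderiv]
  split_ifs with hij
  · subst hij; simp
  · simp [Ne.symm hij]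

/-- The chain rule for the transition map `τ` between the two charts, whose component derivatives
are the entries of the Jacobian. -/
theorem Chart.pd_res {c c' : Chart n M} (h : c'.dom ≤ c.dom) (a : Fin n) (f : c.Fun) :
    c'.pd a (Chart.res h f) = ∑ i, Chart.jac h i a * Chart.res h (c.pd i f) := by
  ext q
  have hq := c'.1.map_source q.2
  have hqc : q.1 ∈ c.1.source := h q.2
  set τ : EuclideanSpace ℝ (Fin n) → EuclideanSpace ℝ (Fin n) := fun y => c.1 (c'.1.symm y) with hτ
  have hτq : τ (c'.1 q.1) = c.1 q.1 := by rw [hτ]; simp only [c'.1.left_inv q.2]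
  have hcoord : ∀ i, c'.expr (Chart.res h (c.coord i)) =ᶠ[nhds (c'.1 q.1)] fun y => τ y i := by
    intro i
    filter_upwards [c'.1.open_target.mem_nhds hq] with y hy
    rw [c'.expr_apply _ hy]; rfl
  have hcomp : c'.expr (Chart.res h f) =ᶠ[nhds (c'.1 q.1)] c.expr f ∘ τ := by
    filter_upwards [c'.1.open_target.mem_nhds hq] with y hy
    have hy' : c'.1.symm y ∈ c.1.source := h (c'.1.map_target hy)
    rw [c'.expr_apply _ hy, Function.comp_apply, hτ, c.expr_apply _ (c.1.map_source hy')]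
    exact congrArg f (Subtype.ext (c.1.left_inv hy').symm)
  have hdi : ∀ i, DifferentiableAt ℝ (fun y => τ y i) (c'.1 q.1) := fun i =>
    (hcoord i).differentiableAt_iff.mp (c'.differentiableAt_expr _ q)
  have hd : DifferentiableAt ℝ τ (c'.1 q.1) := differentiableAt_euclidean.mpr hdi
  have hdf : DifferentiableAt ℝ (c.expr f) (τ (c'.1 q.1)) :=
    hτq ▸ c.differentiableAt_expr f ⟨q.1, hqc⟩
  have hi : ∀ i, fderiv ℝ τ (c'.1 q.1) (EuclideanSpace.single a 1) i = Chart.jac h i a q := by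
    intro i
    rw [Chart.jac, c'.pd_apply, (hcoord i).fderiv_eq]
    have := ((EuclideanSpace.proj (𝕜 := ℝ) i).hasFDerivAt.comp _ hd.hasFDerivAt).fderiv
    exact (congrArg (fun L => L (EuclideanSpace.single a 1)) this).symm
  rw [c'.pd_apply, hcomp.fderiv_eq, fderiv_comp _ hdf hd, ContinuousLinearMap.comp_apply, hτq]
  have hs : fderiv ℝ τ (c'.1 q.1) (EuclideanSpace.single a 1)
      = ∑ i, Chart.jac h i a q • EuclideanSpace.single i (1 : ℝ) := by
    ext k
    rw [hi]
    simp [Pi.single_apply]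
  rw [hs, map_sum]
  simp only [map_smul, smul_eq_mul]
  have : ∀ (g : Fin n → c'.Fun), (∑ i, g i) q = ∑ i, g i q := fun g =>
    map_sum (ContMDiffMap.evalRingHom q) g _
  rw [this]
  rfl

/-- Shrinking the larger chart to the smaller domain keeps its coordinates, so the chain rule can
also be applied in the opposite direction. -/
theorem Chart.exists_restrict [IsManifold (𝓡 n) ∞ M] {c c' : Chart n M} (h : c'.dom ≤ c.dom) :
    ∃ c'' : Chart n M, c''.dom = c'.dom ∧ ∀ q, c''.1 q = c.1 q := by
  refine ⟨⟨c.1.restr c'.dom, restr_mem_maximalAtlas _ c.2 c'.dom.2⟩, ?_, fun _ => rfl⟩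
  refine TopologicalSpace.Opens.ext ?_
  change c.1.source ∩ interior (c'.dom : Set M) = c'.dom
  exact (congrArg _ c'.dom.isOpen.interior_eq).trans (Set.inter_eq_right.mpr h)

theorem Chart.isUnit_det_jac [IsManifold (𝓡 n) ∞ M] {c c' : Chart n M} (h : c'.dom ≤ c.dom) :
    IsUnit (Chart.jac h).det := by
  obtain ⟨c'', hdom, hc⟩ := Chart.exists_restrict h
  have h1 : c''.dom ≤ c'.dom := hdom.le
  have h2 : c'.dom ≤ c''.dom := hdom.ge
  refine Matrix.isUnit_det_of_right_inverse (B := Matrix.of fun a i => Chart.res h2 (Chart.jac h1 a i)) ?_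
  refine Matrix.ext fun i j => ?_
  -- The chain rule from `c'` to the restricted chart, applied to the coordinates of `c` themselves:
  -- their derivatives are Kronecker deltas, which exhibits a right inverse of the Jacobian.
  have e := Chart.pd_res h1 j (Chart.res h (c.coord i))
  have e1 : Chart.res h1 (Chart.res h (c.coord i)) = c''.coord i := by
    ext q
    exact congrArg (fun z : EuclideanSpace ℝ (Fin n) => z i) (hc q.1).symm
  rw [e1, c''.pd_coord] at e
  have e2 := congrArg (Chart.res h2) e
  have e3 : ∀ f : c'.Fun, Chart.res h2 (Chart.res h1 f) = f := fun f => by ext q; rfl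
  simp only [map_sum, map_mul, e3] at e2
  rw [Matrix.mul_apply, Matrix.one_apply]
  have e4 : Chart.res h2 (if j = i then 1 else 0) = if i = j then 1 else 0 := by
    split_ifs with h3 h4 h4
    · exact map_one _
    · exact absurd h3.symm h4
    · exact absurd h4.symm h3
    · exact map_zero _
  rw [e4] at e2
  rw [e2]
  exact Finset.sum_congr rfl fun a _ => mul_comm _ _

theorem Chart.isCoordChange [IsManifold (𝓡 n) ∞ M] {c c' : Chart n M} (h : c'.dom ≤ c.dom) :
    IsCoordChange (Chart.res h) (Chart.jac h) c.pd c'.pd where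
  chain := Chart.pd_res h
  symm _ a b := c'.pd_comm b a _
  isUnit := Chart.isUnit_det_jac h
  comm := c'.pd_comm

end ChartCalculus

/-! ## Lie algebras on subspaces and semidirect sums -/

section Abstract

/-- `br` restricts to a Lie bracket on the subspace `S`. -/
structure IsLieBracketOn {V : Type*} [AddCommGroup V] [Module ℝ V] (S : Submodule ℝ V)
    (br : V → V → V) : Prop where
  mem : ∀ x ∈ S, ∀ y ∈ S, br x y ∈ S
  add_left : ∀ x y z, br (x + y) z = br x z + br y z
  add_right : ∀ x y z, br x (y + z) = br x y + br x z
  smul_right : ∀ (r : ℝ) x y, br x (r • y) = r • br x y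
  self : ∀ x ∈ S, br x x = 0
  leibniz : ∀ x ∈ S, ∀ y ∈ S, ∀ z ∈ S, br x (br y z) = br (br x y) z + br y (br x z)

namespace IsLieBracketOn

variable {V : Type*} [AddCommGroup V] [Module ℝ V] {S : Submodule ℝ V} {br : V → V → V}

/-- The Lie ring structure on the subspace. -/
abbrev lieRing (h : IsLieBracketOn S br) : LieRing (S : Set V) :=
  { (inferInstanceAs (AddCommGroup S) : AddCommGroup (S : Set V)) with
    bracket := fun x y => ⟨br x y, h.mem x x.2 y y.2⟩
    add_lie := fun x y z => Subtype.ext (h.add_left x y z)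
    lie_add := fun x y z => Subtype.ext (h.add_right x y z)
    lie_self := fun x => Subtype.ext (h.self x x.2)
    leibniz_lie := fun x y z => Subtype.ext (h.leibniz x x.2 y y.2 z z.2) }

/-- The Lie algebra structure on the subspace. -/
abbrev lieAlgebra (h : IsLieBracketOn S br) : @LieAlgebra ℝ (S : Set V) _ h.lieRing :=
  letI := h.lieRing
  { (inferInstanceAs (Module ℝ S) : Module ℝ (S : Set V)) with
    lie_smul := fun r x y => Subtype.ext (h.smul_right r x y) }

theorem isInducedLie (h : IsLieBracketOn S br) :
    @IsInducedLie V _ _ (S : Set V) h.lieRing h.lieAlgebra br :=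
  letI := h.lieRing
  letI := h.lieAlgebra
  { coe_add := fun _ _ => rfl
    coe_smul := fun _ _ => rfl
    coe_lie := fun _ _ => rfl }

end IsLieBracketOn

variable {V₁ V₂ W : Type*} [AddCommGroup V₁] [Module ℝ V₁] [AddCommGroup V₂] [Module ℝ V₂]
  [AddCommGroup W] [Module ℝ W]

/-- A Lie bracket on `G ⊆ W` that is, in terms of a parametrisation of `G` by `E × K`, the
semidirect bracket of operations `f` on `E`, `t` on `K` and `r` of `E` on `K`. -/
structure SemidirectData (E : Submodule ℝ V₁) (K : Submodule ℝ V₂) (G : Submodule ℝ W)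
    (f : V₁ → V₁ → V₁) (t : V₂ → V₂ → V₂) (r : V₁ → V₂ → V₂) (br : W → W → W) where
  /-- the parametrisation -/
  Φ : V₁ × V₂ →ₗ[ℝ] W
  lie : IsLieBracketOn G br
  inj : Function.Injective Φ
  mem_iff : ∀ u, Φ u ∈ G ↔ u.1 ∈ E ∧ u.2 ∈ K
  surj : ∀ w ∈ G, ∃ u, Φ u = w
  br_eq : ∀ a b a' b', br (Φ (a, b)) (Φ (a', b')) = Φ (f a a', t b b' + r a b' - r a' b)
  f_zero : ∀ a, f a 0 = 0
  zero_f : ∀ a, f 0 a = 0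
  t_zero : ∀ b, t b 0 = 0
  zero_t : ∀ b, t 0 b = 0
  r_zero : ∀ a, r a 0 = 0
  zero_r : ∀ b, r 0 b = 0

namespace SemidirectData

variable {E : Submodule ℝ V₁} {K : Submodule ℝ V₂} {G : Submodule ℝ W}
    {f : V₁ → V₁ → V₁} {t : V₂ → V₂ → V₂} {r : V₁ → V₂ → V₂} {br : W → W → W}
    (h : SemidirectData E K G f t r br)
include h

theorem br_f (a a' : V₁) : br (h.Φ (a, 0)) (h.Φ (a', 0)) = h.Φ (f a a', 0) := by
  rw [h.br_eq, h.t_zero, h.r_zero, h.r_zero, sub_zero, add_zero]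

theorem br_t (b b' : V₂) : br (h.Φ (0, b)) (h.Φ (0, b')) = h.Φ (0, t b b') := by
  rw [h.br_eq, h.zero_f, h.zero_r, h.zero_r, sub_zero, add_zero]

theorem br_r (a : V₁) (b : V₂) : br (h.Φ (a, 0)) (h.Φ (0, b)) = h.Φ (0, r a b) := by
  rw [h.br_eq, h.f_zero, h.zero_r, h.zero_t, sub_zero, zero_add]

theorem left_mem {a : V₁} (ha : a ∈ E) : h.Φ (a, 0) ∈ G := (h.mem_iff _).mpr ⟨ha, K.zero_mem⟩

theorem right_mem {b : V₂} (hb : b ∈ K) : h.Φ (0, b) ∈ G := (h.mem_iff _).mpr ⟨E.zero_mem, hb⟩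

theorem left_add (a a' : V₁) : h.Φ (a + a', 0) = h.Φ (a, 0) + h.Φ (a', 0) := by
  rw [← map_add, Prod.mk_add_mk, add_zero]

theorem right_add (b b' : V₂) : h.Φ (0, b + b') = h.Φ (0, b) + h.Φ (0, b') := by
  rw [← map_add, Prod.mk_add_mk, add_zero]

theorem left_smul (c : ℝ) (a : V₁) : h.Φ (c • a, 0) = c • h.Φ (a, 0) := by
  rw [← map_smul, Prod.smul_mk, smul_zero]

theorem right_smul (c : ℝ) (b : V₂) : h.Φ (0, c • b) = c • h.Φ (0, b) := by
  rw [← map_smul, Prod.smul_mk, smul_zero]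

theorem left_inj {a a' : V₁} (e : h.Φ (a, 0) = h.Φ (a', 0)) : a = a' := congrArg Prod.fst (h.inj e)

theorem right_inj {b b' : V₂} (e : h.Φ (0, b) = h.Φ (0, b')) : b = b' := congrArg Prod.snd (h.inj e)

/-- Each identity holds in `G` for the images of pairs `(a, 0)` and descends because `Φ` is
injective; closure descends by `mem_iff`. -/
theorem isLieBracketOn_left : IsLieBracketOn E f where
  mem a ha a' ha' := ((h.mem_iff _).mp
    (h.br_f a a' ▸ h.lie.mem _ (h.left_mem ha) _ (h.left_mem ha'))).1
  add_left a b c := h.left_inj (by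
    rw [← h.br_f, h.left_add, h.lie.add_left, h.br_f, h.br_f, h.left_add])
  add_right a b c := h.left_inj (by
    rw [← h.br_f, h.left_add, h.lie.add_right, h.br_f, h.br_f, h.left_add])
  smul_right c a b := h.left_inj (by
    rw [← h.br_f, h.left_smul, h.lie.smul_right, h.br_f, h.left_smul])
  self a ha := h.left_inj (by
    rw [← h.br_f, h.lie.self _ (h.left_mem ha)]; exact (map_zero h.Φ).symm)
  leibniz a ha b hb c hc := h.left_inj (by
    rw [← h.br_f, ← h.br_f, h.lie.leibniz _ (h.left_mem ha) _ (h.left_mem hb) _ (h.left_mem hc),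
      h.br_f, h.br_f, h.br_f, h.br_f, h.left_add])

theorem isLieBracketOn_right : IsLieBracketOn K t where
  mem a ha a' ha' := ((h.mem_iff _).mp
    (h.br_t a a' ▸ h.lie.mem _ (h.right_mem ha) _ (h.right_mem ha'))).2
  add_left a b c := h.right_inj (by
    rw [← h.br_t, h.right_add, h.lie.add_left, h.br_t, h.br_t, h.right_add])
  add_right a b c := h.right_inj (by
    rw [← h.br_t, h.right_add, h.lie.add_right, h.br_t, h.br_t, h.right_add])
  smul_right c a b := h.right_inj (by
    rw [← h.br_t, h.right_smul, h.lie.smul_right, h.br_t, h.right_smul])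
  self a ha := h.right_inj (by
    rw [← h.br_t, h.lie.self _ (h.right_mem ha)]; exact (map_zero h.Φ).symm)
  leibniz a ha b hb c hc := h.right_inj (by
    rw [← h.br_t, ← h.br_t, h.lie.leibniz _ (h.right_mem ha) _ (h.right_mem hb) _ (h.right_mem hc),
      h.br_t, h.br_t, h.br_t, h.br_t, h.right_add])

theorem r_mem {a : V₁} (ha : a ∈ E) {b : V₂} (hb : b ∈ K) : r a b ∈ K :=
  ((h.mem_iff _).mp (h.br_r a b ▸ h.lie.mem _ (h.left_mem ha) _ (h.right_mem hb))).2

theorem r_add (a : V₁) (b b' : V₂) : r a (b + b') = r a b + r a b' := h.right_inj (by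
  rw [← h.br_r, h.right_add, h.lie.add_right, h.br_r, h.br_r, h.right_add])

theorem add_r (a a' : V₁) (b : V₂) : r (a + a') b = r a b + r a' b := h.right_inj (by
  rw [← h.br_r, h.left_add, h.lie.add_left, h.br_r, h.br_r, h.right_add])

theorem r_smul (c : ℝ) (a : V₁) (b : V₂) : r a (c • b) = c • r a b := h.right_inj (by
  rw [← h.br_r, h.right_smul, h.lie.smul_right, h.br_r, h.right_smul])

theorem r_t {a : V₁} (ha : a ∈ E) {b b' : V₂} (hb : b ∈ K) (hb' : b' ∈ K) :
    r a (t b b') = t (r a b) b' + t b (r a b') := h.right_inj (by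
  rw [← h.br_r, ← h.br_t, h.lie.leibniz _ (h.left_mem ha) _ (h.right_mem hb) _ (h.right_mem hb'),
      h.br_r, h.br_r, h.br_t, h.br_t, h.right_add])

/-- The Jacobi identity of `G` for two elements of `E` and one of `K`; `r_t` is the case of one and
two. -/
theorem f_r {a a' : V₁} (ha : a ∈ E) (ha' : a' ∈ E) {b : V₂} (hb : b ∈ K) :
    r a (r a' b) = r (f a a') b + r a' (r a b) := h.right_inj (by
  rw [← h.br_r, ← h.br_r, h.lie.leibniz _ (h.left_mem ha) _ (h.left_mem ha') _ (h.right_mem hb),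
      h.br_f, h.br_r, h.br_r, h.br_r, h.right_add])

theorem br_skew {x y : W} (hx : x ∈ G) (hy : y ∈ G) : br x y = -br y x := by
  have e := h.lie.self _ (G.add_mem hx hy)
  rw [h.lie.add_left, h.lie.add_right, h.lie.add_right, h.lie.self _ hx, h.lie.self _ hy, zero_add,
    add_zero] at e
  exact eq_neg_of_add_eq_zero_left e

/-- Homogeneity is available only in the right argument of the bracket, so the scalar is moved there
by skew-symmetry, which holds only on `G`. -/
theorem smul_r (c : ℝ) {a : V₁} (ha : a ∈ E) {b : V₂} (hb : b ∈ K) : r (c • a) b = c • r a b :=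
  h.right_inj (by
    rw [← h.br_r, h.br_skew (h.left_mem (E.smul_mem c ha)) (h.right_mem hb), h.left_smul,
      h.lie.smul_right, h.br_skew (h.right_mem hb) (h.left_mem ha), smul_neg, neg_neg, h.br_r,
      h.right_smul])

theorem exists_semiDirectSum :
    ∃ (_ : LieRing (G : Set W)) (_ : LieAlgebra ℝ (G : Set W))
      (_ : LieRing (E : Set V₁)) (_ : LieAlgebra ℝ (E : Set V₁))
      (_ : LieRing (K : Set V₂)) (_ : LieAlgebra ℝ (K : Set V₂))
      (ρ : (E : Set V₁) →ₗ⁅ℝ⁆ LieDerivation ℝ (K : Set V₂) (K : Set V₂)),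
      IsInducedLie (G : Set W) br ∧ IsInducedLie (E : Set V₁) f ∧ IsInducedLie (K : Set V₂) t ∧
      (∀ (a : (E : Set V₁)) (b : (K : Set V₂)), (ρ a b : V₂) = r a b) ∧
      Nonempty ((G : Set W) ≃ₗ⁅ℝ⁆ LieAlgebra.SemiDirectSum (K : Set V₂) (E : Set V₁) ρ) := by
  let iG := h.lie.lieRing
  let iG' := h.lie.lieAlgebra
  let iE := h.isLieBracketOn_left.lieRing
  let iE' := h.isLieBracketOn_left.lieAlgebra
  let iK := h.isLieBracketOn_right.lieRing
  let iK' := h.isLieBracketOn_right.lieAlgebra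
  let D : ↥(E : Set V₁) → LieDerivation ℝ (K : Set V₂) (K : Set V₂) := fun a =>
    { toFun := fun b => ⟨r a b, h.r_mem a.2 b.2⟩
      map_add' := fun b b' => Subtype.ext (h.r_add a b b')
      map_smul' := fun c b => Subtype.ext (h.r_smul c a b)
      leibniz' := fun b b' => by
        -- `LieDerivation` states its Leibniz rule as a difference of two brackets; skew-symmetry
        -- brings it to the form of `r_t`.
        rw [sub_eq_add_neg, lie_skew, add_comm]
        exact Subtype.ext (h.r_t a.2 b.2 b'.2) }
  let ρ : (E : Set V₁) →ₗ⁅ℝ⁆ LieDerivation ℝ (K : Set V₂) (K : Set V₂) :=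
    { toFun := D
      map_add' := fun a a' => LieDerivation.ext fun b => Subtype.ext (h.add_r a a' b)
      map_smul' := fun c a => LieDerivation.ext fun b => Subtype.ext (h.smul_r c a.2 b.2)
      map_lie' := fun {a a'} => LieDerivation.ext fun b => by
        rw [LieDerivation.lie_apply, eq_sub_iff_add_eq]
        exact Subtype.ext (h.f_r a.2 a'.2 b.2).symm }
  let Ψ : LieAlgebra.SemiDirectSum (K : Set V₂) (E : Set V₁) ρ →ₗ⁅ℝ⁆ (G : Set W) :=
    { toFun := fun u => ⟨h.Φ (u.right, u.left), (h.mem_iff _).mpr ⟨u.right.2, u.left.2⟩⟩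
      map_add' := fun u v => Subtype.ext (h.Φ.map_add (u.right, u.left) (v.right, v.left))
      map_smul' := fun c u => Subtype.ext (h.Φ.map_smul c (u.right, u.left))
      map_lie' := fun {u v} => Subtype.ext (h.br_eq u.right u.left v.right v.left).symm }
  have hΨ : Function.Bijective Ψ := by
    refine ⟨fun u v e => ?_, fun w => ?_⟩
    · have e' := h.inj (congrArg Subtype.val e)
      exact LieAlgebra.SemiDirectSum.ext (Subtype.ext (congrArg Prod.snd e'))
        (Subtype.ext (congrArg Prod.fst e'))
    · obtain ⟨u, hu⟩ := h.surj w w.2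
      have hm := (h.mem_iff u).mp (hu ▸ w.2)
      exact ⟨⟨⟨u.2, hm.2⟩, ⟨u.1, hm.1⟩⟩, Subtype.ext hu⟩
  exact ⟨iG, iG', iE, iE', iK, iK', ρ, h.lie.isInducedLie, h.isLieBracketOn_left.isInducedLie,
    h.isLieBracketOn_right.isInducedLie, fun _ _ => rfl, ⟨(LieEquiv.ofBijective Ψ hΨ).symm⟩⟩

end SemidirectData

end Abstract

/-! ## The vector fields on `T[1]T^*[1]M` -/

section Global

variable {n : ℕ}

theorem epsField_add {A : Type*} [CommRing A] [Algebra ℝ A] (ε ε' : Fin n → A)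
    (α α' : Fin n → Fin n → A) :
    epsField (ε + ε') (α + α') = epsField ε α + epsField ε' α' := by
  ext x
  simp only [epsField, lmul, LinearMap.add_apply, LinearMap.sum_apply, LinearMap.comp_apply,
    LinearMap.mulLeft_apply, Pi.add_apply, fn, map_add, add_mul, Finset.sum_add_distrib]
  abel

theorem epsField_real_smul {A : Type*} [CommRing A] [Algebra ℝ A] (r : ℝ) (ε : Fin n → A)
    (α : Fin n → Fin n → A) : epsField (r • ε) (r • α) = r • epsField ε α := by
  ext x
  simp only [epsField, lmul, LinearMap.add_apply, LinearMap.sum_apply, LinearMap.comp_apply,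
    LinearMap.mulLeft_apply, LinearMap.smul_apply, Pi.smul_apply, fn, map_smul, smul_mul_assoc,
    ← Finset.smul_sum, smul_add]

variable (M : Type*) [TopologicalSpace M] [ChartedSpace (EuclideanSpace ℝ (Fin n)) M]

variable (n) in
/-- The real vector space of 1-forms. -/
def oneFormsSubmodule : Submodule ℝ (Comp1 n M) where
  carrier := OneForms n M
  add_mem' {x y} hx hy c c' h a := by
    simp only [Pi.add_apply, hx c c' h a, hy c c' h a, map_add, mul_add, Finset.sum_add_distrib]
  zero_mem' c c' h a := by simp
  smul_mem' r x hx c c' h a := by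
    simp only [Pi.smul_apply, hx c c' h a, map_smul, mul_smul_comm, Finset.smul_sum]

variable (n) in
/-- The real vector space of covariant 2-tensor fields. -/
def covTensorsSubmodule : Submodule ℝ (Comp2 n M) where
  carrier := CovTensors n M
  add_mem' {x y} hx hy c c' h a b := by
    simp only [Pi.add_apply, hx c c' h a b, hy c c' h a b, map_add, mul_add, Finset.sum_add_distrib]
  zero_mem' c c' h a b := by simp
  smul_mem' r x hx c c' h a b := by
    simp only [Pi.smul_apply, hx c c' h a b, map_smul, mul_smul_comm, Finset.smul_sum]

variable (n) in
/-- The real vector space `𝒢̃` of vector fields. -/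
def epsFieldsSubmodule : Submodule ℝ (Ops n M) where
  carrier := EpsFields n M
  add_mem' {x y} hx hy := by
    refine ⟨fun c => ?_, fun c c' h F => ?_⟩
    · obtain ⟨ε, α, e⟩ := hx.1 c
      obtain ⟨ε', α', e'⟩ := hy.1 c
      exact ⟨ε + ε', α + α', by rw [Pi.add_apply, e, e', epsField_add]⟩
    · simp only [Pi.add_apply, LinearMap.add_apply, hx.2 c c' h F, hy.2 c c' h F, map_add]
  zero_mem' := ⟨fun c => ⟨0, 0, by simpa using (epsField_real_smul (A := c.Fun) 0 0 0).symm⟩,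
    fun c c' h F => by simp⟩
  smul_mem' r x hx := by
    refine ⟨fun c => ?_, fun c c' h F => ?_⟩
    · obtain ⟨ε, α, e⟩ := hx.1 c
      exact ⟨r • ε, r • α, by rw [Pi.smul_apply, e, epsField_real_smul]⟩
    · simp only [Pi.smul_apply, LinearMap.smul_apply, hx.2 c c' h F, map_smul]

variable (n) in
/-- The vector fields with components `ε` and `α_{ij} = -β_{ij} - ∂_j ε_i`, for families of
components `ε`, `β` of a 1-form and of a covariant 2-tensor. -/
def epsParam : Comp1 n M × Comp2 n M →ₗ[ℝ] Ops n M where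
  toFun u c := epsField (u.1 c) (fun i l => -u.2 c i l - c.pd l (u.1 c i))
  map_add' u v := by
    funext c
    rw [Pi.add_apply, ← epsField_add]
    congr 1
    funext i l
    simp only [Prod.fst_add, Prod.snd_add, Pi.add_apply, map_add]
    ring
  map_smul' r u := by
    funext c
    rw [Pi.smul_apply, RingHom.id_apply, ← epsField_real_smul]
    congr 1
    funext i l
    simp only [Prod.smul_fst, Prod.smul_snd, Pi.smul_apply, smul_sub, smul_neg]
    exact congrArg _ ((c.pd l).toLinearMap.map_smul r (u.1 c i))

theorem epsParam_injective : Function.Injective (epsParam n M) := by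
  rintro ⟨ε, β⟩ ⟨ε', β'⟩ h
  have h1 : ∀ c, ε c = ε' c ∧ β c = β' c := by
    intro c
    obtain ⟨e1, e2⟩ := epsField_injective (congrFun h c)
    refine ⟨e1, funext fun i => funext fun l => ?_⟩
    have := congrFun (congrFun e2 i) l
    rw [e1] at this
    exact neg_injective (sub_left_injective this)
  exact Prod.ext (funext fun c => (h1 c).1) (funext fun c => (h1 c).2)

/-- The substitution `α = -β - ∂ε` is inverted chart by chart; the tensor laws of the resulting `ε`
and `β` come afterwards from `epsParam_mem_iff`. -/
theorem exists_epsParam_eq {D : Ops n M} (hD : D ∈ EpsFields n M) : ∃ u, epsParam n M u = D := by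
  choose ε α h using hD.1
  refine ⟨(ε, fun c i l => -α c i l - c.pd l (ε c i)), funext fun c => ?_⟩
  rw [h]
  change epsField (ε c) _ = _
  congr 1
  funext i l
  ring

variable [IsManifold (𝓡 n) ∞ M]

theorem epsParam_mem_iff (u : Comp1 n M × Comp2 n M) :
    epsParam n M u ∈ EpsFields n M ↔ u.1 ∈ OneForms n M ∧ u.2 ∈ CovTensors n M := by
  have key : ∀ (c c' : Chart n M) (h : c'.dom ≤ c.dom), _ := fun c c' h =>
    (Chart.isCoordChange h).epsField_pullback_iff (u.1 c) (u.2 c) (u.1 c') (u.2 c')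
  constructor
  · intro hu
    exact ⟨fun c c' h => ((key c c' h).mp (hu.2 c c' h)).1, fun c c' h => ((key c c' h).mp (hu.2 c c' h)).2⟩
  · intro hu
    exact ⟨fun c => ⟨_, _, rfl⟩, fun c c' h => (key c c' h).mpr ⟨hu.1 c c' h, hu.2 c c' h⟩⟩

variable {M}
variable (P : TwistedPoisson n M)

omit [IsManifold (𝓡 n) ∞ M] in
theorem TwistedPoisson.structC_skew (c : Chart n M) (i j k : Fin n) :
    structC c.pd (P.π c) (P.H c) i k j = -structC c.pd (P.π c) (P.H c) i j k :=
  TwistedPSM.structC_skew _ _ _ (P.bivector.1 c) (fun i j k => (P.threeForm.1 c i j k).2) i j k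

/-- The coordinate form of a bracket is local, its compatibility with chart changes is that of `Q̃`
and of the two fields, and the Jacobi identity uses `Qtilde_sq` in each chart. -/
theorem TwistedPoisson.isLieBracketOn : IsLieBracketOn (epsFieldsSubmodule n M) P.opBracket where
  mem x hx y hy := by
    refine ⟨fun c => ?_, fun c c' h F => ?_⟩
    · obtain ⟨ε, α, e⟩ := hx.1 c
      obtain ⟨ε', α', e'⟩ := hy.1 c
      have := derivedBracket_epsField ε ε' α α' _ _ _ (P.structC_skew c)
      rw [← e, ← e'] at this
      exact ⟨_, _, this⟩
    · have hQ : ∀ F, P.Q c' (Chart.pull h F) = Chart.pull h (P.Q c F) :=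
        (Chart.isCoordChange h).Qtilde_pullback (P.bivector.1 c) (P.bivector.2 c c' h)
          (P.threeForm.2 c c' h)
      simp only [opBracket, derivedBracket, LinearMap.sub_apply, LinearMap.add_apply,
        LinearMap.comp_apply, hx.2 c c' h, hy.2 c c' h, hQ, map_add, map_sub]
  add_left x y z := by
    funext c
    simp only [opBracket, derivedBracket, Pi.add_apply, LinearMap.comp_add, LinearMap.add_comp]
    abel
  add_right x y z := by
    funext c
    simp only [opBracket, derivedBracket, Pi.add_apply, LinearMap.comp_add, LinearMap.add_comp]
    abel
  smul_right r x y := by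
    funext c
    simp only [opBracket, derivedBracket, Pi.smul_apply, LinearMap.comp_smul, LinearMap.smul_comp,
      ← smul_add]
    exact (smul_sub _ _ _).symm
  self x hx := by
    funext c
    obtain ⟨ε, α, e⟩ := hx.1 c
    have := derivedBracket_skew (Q := P.Q c) (epsField_anticomm ε ε α α)
    rw [eq_neg_iff_add_eq_zero, ← two_smul ℝ] at this
    rw [opBracket, e]
    exact (smul_eq_zero_iff_right two_ne_zero).mp this
  leibniz x hx y hy z hz := by
    funext c
    obtain ⟨ε₁, α₁, e₁⟩ := hx.1 c
    obtain ⟨ε₂, α₂, e₂⟩ := hy.1 c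
    obtain ⟨ε₃, α₃, e₃⟩ := hz.1 c
    simp only [opBracket, Pi.add_apply, e₁, e₂, e₃]
    refine derivedBracket_leibniz (Qtilde_sq _ _ _ (P.bivector.1 c) (P.threeForm.1 c) (P.jacobi c)
      c.pd_comm (P.closed c)) ?_
    rw [Q, derivedBracket_epsField _ _ _ _ _ _ _ (P.structC_skew c)]
    exact epsField_anticomm _ _ _ _

/-- The vector fields `𝒢̃` as a semidirect sum of 1-forms and covariant 2-tensor fields. -/
def TwistedPoisson.semidirectData : SemidirectData (oneFormsSubmodule n M) (covTensorsSubmodule n M)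
    (epsFieldsSubmodule n M) P.formBracket P.tensorBracket P.rho P.opBracket where
  Φ := epsParam n M
  lie := P.isLieBracketOn
  inj := epsParam_injective M
  mem_iff := epsParam_mem_iff M
  surj _ := exists_epsParam_eq M
  br_eq a b a' b' := by
    funext c
    refine (derivedBracket_epsField _ _ _ _ _ _ _ (P.structC_skew c)).trans ?_
    have e1 := derivedMom_eq (a c) (a' c) c.pd (P.π c) (P.H c) (P.bivector.1 c) (P.threeForm.1 c)
    have e2 := derivedPsi_eq (a c) (a' c) (b c) (b' c) c.pd (P.π c) (P.H c) c.pd_comm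
      (P.bivector.1 c) (P.threeForm.1 c)
    exact congrArg₂ epsField e1 e2
  f_zero a := by
    funext c i
    simp [formBracket, bracketForm, lie1, sharp, pair, contr2, contr3]
  zero_f a := by
    funext c i
    simp [formBracket, bracketForm, lie1, sharp, pair, contr2, contr3]
  t_zero b := by
    funext c i j
    simp [tensorBracket, bracketTensor, contr23]
  zero_t b := by
    funext c i j
    simp [tensorBracket, bracketTensor, contr23]
  r_zero a := by
    funext c i j
    simp [rho, action, lie2, contr23]
  zero_r b := by
    funext c i j
    simp [rho, action, lie2, contr23, DH, sharp, ext1, contr3]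

end Global

end

end TwistedPSM

theorem mainTheorem3 (n : ℕ) (M : Type*) [TopologicalSpace M]
    [ChartedSpace (EuclideanSpace ℝ (Fin n)) M] [IsManifold (𝓡 n) ∞ M]
    (P : TwistedPSM.TwistedPoisson n M) :
    ∃ (_ : LieRing (TwistedPSM.EpsFields n M)) (_ : LieAlgebra ℝ (TwistedPSM.EpsFields n M))
      (_ : LieRing (TwistedPSM.OneForms n M)) (_ : LieAlgebra ℝ (TwistedPSM.OneForms n M))
      (_ : LieRing (TwistedPSM.CovTensors n M)) (_ : LieAlgebra ℝ (TwistedPSM.CovTensors n M))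
      (ρ : TwistedPSM.OneForms n M →ₗ⁅ℝ⁆
        LieDerivation ℝ (TwistedPSM.CovTensors n M) (TwistedPSM.CovTensors n M)),
      TwistedPSM.IsInducedLie (TwistedPSM.EpsFields n M) P.opBracket ∧
      TwistedPSM.IsInducedLie (TwistedPSM.OneForms n M) P.formBracket ∧
      TwistedPSM.IsInducedLie (TwistedPSM.CovTensors n M) P.tensorBracket ∧
      (∀ (ε : TwistedPSM.OneForms n M) (α : TwistedPSM.CovTensors n M),
        (ρ ε α : TwistedPSM.Comp2 n M) = P.rho ε α) ∧
      Nonempty (TwistedPSM.EpsFields n M ≃ₗ⁅ℝ⁆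
        LieAlgebra.SemiDirectSum (TwistedPSM.CovTensors n M) (TwistedPSM.OneForms n M) ρ) :=
  P.semidirectData.exists_semiDirectSum
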